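/- Let $0<\alpha<1$, let $n\ge 2$ be an integer, and let $k_n=(-1)^{q+1}$ if $n=2q$, and $k_n\in\{1,-1\}$ (either choice) if $n$ is odd. For $x\in\mathbb R$, $t>0$ let $$p_n(x,t)=\frac1{2\pi}\int_{-\infty}^{+\infty}e^{ixz+k_nt(iz)^n}\,dz$$ (improper integral), let $W(x;\eta,\beta)=\sum_{j\ge0}\frac{x^j}{j!\,\Gamma(\eta j+\beta)}$ be the Wright function (with $1/\Gamma=0$ at the poles of $\Gamma$), and put $$\overline v_{2\alpha}(u,t)=\frac1{t^\alpha}\,W\Big(-\frac u{t^\alpha};-\alpha,1-\alpha\Big),\qquad u\ge 0,\ t>0 .$$ For $0<\nu<2$, an integer $m\ge1$ and $\kappa\in\mathbb R$, a fundamental solution of $\partial_t^\nu U=\kappa\,\partial_x^m U$ is a family $(U_t)_{t>0}$ of tempered distributions on $\mathbb R$ such that, for every Schwartz function $\varphi$, the function $g(t)=\langle U_t,\varphi\rangle$ is $C^{\lceil\nu\rceil}$ on $(0,\infty)$, its Caputo derivative $$D^\nu g(t)=\frac1{\Gamma(\lceil\nu\rceil-\nu)}\int_0^t\frac{g^{(\lceil\nu\rceil)}(z)}{(t-z)^{1+\nu-\lceil\nu\rceil}}\,dz\quad(\nu\ne1),\qquad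 D^1g=g',$$ exists for all $t>0$ (with an absolutely convergent integral) and equals $\kappa\,\langle\partial_x^mU_t,\varphi\rangle$, and $g(t)\to\varphi(0)$ as $t\downarrow0$ (that is, $U_0=\delta$); if $\nu>1$, also $g'(t)\to0$ as $t\downarrow0$. A function $u(x,t)$, continuous in $x$, is called the fundamental solution if the distributions $\varphi\mapsto\int_{\mathbb R}\varphi(x)u(x,t)\,dx$, $t>0$, form a fundamental solution and it is the only one. Then the improper integral defining $p_n(x,t)$ converges for all $x\in\mathbb R$ and $t>0$, the series of $W(\,\cdot\,;-\alpha,1-\alpha)$ converges on $\mathbb R$, and the following hold. 1. For each $t>0$, $\overline v_{2\alpha}(\cdot,t)$ is a probability density on $[0,\infty)$: it is non-negative and $\int_0^\infty\overline v_{2\alpha}(u,t)\,du=1$. It is the folded solution of a fractional diffusion equation of order $2\alpha$: the function $v_{2\alpha}(u,t)=\tfrac12\overline v_{2\alpha}(|u|,t)$, $u\in\mathbb R$, is the fundamental solution of $\partial_t^{2\alpha}v=\partial_u^2v$ (with $v(u,0)=\delta(u)$ and, for $\alpha>1/2$, $\partial_tv(u,0)=0$), and $v_{2\alpha}(u,t)\to0$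 as $|u|\to\infty$. 2. The fundamental solution of $$\frac{\partial^\alpha u}{\partial t^\alpha}=k_n\frac{\partial^nu}{\partial x^n},\qquad u(x,0)=\delta(x),$$ is $$u_\alpha(x,t)=\int_0^\infty p_n(x,u)\,\overline v_{2\alpha}(u,t)\,du,\qquad x\in\mathbb R,\ t>0,$$ where the integral converges absolutely. Equivalently, $u_\alpha(x,t)=\mathbb E\,p_n(x,\mathcal T_\alpha(t))$, where $\mathcal T_\alpha(t)$ is a random time with density $\overline v_{2\alpha}(\cdot,t)$. -/

import Mathlib

open MeasureTheory Filter Topology Set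
open scoped SchwartzMap

noncomputable section

namespace FracHeat

/-- `k` is an admissible coefficient `k_n` of the `n`-th order heat-type equation:
`k = (-1)^(q+1)` if `n = 2q`, and `k = 1` or `k = -1` if `n` is odd. -/
def IsHeatCoeff (n : ℕ) (k : ℝ) : Prop :=
  (∀ q : ℕ, n = 2 * q → k = (-1) ^ (q + 1)) ∧
  (∀ q : ℕ, n = 2 * q + 1 → k = 1 ∨ k = -1)

/-- The integrand `exp (i x z + k t (i z)^n)` of the kernel `p_n(x,t)`. -/
def heatIntegrand (n : ℕ) (k x t z : ℝ) : ℂ :=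
  Complex.exp (Complex.I * x * z + k * t * (Complex.I * z) ^ n)

/-- The integral of the integrand of `p_n` over `[a, b]`, divided by `2π`.
For odd `n` the integrand has modulus one, so the integral over `ℝ` is only an improper one. -/
def heatKernelTrunc (n : ℕ) (k x t : ℝ) (r : ℝ × ℝ) : ℂ :=
  (1 / (2 * Real.pi) : ℝ) * ∫ z in r.1..r.2, heatIntegrand n k x t z

/-- The kernel `p_n(x,t) = (2π)⁻¹ ∫_{-∞}^{∞} exp (i x z + k t (i z)^n) dz`, as an improper
integral, i.e. the limit of the integrals over `[a, b]` as `a → -∞`, `b → ∞` independently. -/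
def heatKernel (n : ℕ) (k x t : ℝ) : ℂ :=
  limUnder (atBot ×ˢ atTop) (heatKernelTrunc n k x t)

/-- The `j`-th term of the Wright function; `1 / Γ` is `0` at the poles of `Γ`, in agreement with
the convention `Real.Gamma (-m) = 0`. -/
def wrightTerm (x η β : ℝ) (j : ℕ) : ℝ :=
  x ^ j / (j.factorial * Real.Gamma (η * j + β))

/-- The Wright function `W(x; η, β)`. -/
def wright (x η β : ℝ) : ℝ := ∑' j : ℕ, wrightTerm x η β j

/-- `v̄_{2α}(u,t) = t^{-α} W(-u/t^α; -α, 1-α)` (used for `u ≥ 0`, `t > 0`). -/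
def vbar (α u t : ℝ) : ℝ := 1 / t ^ α * wright (-u / t ^ α) (-α) (1 - α)

/-- The law on `[0, ∞)` with density `v̄_{2α}(·,t)`: the law of the random time `𝒯_α(t)`. -/
def randomTimeLaw (α t : ℝ) : Measure ℝ :=
  (volume.restrict (Ici 0)).withDensity fun u => ENNReal.ofReal (vbar α u t)

/-- `u_α(x,t) = ∫_0^∞ p_n(x,u) v̄_{2α}(u,t) du`. -/
def uSol (α : ℝ) (n : ℕ) (k x t : ℝ) : ℂ :=
  ∫ u in Ioi (0 : ℝ), heatKernel n k x u * (vbar α u t : ℂ)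

/-- The Dzherbashyan-Caputo derivative of order `ν > 0` at `t > 0`, with `m = ⌈ν⌉`:
the ordinary derivative if `ν = m`, and otherwise (`m - 1 < ν < m`)
`Γ(m-ν)⁻¹ ∫_0^t f^{(m)}(z) (t-z)^{-(1+ν-m)} dz`. -/
def caputo (ν : ℝ) (f : ℝ → ℂ) (t : ℝ) : ℂ :=
  if ν = (⌈ν⌉₊ : ℝ) then iteratedDeriv ⌈ν⌉₊ f t
  else (1 / Real.Gamma (⌈ν⌉₊ - ν) : ℝ) *
    ∫ z in (0 : ℝ)..t, (((t - z) ^ (-(1 + ν - ⌈ν⌉₊)) : ℝ) : ℂ) * iteratedDeriv ⌈ν⌉₊ f z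

/-- `f` has a Caputo derivative of order `ν` on `(0, ∞)`: it is `C^m` there, `m = ⌈ν⌉`, and the
integral in the definition converges absolutely at each `t > 0`. -/
def CaputoRegular (ν : ℝ) (f : ℝ → ℂ) : Prop :=
  ContDiffOn ℝ (⌈ν⌉₊ : ℕ) f (Ioi 0) ∧
  (ν ≠ (⌈ν⌉₊ : ℝ) → ∀ t : ℝ, 0 < t → IntervalIntegrable
    (fun z => (((t - z) ^ (-(1 + ν - ⌈ν⌉₊)) : ℝ) : ℂ) * iteratedDeriv ⌈ν⌉₊ f z) volume 0 t)

/-- The family `U t`, `t > 0`, of tempered distributions on `ℝ` solves, for `0 < ν < 2`,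
`∂_t^ν U = k ∂_x^n U` for `t > 0`, with `U(·,0) = δ` and, if `ν > 1`, also `∂_t U(·,0) = 0`.
The space derivative is the distributional one, the time derivative is the Caputo derivative of
`t ↦ ⟨U t, φ⟩` for each test function `φ`, and the initial conditions are limits as `t ↓ 0`.
Values of `U` at `t ≤ 0` play no role. -/
structure IsFundamentalSolution (ν : ℝ) (n : ℕ) (k : ℝ) (U : ℝ → 𝓢'(ℝ, ℂ)) : Prop where
  regular : ∀ φ : 𝓢(ℝ, ℂ), CaputoRegular ν fun s => U s φ
  equation : ∀ φ : 𝓢(ℝ, ℂ), ∀ t : ℝ, 0 < t →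
    caputo ν (fun s => U s φ) t =
      k * ((TemperedDistribution.derivCLM ℂ)^[n] (U t)) φ
  initial : Tendsto U (𝓝[>] 0) (𝓝 (TemperedDistribution.delta 0))
  initial_deriv : 1 < ν → ∀ φ : 𝓢(ℝ, ℂ),
    Tendsto (deriv fun s => U s φ) (𝓝[>] 0) (𝓝 0)

/-- The tempered distribution `T` is given by the function `f`. -/
def IsGivenBy (T : 𝓢'(ℝ, ℂ)) (f : ℝ → ℂ) : Prop :=
  ∀ φ : 𝓢(ℝ, ℂ), Integrable (fun x => φ x * f x) ∧ T φ = ∫ x, φ x * f x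

/-- The function `u(x,t)`, continuous in `x`, is *the* fundamental solution: it is one, and there
is no other among all families of tempered distributions. -/
def IsTheFundamentalSolution (ν : ℝ) (n : ℕ) (k : ℝ) (u : ℝ → ℝ → ℂ) : Prop :=
  (∀ t : ℝ, 0 < t → Continuous fun x => u x t) ∧
  ∃ U : ℝ → 𝓢'(ℝ, ℂ), IsFundamentalSolution ν n k U ∧
    (∀ t : ℝ, 0 < t → IsGivenBy (U t) fun x => u x t) ∧
    ∀ V : ℝ → 𝓢'(ℝ, ℂ), IsFundamentalSolution ν n k V → ∀ t : ℝ, 0 < t → V t = U t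

end FracHeat

end

open scoped FourierTransform

namespace FracHeat

/-! ### Hankel-type contour integrals -/

/-! Everything rests on the function M(u) = W(-u; -α, 1-α), from which the density arises by
scaling: v̄(u,t) = t^(-α) M(u t^(-α)).

Hankel's formula for 1/Γ, inserted termwise in the Wright series, writes M as a contour integral of
e^(σ - u σ^α) σ^(α-1). With σ = e^w and conjugation symmetry, only the imaginary part over the upper
half of the contour is needed. Moving the contour to the right shows that M decays faster than any
exponential, and integrating in u under the contour integral gives the moments j!/Γ(αj+1). Hence M
has total mass 1, and ∫ e^(zu) M(u) du is the Mittag-Leffler function E_α(z), for every complex z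
(`hasSum_integral_cexp_mWright`).

Non-negativity comes from two Post–Widder inversions
(`nonneg_of_forall_integral_pow_mul_exp_nonneg`). In the time variable, t^(αk) ∫ u^k e^(-z t^α u)
M(u) du has Laplace transform k! l^(α-1) (l^α + z)^(-k-1), which is completely monotone; so these
integrals are non-negative, and at t = 1 they are the derivatives, up to sign, of the Laplace
transform of M. A second inversion gives M ≥ 0, and then |E_α(z)| ≤ 1 for Re z ≤ 0.

On the Fourier side the equation of order ν becomes the scalar Volterra equation q = 1 + k σ(ξ) J^ν
q, where σ is the symbol of the adjoint of ∂_x^n and J^ν is the fractional integral. Its solution is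
E_ν(k σ(ξ) t^ν). For ν = α the sign condition on k_n says exactly that Re(k_n σ) ≤ 0, and E_α(k_n σ
t^α) = ∫ e^(u k_n σ) v̄(u,t) du is the mixture of the symbols of p_n(·,u) against v̄. For ν = 2α and
n = 2, E_2α(z²) is the even part of E_α(z) at z = 2πiξ t^α, which is the symbol of the symmetrised
density. `exists_isFundamentalSolution` passes from symbols to distributions; Fubini and Fourier
inversion identify them with the stated functions. For p_n itself, van der Corput estimates give
convergence of the improper integral and a bound O(1 + u^(-1/2)) uniform in x, which is integrable
against v̄.

Uniqueness (`IsFundamentalSolution.unique`): the difference of two solutions satisfies a homogeneous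
Volterra equation. The uniform boundedness principle on the Schwartz space bounds it by one seminorm
on (0,T]; iterating N times on a test function with compactly supported Fourier transform gives a
bound A^N/Γ(νN+1) up to a constant, which tends to 0. Such test functions are dense. -/

/-- The integrand `exp (c w + e^w - u e^{α w})`: the Hankel integrand in the variable `w = log σ`. -/
noncomputable def hankelKernel (α c u : ℝ) (w : ℂ) : ℂ :=
  Complex.exp (c * w + Complex.exp w - u * Complex.exp (α * w))

/-- The integral of `F` along the segment `[b, b + iθ]` followed by the ray `[b + iθ, ∞ + iθ)`. -/
noncomputable def hankelIntegral (θ b : ℝ) (F : ℂ → ℂ) : ℂ :=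
  Complex.I * (∫ y in (0 : ℝ)..θ, F (b + y * Complex.I)) + ∫ x in Ioi b, F (x + θ * Complex.I)

lemma norm_hankelKernel (α c u x y : ℝ) :
    ‖hankelKernel α c u (x + y * Complex.I)‖ =
      Real.exp (c * x + Real.exp x * Real.cos y - u * (Real.exp (α * x) * Real.cos (α * y))) := by
  rw [hankelKernel, Complex.norm_exp]
  congr 1
  have h1 : ((α : ℂ) * (x + y * Complex.I)) = ((α * x : ℝ) : ℂ) + ((α * y : ℝ) : ℂ) * Complex.I := by
    push_cast; ring
  rw [h1]
  simp [Complex.exp_re]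

lemma differentiable_hankelKernel (α c u : ℝ) : Differentiable ℂ (hankelKernel α c u) := by
  unfold hankelKernel
  fun_prop

lemma continuous_hankelKernel (α c u : ℝ) : Continuous (hankelKernel α c u) :=
  (differentiable_hankelKernel α c u).continuous

lemma hankelKernel_ofReal_im (α c u x : ℝ) : (hankelKernel α c u x).im = 0 := by
  have : hankelKernel α c u x =
      ((Real.exp (c * x + Real.exp x - u * Real.exp (α * x)) : ℝ) : ℂ) := by
    simp [hankelKernel]
  rw [this, Complex.ofReal_im]

/-- Change of variables `s = e^x`. -/
lemma integral_exp_smul_comp_exp {E : Type*} [NormedAddCommGroup E] [NormedSpace ℝ E] (g : ℝ → E) :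
    ∫ x : ℝ, Real.exp x • g (Real.exp x) = ∫ s in Ioi (0 : ℝ), g s := by
  have := integral_image_eq_integral_abs_deriv_smul (s := univ) (f := Real.exp) (f' := Real.exp)
    MeasurableSet.univ (fun x _ => (Real.hasDerivAt_exp x).hasDerivWithinAt)
    Real.exp_injective.injOn g
  rw [image_univ, Real.range_exp] at this
  simpa [abs_of_pos (Real.exp_pos _)] using this.symm

lemma integrable_exp_smul_comp_exp {E : Type*} [NormedAddCommGroup E] [NormedSpace ℝ E]
    {g : ℝ → E} (hg : IntegrableOn g (Ioi 0)) :
    Integrable fun x : ℝ => Real.exp x • g (Real.exp x) := by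
  have := (integrableOn_image_iff_integrableOn_abs_deriv_smul (s := univ) (f := Real.exp)
    (f' := Real.exp) MeasurableSet.univ (fun x _ => (Real.hasDerivAt_exp x).hasDerivWithinAt)
    Real.exp_injective.injOn g).1 (by rwa [image_univ, Real.range_exp])
  simpa [abs_of_pos (Real.exp_pos _)] using this

/-- Under s = e^x this is the Gamma integral of s^(c-1) e^(-a s), and c > 0 is what makes it
converge at x → -∞. -/
lemma integrable_exp_sub_exp {c a : ℝ} (hc : 0 < c) (ha : 0 < a) :
    Integrable fun x : ℝ => Real.exp (c * x - a * Real.exp x) := by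
  have h := integrableOn_rpow_mul_exp_neg_mul_rpow (p := 1) (s := c - 1) (b := a)
    (by linarith) one_pos ha
  refine (integrable_exp_smul_comp_exp h).congr (Eventually.of_forall fun x => ?_)
  simp only [smul_eq_mul, Real.rpow_one]
  rw [← Real.exp_mul, ← Real.exp_add, ← Real.exp_add]
  congr 1; ring

/-- On a right half-line e^(cx) is at most a constant times e^((|c|+1)x), so the sign of c no longer
matters. This is what allows Hankel integrals with c ≤ 0. -/
lemma integrableOn_Ioi_exp_sub_exp (c : ℝ) {a : ℝ} (ha : 0 < a) (b : ℝ) :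
    IntegrableOn (fun x : ℝ => Real.exp (c * x - a * Real.exp x)) (Ioi b) := by
  have h := (integrable_exp_sub_exp (c := |c| + 1) (by positivity) ha).integrableOn (s := Ioi b)
  refine Integrable.mono' (h.const_mul (Real.exp (-(|c| + 1 - c) * b)))
    (by fun_prop) ?_
  refine (ae_restrict_iff' measurableSet_Ioi).2 (Eventually.of_forall fun x hx => ?_)
  rw [Real.norm_of_nonneg (Real.exp_pos _).le, ← Real.exp_add, Real.exp_le_exp]
  have : 0 ≤ (|c| + 1 - c) * (x - b) :=
    mul_nonneg (by linarith [le_abs_self c]) (sub_nonneg.2 (le_of_lt hx))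
  linarith

lemma integral_rect_eq_zero {F : ℂ → ℂ} (hF : Differentiable ℂ F) (a b y₀ y₁ : ℝ) :
    (∫ x in a..b, F (x + y₀ * Complex.I)) - (∫ x in a..b, F (x + y₁ * Complex.I)) +
      Complex.I * (∫ y in y₀..y₁, F (b + y * Complex.I)) -
      Complex.I * (∫ y in y₀..y₁, F (a + y * Complex.I)) = 0 := by
  have := Complex.integral_boundary_rect_eq_zero_of_differentiableOn F (a + y₀ * Complex.I)
    (b + y₁ * Complex.I) hF.differentiableOn
  simpa using this

lemma tendsto_vertical_integral {F : ℂ → ℂ} {l : Filter ℝ} {B : ℝ → ℝ} {y₀ y₁ : ℝ} (hy : y₀ ≤ y₁)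
    (hB : Tendsto B l (𝓝 0))
    (h : ∀ᶠ x : ℝ in l, ∀ y ∈ Icc y₀ y₁, ‖F (x + y * Complex.I)‖ ≤ B x) :
    Tendsto (fun x : ℝ => ∫ y in y₀..y₁, F (x + y * Complex.I)) l (𝓝 0) := by
  have h2 : Tendsto (fun x => B x * |y₁ - y₀|) l (𝓝 0) := by simpa using hB.mul_const (|y₁ - y₀|)
  refine squeeze_zero_norm' (h.mono fun x hx => ?_) h2
  refine intervalIntegral.norm_integral_le_of_norm_le_const fun y hy' => hx y ?_
  rw [uIoc_of_le hy] at hy'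
  exact ⟨hy'.1.le, hy'.2⟩

/-- The integrals of an entire function over two horizontal lines agree if the function decays
between them. -/
lemma integral_horizontal_eq {F : ℂ → ℂ} (hF : Differentiable ℂ F) {y₀ y₁ : ℝ} (hy : y₀ ≤ y₁)
    {B : ℝ → ℝ} (hB : Tendsto B atTop (𝓝 0)) (hB' : Tendsto B atBot (𝓝 0))
    (h : ∀ x : ℝ, ∀ y ∈ Icc y₀ y₁, ‖F (x + y * Complex.I)‖ ≤ B x) (hBi : Integrable B) :
    ∫ x : ℝ, F (x + y₀ * Complex.I) = ∫ x : ℝ, F (x + y₁ * Complex.I) := by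
  have hi : ∀ y ∈ Icc y₀ y₁, Integrable fun x : ℝ => F (x + y * Complex.I) := fun y hy =>
    hBi.mono' (hF.continuous.comp (by fun_prop)).aestronglyMeasurable
      (Eventually.of_forall fun x => h x y hy)
  have t0 := intervalIntegral_tendsto_integral (hi y₀ ⟨le_rfl, hy⟩) tendsto_neg_atTop_atBot
    tendsto_id
  have t1 := intervalIntegral_tendsto_integral (hi y₁ ⟨hy, le_rfl⟩) tendsto_neg_atTop_atBot
    tendsto_id
  have v0 := tendsto_vertical_integral hy hB (Eventually.of_forall h)
  have v1 := (tendsto_vertical_integral hy hB' (Eventually.of_forall h)).comp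
    tendsto_neg_atTop_atBot
  have := ((t0.sub t1).add (v0.const_mul Complex.I)).sub (v1.const_mul Complex.I)
  have e := tendsto_nhds_unique this (tendsto_const_nhds.congr fun R => by
    have := integral_rect_eq_zero hF (-R) R y₀ y₁
    simp only [Function.comp, id]
    push_cast at this ⊢
    exact this.symm)
  simpa [sub_eq_zero] using e

/-- For a function that is real on the real line, the imaginary part of the Hankel integral does
not depend on the abscissa of the vertical segment. -/
lemma hankelIntegral_im_eq {F : ℂ → ℂ} (hF : Differentiable ℂ F) (hreal : ∀ x : ℝ, (F x).im = 0)
    {θ : ℝ} (hθ : 0 ≤ θ) {B : ℝ → ℝ} (hB : Tendsto B atBot (𝓝 0))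
    (h : ∀ x : ℝ, ∀ y ∈ Icc 0 θ, ‖F (x + y * Complex.I)‖ ≤ B x)
    (hi : Integrable fun x : ℝ => F (x + θ * Complex.I)) (b : ℝ) :
    (hankelIntegral θ b F).im = (∫ x : ℝ, F (x + θ * Complex.I)).im := by
  have t1 := intervalIntegral_tendsto_integral_Iic b hi.integrableOn tendsto_id
  have v1 := tendsto_vertical_integral hθ hB (Eventually.of_forall h)
  have hlim : Tendsto (fun a : ℝ =>
      (∫ x in a..b, F (x + θ * Complex.I)) -
      Complex.I * (∫ y in (0 : ℝ)..θ, F (b + y * Complex.I)) +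
      Complex.I * (∫ y in (0 : ℝ)..θ, F (a + y * Complex.I))) atBot
      (𝓝 ((∫ x in Iic b, F (x + θ * Complex.I)) -
      Complex.I * (∫ y in (0 : ℝ)..θ, F (b + y * Complex.I)) + Complex.I * 0)) :=
    (t1.sub_const _).add (v1.const_mul Complex.I)
  have him := (Complex.continuous_im.tendsto _).comp hlim
  -- The bottom side of the rectangle lies on the real axis, where `F` is real: it contributes
  -- nothing to the imaginary part.
  have hz : ∀ a : ℝ, (∫ x in a..b, F (x + (0 : ℝ) * Complex.I)).im = 0 := by
    intro a
    have : (∫ x in a..b, F (x + (0 : ℝ) * Complex.I)) =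
        ((∫ x in a..b, (F x).re : ℝ) : ℂ) := by
      rw [← intervalIntegral.integral_ofReal]
      refine intervalIntegral.integral_congr fun x _ => ?_
      apply Complex.ext <;> simp [hreal]
    rw [this, Complex.ofReal_im]
  have e := tendsto_nhds_unique him (tendsto_const_nhds.congr (f₁ := fun _ => (0 : ℝ)) fun a => by
    have := integral_rect_eq_zero hF a b 0 θ
    have h2 : (∫ x in a..b, F (x + θ * Complex.I)) -
      Complex.I * (∫ y in (0 : ℝ)..θ, F (b + y * Complex.I)) +
      Complex.I * (∫ y in (0 : ℝ)..θ, F (a + y * Complex.I)) =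
        ∫ x in a..b, F (x + (0 : ℝ) * Complex.I) := by
      linear_combination -this
    simp only [Function.comp]
    rw [h2, hz])
  have hs := intervalIntegral.integral_Iic_add_Ioi (b := b) hi.integrableOn hi.integrableOn
  rw [← hs, hankelIntegral]
  simp only [mul_zero, add_zero, Complex.sub_im, Complex.add_im] at e ⊢
  linarith

end FracHeat

/-! ### The contour angle and the Gamma integral along a rotated ray. -/

namespace FracHeat

/-- The angle `π / (1 + α)` of the rays of the contour. -/
noncomputable def hankelAngle (α : ℝ) : ℝ := Real.pi / (1 + α)

section Angle
variable {α : ℝ}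

lemma hankelAngle_pos (h0 : 0 < α) : 0 < hankelAngle α := by
  unfold hankelAngle; positivity

/-- Beyond π/2 the factor exp(e^w) decays doubly exponentially along the ray. -/
lemma hankelAngle_gt (h0 : 0 < α) (h1 : α < 1) : Real.pi / 2 < hankelAngle α := by
  unfold hankelAngle
  have := Real.pi_pos
  gcongr
  linarith

lemma hankelAngle_lt (h0 : 0 < α) : hankelAngle α < Real.pi := by
  unfold hankelAngle
  rw [div_lt_iff₀ (by linarith)]
  nlinarith [Real.pi_pos]

/-- This keeps Re e^(αw) positive on the whole contour, so that exp(-u e^(αw)) decays in u ≥ 0. The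
inequality απ/(1+α) < π/2 is equivalent to α < 1. -/
lemma mul_hankelAngle_lt (h0 : 0 < α) (h1 : α < 1) : α * hankelAngle α < Real.pi / 2 := by
  unfold hankelAngle
  rw [mul_div_assoc', div_lt_div_iff₀ (by linarith) two_pos]
  nlinarith [Real.pi_pos]

lemma cos_hankelAngle_neg (h0 : 0 < α) (h1 : α < 1) : Real.cos (hankelAngle α) < 0 :=
  Real.cos_neg_of_pi_div_two_lt_of_lt (hankelAngle_gt h0 h1)
    (by linarith [hankelAngle_lt h0, Real.pi_pos])

lemma cos_mul_hankelAngle_pos (h0 : 0 < α) (h1 : α < 1) : 0 < Real.cos (α * hankelAngle α) :=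
  Real.cos_pos_of_mem_Ioo ⟨by linarith [mul_pos h0 (hankelAngle_pos h0), Real.pi_pos],
    mul_hankelAngle_lt h0 h1⟩

lemma cos_mul_ge (h0 : 0 < α) (h1 : α < 1) {y : ℝ} (hy : y ∈ Icc 0 (hankelAngle α)) :
    Real.cos (α * hankelAngle α) ≤ Real.cos (α * y) :=
  Real.cos_le_cos_of_nonneg_of_le_pi (mul_nonneg h0.le hy.1)
    (by linarith [mul_hankelAngle_lt h0 h1, Real.pi_pos]) (by gcongr; exact hy.2)

end Angle

section
variable {α : ℝ} (h0 : 0 < α) (h1 : α < 1)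
include h0 h1

lemma norm_hankelKernel_ray_le {c u : ℝ} (hu : 0 ≤ u) {b x : ℝ} (hb : b ≤ x) :
    ‖hankelKernel α c u (x + hankelAngle α * Complex.I)‖ ≤
      Real.exp (c * x - -Real.cos (hankelAngle α) * Real.exp x) *
      Real.exp (-(Real.cos (α * hankelAngle α) * Real.exp (α * b)) * u) := by
  rw [norm_hankelKernel, ← Real.exp_add, Real.exp_le_exp]
  have hk := cos_mul_hankelAngle_pos h0 h1
  have h3 : Real.exp (α * b) ≤ Real.exp (α * x) := by gcongr
  have : u * (Real.exp (α * b) * Real.cos (α * hankelAngle α)) ≤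
      u * (Real.exp (α * x) * Real.cos (α * hankelAngle α)) := by gcongr
  linarith

lemma norm_hankelKernel_segment_le {c u : ℝ} (hu : 0 ≤ u) {x y : ℝ}
    (hy : y ∈ Icc 0 (hankelAngle α)) :
    ‖hankelKernel α c u (x + y * Complex.I)‖ ≤ Real.exp (c * x + Real.exp x) *
      Real.exp (-(Real.cos (α * hankelAngle α) * Real.exp (α * x)) * u) := by
  rw [norm_hankelKernel, ← Real.exp_add, Real.exp_le_exp]
  have h3 : u * (Real.exp (α * x) * Real.cos (α * hankelAngle α)) ≤
      u * (Real.exp (α * x) * Real.cos (α * y)) := by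
    gcongr; exact cos_mul_ge h0 h1 hy
  have h4 : Real.exp x * Real.cos y ≤ Real.exp x := by
    nlinarith [Real.exp_pos x, Real.cos_le_one y]
  linarith

lemma integrableOn_hankelKernel (c : ℝ) {u : ℝ} (hu : 0 ≤ u) (b : ℝ) :
    IntegrableOn (fun x : ℝ => hankelKernel α c u (x + hankelAngle α * Complex.I)) (Ioi b) := by
  refine Integrable.mono' ((integrableOn_Ioi_exp_sub_exp c
    (neg_pos.2 (cos_hankelAngle_neg h0 h1)) b).mul_const
    (Real.exp (-(Real.cos (α * hankelAngle α) * Real.exp (α * b)) * u)))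
    ((continuous_hankelKernel α c u).comp (by fun_prop)).aestronglyMeasurable ?_
  exact (ae_restrict_iff' measurableSet_Ioi).2 (Eventually.of_forall fun x hx =>
    norm_hankelKernel_ray_le h0 h1 hu (le_of_lt hx))

lemma integrable_hankelKernel {c : ℝ} (hc : 0 < c) {u : ℝ} (hu : 0 ≤ u) :
    Integrable (fun x : ℝ => hankelKernel α c u (x + hankelAngle α * Complex.I)) := by
  refine Integrable.mono' (integrable_exp_sub_exp hc
    (neg_pos.2 (cos_hankelAngle_neg h0 h1)))
    ((continuous_hankelKernel α c u).comp (by fun_prop)).aestronglyMeasurable ?_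
  refine Eventually.of_forall fun x => (norm_hankelKernel_ray_le h0 h1 hu le_rfl).trans ?_
  refine mul_le_of_le_one_right (Real.exp_pos _).le (Real.exp_le_one_iff.2 ?_)
  have := cos_mul_hankelAngle_pos h0 h1
  have : 0 ≤ Real.cos (α * hankelAngle α) * Real.exp (α * x) * u := by positivity
  linarith

/-- For c > 0 the factor e^(cx) kills the vertical segment as its abscissa tends to -∞, leaving the
full horizontal line. -/
lemma hankelIntegral_hankelKernel_im {c : ℝ} (hc : 0 < c) {u : ℝ} (hu : 0 ≤ u) (b : ℝ) :
    (hankelIntegral (hankelAngle α) b (hankelKernel α c u)).im =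
      (∫ x : ℝ, hankelKernel α c u (x + hankelAngle α * Complex.I)).im := by
  refine hankelIntegral_im_eq (differentiable_hankelKernel α c u) (hankelKernel_ofReal_im α c u)
    (hankelAngle_pos h0).le (B := fun x => Real.exp (c * x + Real.exp x)) ?_ ?_
    (integrable_hankelKernel h0 h1 hc hu) b
  · refine Real.tendsto_exp_atBot.comp ?_
    exact (tendsto_id.const_mul_atBot hc).atBot_add Real.tendsto_exp_atBot
  · intro x y hy
    refine (norm_hankelKernel_segment_le h0 h1 hu hy).trans ?_
    refine mul_le_of_le_one_right (Real.exp_pos _).le (Real.exp_le_one_iff.2 ?_)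
    have := cos_mul_hankelAngle_pos h0 h1
    have : 0 ≤ Real.cos (α * hankelAngle α) * Real.exp (α * x) * u := by positivity
    linarith

/-- The Gamma integral along a rotated ray. -/
lemma integral_hankelKernel_zero {c : ℝ} (hc : 0 < c) :
    ∫ x : ℝ, hankelKernel α c 0 (x + hankelAngle α * Complex.I) =
      Complex.exp (c * Real.pi * Complex.I) * Real.Gamma c := by
  have ha := neg_pos.2 (cos_hankelAngle_neg h0 h1)
  -- Between the heights θ and π one has cos y ≤ cos θ < 0, so the line may be raised to height π.
  -- There e^w = -e^x and the integral is Euler's, up to the phase e^(iπc).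
  rw [integral_horizontal_eq (differentiable_hankelKernel α c 0) (hankelAngle_lt h0).le
    (B := fun x => Real.exp (c * x - -Real.cos (hankelAngle α) * Real.exp x)) ?_ ?_ ?_
    (integrable_exp_sub_exp hc ha)]
  · have h2 : ∀ x : ℝ, hankelKernel α c 0 (x + Real.pi * Complex.I) =
        Complex.exp (c * Real.pi * Complex.I) *
        ((Real.exp x • (Real.exp x ^ (c - 1) * Real.exp (-(1 * Real.exp x))) : ℝ) : ℂ) := by
      intro x
      rw [smul_eq_mul, ← Real.exp_mul, ← Real.exp_add, ← Real.exp_add, hankelKernel,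
        Complex.ofReal_exp, ← Complex.exp_add, Complex.exp_add (x : ℂ), Complex.exp_pi_mul_I]
      congr 1
      push_cast
      ring
    simp_rw [h2]
    rw [integral_const_mul, integral_complex_ofReal,
      integral_exp_smul_comp_exp (fun s : ℝ => s ^ (c - 1) * Real.exp (-(1 * s))),
      Real.integral_rpow_mul_exp_neg_mul_Ioi hc one_pos]
    simp
  · refine Real.tendsto_exp_atBot.comp ?_
    have h3 : Tendsto (fun x : ℝ => Real.exp x * (c * (x ^ 1 * Real.exp (-x)) - -Real.cos (hankelAngle α)))
        atTop atBot := by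
      refine Real.tendsto_exp_atTop.atTop_mul_neg (C := c * 0 - -Real.cos (hankelAngle α))
        (by linarith) ?_
      exact ((Real.tendsto_pow_mul_exp_neg_atTop_nhds_zero 1).const_mul c).sub_const _
    refine h3.congr fun x => ?_
    have : Real.exp x * Real.exp (-x) = 1 := by rw [← Real.exp_add]; simp
    linear_combination c * x * this
  · refine Real.tendsto_exp_atBot.comp ?_
    refine tendsto_atBot_mono (fun x => ?_) (tendsto_id.const_mul_atBot hc)
    have := mul_pos ha (Real.exp_pos x)
    simp only [id]; linarith
  · intro x y hy
    rw [norm_hankelKernel, Real.exp_le_exp]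
    have : Real.cos y ≤ Real.cos (hankelAngle α) :=
      Real.cos_le_cos_of_nonneg_of_le_pi (hankelAngle_pos h0).le hy.2 hy.1
    nlinarith [Real.exp_pos x]

-- The reflection formula, in a form that survives at positive integers c: there both sides are 0,
-- since `Real.Gamma` is 0 at its poles.
omit h0 h1 in
lemma Gamma_mul_sin_eq {c : ℝ} (hc : 0 < c) :
    Real.Gamma c * Real.sin (Real.pi * c) = Real.pi / Real.Gamma (1 - c) := by
  have h := Real.Gamma_mul_Gamma_one_sub c
  by_cases hs : Real.sin (Real.pi * c) = 0
  · rw [hs, div_zero] at h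
    rcases mul_eq_zero.1 h with h | h
    · exact absurd h (Real.Gamma_pos_of_pos hc).ne'
    · simp [h, hs]
  · have hne : Real.Gamma (1 - c) ≠ 0 := by
      intro h'
      rw [h', mul_zero] at h
      exact (div_ne_zero Real.pi_ne_zero hs) h.symm
    rw [eq_div_iff hne]
    rw [eq_div_iff hs] at h
    linear_combination h

lemma integral_hankelKernel_zero_im {c : ℝ} (hc : 0 < c) :
    (∫ x : ℝ, hankelKernel α c 0 (x + hankelAngle α * Complex.I)).im =
      Real.pi / Real.Gamma (1 - c) := by
  rw [integral_hankelKernel_zero h0 h1 hc, ← Gamma_mul_sin_eq hc, Complex.im_mul_ofReal]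
  have : (c * Real.pi * Complex.I : ℂ) = ((Real.pi * c : ℝ) : ℂ) * Complex.I := by push_cast; ring
  rw [this, Complex.exp_ofReal_mul_I_im]
  ring

end
end FracHeat

/-! ### Hankel's formula for 1/Γ at every real argument. -/

namespace FracHeat

section
variable {α : ℝ} (h0 : 0 < α) (h1 : α < 1)
include h0 h1

/-- The contour starts at a finite abscissa, so nothing happens to the integral as c crosses 0; this
reaches c = 0 from c > 0. -/
lemma continuousAt_hankelIntegral (b : ℝ) :
    ContinuousAt (fun c : ℝ => hankelIntegral (hankelAngle α) b (hankelKernel α c 0)) 0 := by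
  unfold hankelIntegral
  refine ContinuousAt.add (continuousAt_const.mul (Continuous.continuousAt ?_)) ?_
  · apply intervalIntegral.continuous_parametric_intervalIntegral_of_continuous'
    unfold hankelKernel
    fun_prop
  · have ha := neg_pos.2 (cos_hankelAngle_neg h0 h1)
    refine continuousAt_of_dominated (bound := fun x =>
      Real.exp (1 * x - -Real.cos (hankelAngle α) * Real.exp x) +
      Real.exp (-1 * x - -Real.cos (hankelAngle α) * Real.exp x)) ?_ ?_ ?_ ?_
    · exact Eventually.of_forall fun c =>
        ((continuous_hankelKernel α c 0).comp (by fun_prop)).aestronglyMeasurable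
    · filter_upwards [Icc_mem_nhds (show (-1 : ℝ) < 0 by norm_num) (show (0 : ℝ) < 1 by norm_num)]
        with c hc
      refine Eventually.of_forall fun x => ?_
      rw [norm_hankelKernel]
      rcases le_total 0 x with hx | hx
      · refine le_add_of_le_of_nonneg (Real.exp_le_exp.2 ?_) (Real.exp_pos _).le
        nlinarith [hc.2]
      · refine le_add_of_nonneg_of_le (Real.exp_pos _).le (Real.exp_le_exp.2 ?_)
        nlinarith [hc.1]
    · exact (integrableOn_Ioi_exp_sub_exp 1 ha b).add (integrableOn_Ioi_exp_sub_exp (-1) ha b)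
    · refine Eventually.of_forall fun x => Continuous.continuousAt ?_
      unfold hankelKernel
      fun_prop

omit h0 h1 in
lemma hasDerivAt_hankelKernel_zero (c : ℝ) (w : ℂ) :
    HasDerivAt (hankelKernel α c 0) (hankelKernel α (c + 1) 0 w + c * hankelKernel α c 0 w) w := by
  have : HasDerivAt (fun w : ℂ => Complex.exp (c * w + Complex.exp w - (0 : ℝ) * Complex.exp (α * w)))
      (Complex.exp (c * w + Complex.exp w - (0 : ℝ) * Complex.exp (α * w)) *
        (c * 1 + Complex.exp w - (0 : ℝ) * (Complex.exp (α * w) * (α * 1)))) w :=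
    ((((hasDerivAt_id w).const_mul (c : ℂ)).add (Complex.hasDerivAt_exp w)).sub
      (((hasDerivAt_id w).const_mul (α : ℂ)).cexp.const_mul _)).cexp
  refine this.congr_deriv ?_
  simp only [hankelKernel]
  push_cast
  rw [show ((c : ℂ) + 1) * w + Complex.exp w - 0 * Complex.exp (α * w) =
    (c * w + Complex.exp w - 0 * Complex.exp (α * w)) + w by ring, Complex.exp_add _ w]
  ring

/-- The derivative of e^(cw + e^w) is the kernel for c + 1 plus c times the kernel for c;
integrating it along the contour leaves only the value at the starting point. That value is real, so
the imaginary part obeys the recurrence of 1/Γ exactly. -/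
lemma hankelIntegral_recurrence (c b : ℝ) :
    hankelIntegral (hankelAngle α) b (hankelKernel α (c + 1) 0) +
      c * hankelIntegral (hankelAngle α) b (hankelKernel α c 0) = -hankelKernel α c 0 b := by
  have ha := neg_pos.2 (cos_hankelAngle_neg h0 h1)
  have hcv : ∀ c : ℝ, Continuous fun y : ℝ => hankelKernel α c 0 (b + y * Complex.I) := fun c =>
    (continuous_hankelKernel α c 0).comp (by fun_prop)
  have e1 : Complex.I * (∫ y in (0 : ℝ)..hankelAngle α,
      (hankelKernel α (c + 1) 0 (b + y * Complex.I) + c * hankelKernel α c 0 (b + y * Complex.I))) =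
      hankelKernel α c 0 (b + hankelAngle α * Complex.I) - hankelKernel α c 0 b := by
    rw [← intervalIntegral.integral_const_mul]
    have := intervalIntegral.integral_eq_sub_of_hasDerivAt (a := 0) (b := hankelAngle α)
      (f := fun y : ℝ => hankelKernel α c 0 (b + y * Complex.I))
      (f' := fun y : ℝ => Complex.I * (hankelKernel α (c + 1) 0 (b + y * Complex.I) +
        c * hankelKernel α c 0 (b + y * Complex.I)))
      (fun y _ => by
        have h2 : HasDerivAt (fun y : ℂ => (b : ℂ) + y * Complex.I) Complex.I y := by
          simpa using ((hasDerivAt_id (y : ℂ)).mul_const Complex.I).const_add (b : ℂ)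
        have h3 := ((hasDerivAt_hankelKernel_zero (α := α) c _).comp (y : ℂ) h2).comp_ofReal
        refine h3.congr_deriv (by ring))
      (Continuous.intervalIntegrable (by
        exact continuous_const.mul ((hcv _).add (continuous_const.mul (hcv _)))) _ _)
    rw [this]
    simp
  have e2 : (∫ x in Ioi b, (hankelKernel α (c + 1) 0 (x + hankelAngle α * Complex.I) +
      c * hankelKernel α c 0 (x + hankelAngle α * Complex.I))) =
      0 - hankelKernel α c 0 (b + hankelAngle α * Complex.I) := by
    have hi := integrableOn_hankelKernel h0 h1 c (le_refl (0 : ℝ)) b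
    have hi' := (integrableOn_hankelKernel h0 h1 (c + 1) (le_refl (0 : ℝ)) b).add
      (hi.const_mul (c : ℂ))
    have hd : ∀ x ∈ Ici b, HasDerivAt (fun x : ℝ => hankelKernel α c 0 (x + hankelAngle α * Complex.I))
        (hankelKernel α (c + 1) 0 (x + hankelAngle α * Complex.I) +
          c * hankelKernel α c 0 (x + hankelAngle α * Complex.I)) x := fun x _ => by
      have h2 : HasDerivAt (fun y : ℂ => y + hankelAngle α * Complex.I) 1 x :=
        (hasDerivAt_id (x : ℂ)).add_const _
      have h3 := ((hasDerivAt_hankelKernel_zero (α := α) c _).comp (x : ℂ) h2).comp_ofReal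
      exact h3.congr_deriv (by ring)
    exact integral_Ioi_of_hasDerivAt_of_tendsto' hd hi'
      (tendsto_zero_of_hasDerivAt_of_integrableOn_Ioi (fun x hx => hd x (mem_Ici_of_Ioi hx)) hi' hi)
  rw [intervalIntegral.integral_add ((hcv _).intervalIntegrable _ _)
    (((hcv _).intervalIntegrable _ _).const_mul _),
    intervalIntegral.integral_const_mul] at e1
  rw [integral_add (integrableOn_hankelKernel h0 h1 (c + 1) (le_refl (0 : ℝ)) b)
    ((integrableOn_hankelKernel h0 h1 c (le_refl (0 : ℝ)) b).const_mul _),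
    integral_const_mul] at e2
  simp only [hankelIntegral]
  linear_combination e1 + e2

/-- Hankel's formula for the reciprocal of the Gamma function. -/
lemma hankelIntegral_im_eq_Gamma_inv (b c : ℝ) :
    (hankelIntegral (hankelAngle α) b (hankelKernel α c 0)).im = Real.pi / Real.Gamma (1 - c) := by
  have hpos : ∀ c : ℝ, 0 < c → (hankelIntegral (hankelAngle α) b (hankelKernel α c 0)).im =
      Real.pi / Real.Gamma (1 - c) := fun c hc => by
    rw [hankelIntegral_hankelKernel_im h0 h1 hc le_rfl, integral_hankelKernel_zero_im h0 h1 hc]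
  have hzero : (hankelIntegral (hankelAngle α) b (hankelKernel α 0 0)).im =
      Real.pi / Real.Gamma (1 - 0) := by
    have t1 : Tendsto (fun c : ℝ => (hankelIntegral (hankelAngle α) b (hankelKernel α c 0)).im)
        (𝓝[>] 0) (𝓝 (hankelIntegral (hankelAngle α) b (hankelKernel α 0 0)).im) :=
      ((Complex.continuous_im.tendsto _).comp (continuousAt_hankelIntegral h0 h1 b)).mono_left
        nhdsWithin_le_nhds
    have t2 : Tendsto (fun c : ℝ => Real.pi / Real.Gamma (1 - c)) (𝓝[>] 0)
        (𝓝 (Real.pi / Real.Gamma (1 - 0))) := by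
      refine Tendsto.mono_left ?_ nhdsWithin_le_nhds
      refine ContinuousAt.div continuousAt_const (ContinuousAt.comp (g := Real.Gamma)
        (Real.differentiableAt_Gamma ?_).continuousAt (by fun_prop)) (by simp)
      intro m hm
      have : (0 : ℝ) ≤ m := by positivity
      linarith
    refine tendsto_nhds_unique t1 (t2.congr' ?_)
    filter_upwards [self_mem_nhdsWithin] with c hc using (hpos c hc).symm
  -- The recurrence together with Γ(1-c) = -c Γ(-c) carries the formula one unit to the left at each
  -- step.
  have hind : ∀ N : ℕ, ∀ c : ℝ, -(N : ℝ) ≤ c →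
      (hankelIntegral (hankelAngle α) b (hankelKernel α c 0)).im =
        Real.pi / Real.Gamma (1 - c) := by
    intro N
    induction N with
    | zero =>
      intro c hc
      rcases eq_or_lt_of_le (show 0 ≤ c by simpa using hc) with h | h
      · rw [← h]; exact hzero
      · exact hpos c h
    | succ N ih =>
      intro c hc
      by_cases hc0 : 0 ≤ c
      · exact ih c (le_trans (by simp) hc0)
      push Not at hc0
      have h1' := ih (c + 1) (by push_cast at hc; linarith)
      have hr := congrArg Complex.im (hankelIntegral_recurrence h0 h1 c b)
      rw [Complex.add_im, Complex.neg_im, hankelKernel_ofReal_im, h1', Complex.im_ofReal_mul] at hr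
      have hG : Real.Gamma (1 - c) = -c * Real.Gamma (-c) := by
        rw [← Real.Gamma_add_one (by linarith)]; congr 1; ring
      have hG0 : Real.Gamma (-c) ≠ 0 := (Real.Gamma_pos_of_pos (by linarith)).ne'
      rw [show 1 - (c + 1) = -c by ring] at hr
      rw [hG, eq_div_iff (mul_ne_zero (by linarith) hG0)]
      field_simp at hr
      linarith
  obtain ⟨N, hN⟩ := exists_nat_ge (-c)
  exact hind N c (by linarith)

end
end FracHeat

/-! ### The M-Wright function: contour integral, decay, moments. -/

namespace FracHeat

/-- The `M`-Wright function `M(u) = W(-u; -α, 1 - α)`. -/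
noncomputable def mWright (α u : ℝ) : ℝ := wright (-u) (-α) (1 - α)

lemma _root_.HasSum.congr_eq {E : Type*} [AddCommMonoid E] [TopologicalSpace E] {ι : Type*}
    {f g : ι → E} {a b : E} (h : HasSum f a) (hf : ∀ j, g j = f j) (hab : b = a) : HasSum g b := by
  rw [hab, show g = f from funext hf]; exact h

section
variable {α : ℝ} (h0 : 0 < α) (h1 : α < 1)
include h0 h1

/-- `exp (u e^{α x})` is absorbed by `exp (-a e^x)` since `α < 1`. -/
lemma integrable_exp_add_exp_sub_exp (u : ℝ) {a : ℝ} (ha : 0 < a) :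
    Integrable fun x : ℝ => Real.exp (α * x + u * Real.exp (α * x) - a * Real.exp x) := by
  have hlim : Tendsto (fun x : ℝ => Real.exp (α * x) * (u - a / 2 * Real.exp ((1 - α) * x)))
      atTop atBot := by
    refine Tendsto.atTop_mul_atBot₀ (Real.tendsto_exp_atTop.comp
      (tendsto_id.const_mul_atTop h0)) ?_
    refine tendsto_atBot_add_const_left _ u ?_
    refine tendsto_neg_atTop_atBot.comp (Tendsto.const_mul_atTop (by linarith) ?_)
    exact Real.tendsto_exp_atTop.comp (tendsto_id.const_mul_atTop (by linarith))
  obtain ⟨R, hR⟩ := (hlim.eventually (eventually_le_atBot 0)).exists_forall_of_atTop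
  -- Beyond `R` half of a e^x dominates u e^(αx); to the left of `R` that term is bounded by a
  -- constant.
  have hb : ∀ x : ℝ, u * Real.exp (α * x) ≤ a / 2 * Real.exp x + |u| * Real.exp (α * R) := by
    intro x
    have hpos : 0 ≤ |u| * Real.exp (α * R) := by positivity
    have hpos2 : 0 ≤ a / 2 * Real.exp x := by positivity
    rcases le_total R x with hx | hx
    · have h2 := hR x hx
      have h3 : Real.exp (α * x) * Real.exp ((1 - α) * x) = Real.exp x := by
        rw [← Real.exp_add]; congr 1; ring
      have h4 : a / 2 * (Real.exp (α * x) * Real.exp ((1 - α) * x)) = a / 2 * Real.exp x := by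
        rw [h3]
      linarith
    · have h2 : u * Real.exp (α * x) ≤ |u| * Real.exp (α * R) := by
        gcongr; exact le_abs_self u
      linarith
  refine Integrable.mono' ((integrable_exp_sub_exp h0 (half_pos ha)).const_mul
    (Real.exp (|u| * Real.exp (α * R)))) (by fun_prop) (Eventually.of_forall fun x => ?_)
  rw [Real.norm_of_nonneg (Real.exp_pos _).le, ← Real.exp_add, Real.exp_le_exp]
  linarith [hb x]

/-- The Wright series converges, and its sum is given by a contour integral. -/
lemma hasSum_wrightTerm (x : ℝ) :
    HasSum (wrightTerm x (-α) (1 - α)) (1 / Real.pi *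
      (∫ y : ℝ, hankelKernel α α (-x) (y + hankelAngle α * Complex.I)).im) := by
  set θ := hankelAngle α with hθ
  have ha := neg_pos.2 (cos_hankelAngle_neg h0 h1)
  -- Expanding exp(x e^(αw)) in powers turns the j-th term into the kernel at u = 0 with exponent
  -- α(j+1), whose integral has imaginary part π/Γ(1 - α(j+1)), the Gamma factor of the Wright
  -- series.
  have key : HasSum (fun j : ℕ => ∫ y : ℝ, ((x ^ j / j.factorial : ℝ) : ℂ) *
      hankelKernel α (α * (j + 1)) 0 (y + θ * Complex.I))
      (∫ y : ℝ, hankelKernel α α (-x) (y + θ * Complex.I)) := by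
    have hsum : ∀ y : ℝ, HasSum (fun j : ℕ =>
        Real.exp (α * y - -Real.cos θ * Real.exp y) * ((|x| * Real.exp (α * y)) ^ j / j.factorial))
        (Real.exp (α * y + |x| * Real.exp (α * y) - -Real.cos θ * Real.exp y)) := fun y => by
      have := (NormedSpace.expSeries_div_hasSum_exp (|x| * Real.exp (α * y))).mul_left
        (Real.exp (α * y - -Real.cos θ * Real.exp y))
      rw [← Real.exp_eq_exp_ℝ, ← Real.exp_add] at this
      exact this.congr_eq (fun _ => rfl) (by congr 1; ring)
    refine hasSum_integral_of_dominated_convergence (fun j y =>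
      Real.exp (α * y - -Real.cos θ * Real.exp y) * ((|x| * Real.exp (α * y)) ^ j / j.factorial))
      ?_ ?_ ?_ ?_ ?_
    · intro j
      exact (continuous_const.mul ((continuous_hankelKernel α _ 0).comp
        (by fun_prop))).aestronglyMeasurable
    · refine fun j => Eventually.of_forall fun y => le_of_eq ?_
      rw [norm_mul, norm_hankelKernel, Complex.norm_real, norm_div, norm_pow, Real.norm_eq_abs,
        Real.norm_of_nonneg (by positivity : (0 : ℝ) ≤ j.factorial), mul_pow, ← Real.exp_nat_mul]
      have : Real.exp (α * (j + 1) * y + Real.exp y * Real.cos θ -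
          0 * (Real.exp (α * y) * Real.cos (α * θ))) =
          Real.exp (α * y - -Real.cos θ * Real.exp y) * Real.exp (j * (α * y)) := by
        rw [← Real.exp_add]; congr 1; ring
      rw [this]; ring
    · exact Eventually.of_forall fun y => (hsum y).summable
    · refine (integrable_exp_add_exp_sub_exp h0 h1 |x| ha).congr (Eventually.of_forall fun y => ?_)
      exact (hsum y).tsum_eq.symm
    · refine Eventually.of_forall fun y => ?_
      set w : ℂ := y + θ * Complex.I
      have := (NormedSpace.expSeries_div_hasSum_exp ((x : ℂ) * Complex.exp (α * w))).mul_left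
        (Complex.exp (α * w + Complex.exp w))
      rw [← Complex.exp_eq_exp_ℂ, ← Complex.exp_add] at this
      refine this.congr_eq (fun j => ?_) ?_
      · rw [mul_pow, ← Complex.exp_nat_mul, hankelKernel]
        have : Complex.exp (((α * (j + 1) : ℝ) : ℂ) * w + Complex.exp w -
            (0 : ℝ) * Complex.exp (α * w)) =
            Complex.exp (α * w + Complex.exp w) * Complex.exp (j * (α * w)) := by
          rw [← Complex.exp_add]; congr 1; push_cast; ring
        rw [this]; push_cast; ring
      · rw [hankelKernel]; congr 1; push_cast; ring
  have h2 := (Complex.hasSum_im key).mul_left (1 / Real.pi)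
  refine h2.congr_eq (fun j => ?_) rfl
  rw [integral_const_mul, Complex.im_ofReal_mul,
    integral_hankelKernel_zero_im h0 h1 (by positivity), wrightTerm,
    show -α * j + (1 - α) = 1 - α * (j + 1) by ring]
  -- At a pole of Γ both sides vanish, by division by zero.
  by_cases hG : Real.Gamma (1 - α * (j + 1)) = 0
  · simp [hG]
  · have := Real.pi_pos
    field_simp

/-- The free abscissa b is the point: large b yields decay in u, and b = 0 yields the moments. -/
lemma mWright_eq_hankelIntegral {u : ℝ} (hu : 0 ≤ u) (b : ℝ) :
    mWright α u =
      1 / Real.pi * (hankelIntegral (hankelAngle α) b (hankelKernel α α u)).im := by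
  rw [mWright, wright, (hasSum_wrightTerm h0 h1 (-u)).tsum_eq, neg_neg,
    hankelIntegral_hankelKernel_im h0 h1 h0 hu]

/-- The `M`-Wright function decays faster than any exponential. -/
lemma exists_abs_mWright_le (K : ℝ) :
    ∃ C : ℝ, 0 ≤ C ∧ ∀ u : ℝ, 0 ≤ u → |mWright α u| ≤ C * Real.exp (-K * u) := by
  set θ := hankelAngle α with hθ
  have hκ := cos_mul_hankelAngle_pos h0 h1
  have ha := neg_pos.2 (cos_hankelAngle_neg h0 h1)
  -- On the contour starting at abscissa b, Re e^(αw) is at least cos(αθ) e^(αb). Choosing b so that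
  -- this exceeds K gives the factor e^(-Ku).
  obtain ⟨b, hb⟩ : ∃ b : ℝ, K ≤ Real.cos (α * hankelAngle α) * Real.exp (α * b) := by
    have : Tendsto (fun b : ℝ => Real.cos (α * hankelAngle α) * Real.exp (α * b)) atTop atTop :=
      (Real.tendsto_exp_atTop.comp (tendsto_id.const_mul_atTop h0)).const_mul_atTop hκ
    exact (this.eventually (eventually_ge_atTop K)).exists
  set D : ℝ := ∫ x in Ioi b, Real.exp (α * x - -Real.cos θ * Real.exp x) with hD
  have hD0 : 0 ≤ D := integral_nonneg fun x => (Real.exp_pos _).le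
  refine ⟨1 / Real.pi * (Real.exp (α * b + Real.exp b) * |θ - 0| + D), by positivity,
    fun u hu => ?_⟩
  rw [mWright_eq_hankelIntegral h0 h1 hu b, abs_mul, abs_of_pos (by positivity : 0 < 1 / Real.pi),
    mul_assoc]
  gcongr
  have hexp : Real.exp (-(Real.cos (α * hankelAngle α) * Real.exp (α * b)) * u) ≤
      Real.exp (-K * u) := by
    rw [Real.exp_le_exp]; nlinarith
  refine (Complex.abs_im_le_norm _).trans ((norm_add_le _ _).trans ?_)
  rw [add_mul]
  refine add_le_add ?_ ?_
  · rw [norm_mul, Complex.norm_I, one_mul]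
    refine (intervalIntegral.norm_integral_le_of_norm_le_const
      (C := Real.exp (α * b + Real.exp b) * Real.exp (-K * u)) fun y hy => ?_).trans
      (le_of_eq (by ring))
    rw [uIoc_of_le (hankelAngle_pos h0).le] at hy
    refine (norm_hankelKernel_segment_le h0 h1 hu ⟨hy.1.le, hy.2⟩).trans ?_
    gcongr
  · rw [hD, ← integral_mul_const]
    refine norm_integral_le_of_norm_le ((integrableOn_Ioi_exp_sub_exp α ha b).mul_const _) ?_
    refine (ae_restrict_iff' measurableSet_Ioi).2 (Eventually.of_forall fun x hx => ?_)
    refine (norm_hankelKernel_ray_le h0 h1 hu (le_of_lt hx)).trans ?_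
    gcongr

lemma continuousOn_mWright : ContinuousOn (mWright α) (Ici 0) := by
  have ha := neg_pos.2 (cos_hankelAngle_neg h0 h1)
  have hκ := cos_mul_hankelAngle_pos h0 h1
  have : ContinuousOn (fun u : ℝ => 1 / Real.pi *
      (∫ x : ℝ, hankelKernel α α u (x + hankelAngle α * Complex.I)).im) (Ici 0) := by
    refine continuousOn_const.mul (Complex.continuous_im.comp_continuousOn ?_)
    refine continuousOn_of_dominated (bound := fun x =>
      Real.exp (α * x - -Real.cos (hankelAngle α) * Real.exp x)) ?_ ?_
      (integrable_exp_sub_exp h0 ha) ?_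
    · exact fun u _ => ((continuous_hankelKernel α α u).comp (by fun_prop)).aestronglyMeasurable
    · refine fun u hu => Eventually.of_forall fun x => ?_
      have hu' : (0 : ℝ) ≤ u := hu
      refine (norm_hankelKernel_ray_le h0 h1 hu (le_refl x)).trans ?_
      refine mul_le_of_le_one_right (Real.exp_pos _).le (Real.exp_le_one_iff.2 ?_)
      have : 0 ≤ Real.cos (α * hankelAngle α) * Real.exp (α * x) * u := by positivity
      linarith
    · refine Eventually.of_forall fun x => Continuous.continuousOn ?_
      unfold hankelKernel
      fun_prop
  refine this.congr fun u hu => ?_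
  rw [mWright, wright, (hasSum_wrightTerm h0 h1 (-u)).tsum_eq, neg_neg]

lemma aestronglyMeasurable_mWright :
    AEStronglyMeasurable (mWright α) (volume.restrict (Ioi 0)) :=
  ((continuousOn_mWright h0 h1).mono Ioi_subset_Ici_self).aestronglyMeasurable measurableSet_Ioi

lemma integrableOn_pow_mul_exp_mul_mWright (j : ℕ) (K : ℝ) :
    IntegrableOn (fun u => u ^ j * Real.exp (K * u) * mWright α u) (Ioi 0) := by
  obtain ⟨C, hC, hle⟩ := exists_abs_mWright_le h0 h1 (K + 1)
  have h := (integrableOn_rpow_mul_exp_neg_mul_rpow (p := 1) (s := j) (b := 1)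
    (by have : (0 : ℝ) ≤ j := by positivity
        linarith) one_pos one_pos).const_mul C
  refine Integrable.mono' h (AEStronglyMeasurable.mul (by fun_prop)
    (aestronglyMeasurable_mWright h0 h1)) ?_
  refine (ae_restrict_iff' measurableSet_Ioi).2 (Eventually.of_forall fun u hu => ?_)
  have hu' : (0 : ℝ) < u := hu
  rw [norm_mul, norm_mul, norm_pow, Real.norm_of_nonneg hu'.le,
    Real.norm_of_nonneg (Real.exp_pos _).le, Real.norm_eq_abs, Real.rpow_one, Real.rpow_natCast]
  calc u ^ j * Real.exp (K * u) * |mWright α u|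
      ≤ u ^ j * Real.exp (K * u) * (C * Real.exp (-(K + 1) * u)) := by gcongr; exact hle u hu'.le
    _ = C * (u ^ j * (Real.exp (K * u) * Real.exp (-(K + 1) * u))) := by ring
    _ = C * (u ^ j * Real.exp (-1 * u)) := by rw [← Real.exp_add]; congr 3; ring

lemma integrableOn_pow_mul_mWright (j : ℕ) :
    IntegrableOn (fun u => u ^ j * mWright α u) (Ioi 0) := by
  simpa using integrableOn_pow_mul_exp_mul_mWright h0 h1 j 0

lemma integrableOn_mWright : IntegrableOn (mWright α) (Ioi 0) := by
  simpa using integrableOn_pow_mul_mWright h0 h1 0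

end

lemma integrableOn_pow_mul_cexp {B : ℂ} (hB : 0 < B.re) (j : ℕ) :
    IntegrableOn (fun u : ℝ => (u : ℂ) ^ j * Complex.exp (-u * B)) (Ioi 0) := by
  have h := integrableOn_rpow_mul_exp_neg_mul_rpow (p := 1) (s := j) (b := B.re)
    (by have : (0 : ℝ) ≤ j := by positivity
        linarith) one_pos hB
  refine Integrable.mono' h (Continuous.aestronglyMeasurable (by fun_prop)) ?_
  refine (ae_restrict_iff' measurableSet_Ioi).2 (Eventually.of_forall fun u hu => ?_)
  have hu' : (0 : ℝ) < u := hu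
  rw [norm_mul, norm_pow, Complex.norm_real, Real.norm_of_nonneg hu'.le, Complex.norm_exp,
    Real.rpow_one, Real.rpow_natCast]
  simp [mul_comm]

lemma integral_pow_mul_cexp {B : ℂ} (hB : 0 < B.re) (j : ℕ) :
    ∫ u in Ioi (0 : ℝ), (u : ℂ) ^ j * Complex.exp (-u * B) = j.factorial / B ^ (j + 1) := by
  have hB0 : B ≠ 0 := fun h => by simp [h] at hB
  induction j with
  | zero =>
    have := integral_exp_mul_complex_Ioi (a := -B) (by simpa using hB) 0
    simp only [pow_zero, one_mul, Nat.factorial_zero, Nat.cast_one, zero_add, pow_one]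
    simp only [Complex.ofReal_zero, mul_zero, Complex.exp_zero, neg_div_neg_eq] at this
    rw [← this]
    congr 1; ext u; congr 1; ring
  | succ j ih =>
    have hi := (integrableOn_pow_mul_cexp hB j).const_mul ((j : ℂ) + 1)
    have hi2 := (integrableOn_pow_mul_cexp hB (j + 1))
    have hd : ∀ x ∈ Ici (0 : ℝ), HasDerivAt (fun u : ℝ => (u : ℂ) ^ (j + 1) * Complex.exp (-u * B))
        (((j : ℂ) + 1) * ((x : ℂ) ^ j * Complex.exp (-x * B)) -
          B * ((x : ℂ) ^ (j + 1) * Complex.exp (-x * B))) x := fun x _ => by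
      have h2 : HasDerivAt (fun u : ℂ => u ^ (j + 1) * Complex.exp (-u * B))
          (((j + 1 : ℕ) : ℂ) * (x : ℂ) ^ j * 1 * Complex.exp (-x * B) +
            (x : ℂ) ^ (j + 1) * (Complex.exp (-x * B) * (-1 * B))) x :=
        ((hasDerivAt_id (x : ℂ)).pow (j + 1)).mul
          (((hasDerivAt_id (x : ℂ)).neg.mul_const B).cexp)
      refine h2.comp_ofReal.congr_deriv ?_
      push_cast; ring
    have hi3 := hi.sub (hi2.const_mul B)
    have e := integral_Ioi_of_hasDerivAt_of_tendsto' hd hi3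
      (tendsto_zero_of_hasDerivAt_of_integrableOn_Ioi (fun x hx => hd x (mem_Ici_of_Ioi hx)) hi3 hi2)
    rw [integral_sub hi (hi2.const_mul B), integral_const_mul, integral_const_mul, ih] at e
    rw [eq_div_iff (pow_ne_zero _ hB0), Nat.factorial_succ]
    generalize (∫ u in Ioi (0 : ℝ), (u : ℂ) ^ (j + 1) * Complex.exp (-u * B)) = J at e ⊢
    simp only [Complex.ofReal_zero, ne_eq, Nat.add_eq_zero_iff, one_ne_zero, and_false,
      not_false_eq_true, zero_pow, zero_mul, sub_zero] at e
    field_simp at e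
    push_cast
    linear_combination -e

/-- Moments of a mixture of exponentials. -/
lemma integral_pow_mul_integral_cexp {X : Type*} [MeasurableSpace X] {μ : Measure X} [SFinite μ]
    {A B : X → ℂ} (hA : Integrable A μ) (hBm : AEStronglyMeasurable B μ) {c : ℝ} (hc : 0 < c)
    (hB : ∀ᵐ x ∂μ, c ≤ (B x).re) (j : ℕ) :
    Integrable (fun u : ℝ => (u : ℂ) ^ j * ∫ x, A x * Complex.exp (-u * B x) ∂μ)
      (volume.restrict (Ioi 0)) ∧
    ∫ u in Ioi (0 : ℝ), (u : ℂ) ^ j * ∫ x, A x * Complex.exp (-u * B x) ∂μ =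
      j.factorial * ∫ x, A x / B x ^ (j + 1) ∂μ := by
  have hg := (integrableOn_rpow_mul_exp_neg_mul_rpow (p := 1) (s := j) (b := c)
    (by have : (0 : ℝ) ≤ j := by positivity
        linarith) one_pos hc)
  have hint : Integrable (Function.uncurry fun (u : ℝ) (x : X) =>
      A x * ((u : ℂ) ^ j * Complex.exp (-u * B x))) ((volume.restrict (Ioi 0)).prod μ) := by
    refine Integrable.mono' (hg.mul_prod hA.norm) ?_ ?_
    · have hm2 : AEStronglyMeasurable (fun p : ℝ × X => B p.2) ((volume.restrict (Ioi 0)).prod μ) :=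
        hBm.comp_snd
      have hm1 : AEStronglyMeasurable (fun p : ℝ × X => A p.2) ((volume.restrict (Ioi 0)).prod μ) :=
        hA.aestronglyMeasurable.comp_snd
      have hm0 : AEStronglyMeasurable (fun p : ℝ × X => (p.1 : ℂ)) ((volume.restrict (Ioi 0)).prod μ) :=
        (Complex.measurable_ofReal.comp measurable_fst).aestronglyMeasurable
      exact hm1.mul ((hm0.pow j).mul (Complex.continuous_exp.comp_aestronglyMeasurable
        (hm0.neg.mul hm2)))
    · have h1 : ∀ᵐ p : ℝ × X ∂((volume.restrict (Ioi 0)).prod μ), 0 < p.1 :=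
        Measure.quasiMeasurePreserving_fst.ae (ae_restrict_mem measurableSet_Ioi)
      have h2 : ∀ᵐ p : ℝ × X ∂((volume.restrict (Ioi 0)).prod μ), c ≤ (B p.2).re :=
        Measure.quasiMeasurePreserving_snd.ae hB
      filter_upwards [h1, h2] with p hp1 hp2
      simp only [Function.uncurry]
      rw [norm_mul, norm_mul, norm_pow, Complex.norm_real, Real.norm_of_nonneg hp1.le,
        Complex.norm_exp, Real.rpow_one, Real.rpow_natCast, mul_comm]
      gcongr
      simp
      nlinarith
  have e1 : ∀ u : ℝ, (u : ℂ) ^ j * ∫ x, A x * Complex.exp (-u * B x) ∂μ =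
      ∫ x, A x * ((u : ℂ) ^ j * Complex.exp (-u * B x)) ∂μ := fun u => by
    rw [← integral_const_mul]; congr 1; ext x; ring
  simp_rw [e1]
  refine ⟨hint.integral_prod_left, ?_⟩
  rw [integral_integral_swap hint, ← integral_const_mul]
  refine integral_congr_ae ?_
  filter_upwards [hB] with x hx
  rw [integral_const_mul, integral_pow_mul_cexp (by linarith) j]
  ring

section
variable {α : ℝ} (h0 : 0 < α) (h1 : α < 1)
include h0 h1

/-- The moments of the `M`-Wright function. -/
lemma integral_pow_mul_mWright (j : ℕ) :
    ∫ u in Ioi (0 : ℝ), u ^ j * mWright α u = j.factorial / Real.Gamma (α * j + 1) := by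
  set θ := hankelAngle α with hθ
  have hκ := cos_mul_hankelAngle_pos h0 h1
  have hker : ∀ (u : ℝ) (w : ℂ), hankelKernel α α u w =
      hankelKernel α α 0 w * Complex.exp (-u * Complex.exp (α * w)) := fun u w => by
    rw [hankelKernel, hankelKernel, ← Complex.exp_add]; congr 1; push_cast; ring
  -- Integrating u^j e^(-uB) with B = e^(αw) gives j!/B^(j+1), which lowers the exponent from α to
  -- -αj. Hankel's formula is thus used at a non-positive exponent. The contour starts at b = 0, so
  -- that Re B ≥ cos(αθ) > 0 throughout.
  have hdiv : ∀ w : ℂ, hankelKernel α α 0 w / Complex.exp (α * w) ^ (j + 1) =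
      hankelKernel α (-(α * j)) 0 w := fun w => by
    rw [← Complex.exp_nat_mul, hankelKernel, hankelKernel, ← Complex.exp_sub]
    congr 1; push_cast; ring
  have hre : ∀ x y : ℝ, (Complex.exp (α * (x + y * Complex.I))).re =
      Real.exp (α * x) * Real.cos (α * y) := fun x y => by
    rw [Complex.exp_re]; simp
  have hcB : ∀ f : ℝ → ℂ, Continuous f → Continuous fun x => Complex.exp (α * f x) := fun f hf => by
    fun_prop
  obtain ⟨i1, e1⟩ := integral_pow_mul_integral_cexp (μ := volume.restrict (Ioi (0 : ℝ)))
    (A := fun x : ℝ => hankelKernel α α 0 (x + θ * Complex.I))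
    (B := fun x : ℝ => Complex.exp (α * (x + θ * Complex.I)))
    (integrableOn_hankelKernel h0 h1 α le_rfl 0) (hcB _ (by fun_prop)).aestronglyMeasurable
    hκ ((ae_restrict_iff' measurableSet_Ioi).2 (Eventually.of_forall fun x hx => by
      rw [hre]
      refine le_mul_of_one_le_left hκ.le (Real.one_le_exp ?_)
      exact mul_nonneg h0.le (le_of_lt hx))) j
  obtain ⟨i2, e2⟩ := integral_pow_mul_integral_cexp (μ := volume.restrict (Ioc (0 : ℝ) θ))
    (A := fun y : ℝ => hankelKernel α α 0 ((0 : ℝ) + y * Complex.I))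
    (B := fun y : ℝ => Complex.exp (α * ((0 : ℝ) + y * Complex.I)))
    (((continuous_hankelKernel α α 0).comp (by fun_prop)).integrableOn_Icc.mono_set
      Ioc_subset_Icc_self) (hcB _ (by fun_prop)).aestronglyMeasurable
    hκ ((ae_restrict_iff' measurableSet_Ioc).2 (Eventually.of_forall fun y hy => by
      rw [hre]
      simpa using cos_mul_ge h0 h1 (Ioc_subset_Icc_self hy))) j
  simp_rw [← hker, hdiv] at i1 e1 i2 e2
  have hsum : ∫ u in Ioi (0 : ℝ), (u : ℂ) ^ j * hankelIntegral θ 0 (hankelKernel α α u) =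
      j.factorial * hankelIntegral θ 0 (hankelKernel α (-(α * j)) 0) := by
    have : ∀ u : ℝ, (u : ℂ) ^ j * hankelIntegral θ 0 (hankelKernel α α u) =
        Complex.I * ((u : ℂ) ^ j * ∫ y in Ioc (0 : ℝ) θ, hankelKernel α α u ((0 : ℝ) + y * Complex.I)) +
        (u : ℂ) ^ j * ∫ x in Ioi (0 : ℝ), hankelKernel α α u (x + θ * Complex.I) := fun u => by
      rw [hankelIntegral, intervalIntegral.integral_of_le (hankelAngle_pos h0).le]; ring
    simp_rw [this]
    rw [integral_add (i2.const_mul _) i1, integral_const_mul, e1, e2, hankelIntegral,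
      intervalIntegral.integral_of_le (hankelAngle_pos h0).le]
    ring
  have hint : Integrable (fun u : ℝ => (u : ℂ) ^ j * hankelIntegral θ 0 (hankelKernel α α u))
      (volume.restrict (Ioi 0)) := by
    refine ((i2.const_mul Complex.I).add i1).congr (Eventually.of_forall fun u => ?_)
    simp only [hankelIntegral, Pi.add_apply]
    rw [intervalIntegral.integral_of_le (hankelAngle_pos h0).le]; ring
  have him := congrArg Complex.im hsum
  rw [← Complex.imCLM_apply, ← Complex.imCLM.integral_comp_comm hint] at him
  have e3 : ∫ u in Ioi (0 : ℝ), u ^ j * mWright α u = ∫ u in Ioi (0 : ℝ), 1 / Real.pi *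
      Complex.imCLM ((u : ℂ) ^ j * hankelIntegral θ 0 (hankelKernel α α u)) := by
    refine setIntegral_congr_fun measurableSet_Ioi fun u hu => ?_
    rw [mWright_eq_hankelIntegral h0 h1 (le_of_lt hu) 0, Complex.imCLM_apply,
      ← Complex.ofReal_pow, Complex.im_ofReal_mul]
    ring
  rw [e3, integral_const_mul, him, ← Complex.ofReal_natCast, Complex.im_ofReal_mul,
    hankelIntegral_im_eq_Gamma_inv h0 h1, show 1 - -(α * j) = α * j + 1 by ring]
  have := Real.pi_pos
  field_simp

/-- Real exponential moments. -/
lemma hasSum_integral_pow_mul_exp_mWright (k : ℕ) (z : ℝ) :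
    HasSum (fun j : ℕ => z ^ j / j.factorial * ((j + k).factorial / Real.Gamma (α * (j + k) + 1)))
      (∫ u in Ioi (0 : ℝ), u ^ k * Real.exp (z * u) * mWright α u) := by
  have hs : ∀ y : ℝ, ∀ u : ℝ, HasSum (fun j : ℕ => (y ^ j / j.factorial * u ^ (j + k)))
      (u ^ k * Real.exp (y * u)) := fun y u => by
    have := (NormedSpace.expSeries_div_hasSum_exp (y * u)).mul_left (u ^ k)
    rw [← Real.exp_eq_exp_ℝ] at this
    refine this.congr_eq (fun j => ?_) rfl
    rw [mul_pow, pow_add]; ring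
  have key : HasSum (fun j : ℕ => ∫ u in Ioi (0 : ℝ), z ^ j / j.factorial * u ^ (j + k) * mWright α u)
      (∫ u in Ioi (0 : ℝ), u ^ k * Real.exp (z * u) * mWright α u) := by
    refine hasSum_integral_of_dominated_convergence (fun j u =>
      |z| ^ j / j.factorial * |u| ^ (j + k) * |mWright α u|) ?_ ?_ ?_ ?_ ?_
    · exact fun j => AEStronglyMeasurable.mul (by fun_prop) (aestronglyMeasurable_mWright h0 h1)
    · refine fun j => Eventually.of_forall fun u => le_of_eq ?_
      simp
    · exact Eventually.of_forall fun u => ((hs |z| |u|).mul_right _).summable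
    · refine ((integrableOn_pow_mul_exp_mul_mWright h0 h1 k |z|).norm).congr ?_
      refine (ae_restrict_iff' measurableSet_Ioi).2 (Eventually.of_forall fun u hu => ?_)
      have hu' : (0 : ℝ) < u := hu
      simp only
      rw [((hs |z| |u|).mul_right _).tsum_eq, norm_mul, norm_mul, norm_pow,
        Real.norm_of_nonneg (Real.exp_pos _).le, Real.norm_eq_abs, Real.norm_eq_abs,
        abs_of_pos hu']
    · exact Eventually.of_forall fun u => (hs z u).mul_right _
  refine key.congr_eq (fun j => ?_) rfl
  simp_rw [mul_assoc]
  rw [integral_const_mul, integral_pow_mul_mWright h0 h1]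
  push_cast
  rfl

/-- The entire function `∫₀^∞ e^{z u} M(u) du` is the Mittag-Leffler function. -/
lemma hasSum_integral_cexp_mWright (z : ℂ) :
    HasSum (fun j : ℕ => z ^ j / Real.Gamma (α * j + 1))
      (∫ u in Ioi (0 : ℝ), Complex.exp (z * u) * mWright α u) := by
  have hs : ∀ u : ℝ, HasSum (fun j : ℕ => (z ^ j / j.factorial * (u : ℂ) ^ j))
      (Complex.exp (z * u)) := fun u => by
    have := (NormedSpace.expSeries_div_hasSum_exp (z * u))
    rw [← Complex.exp_eq_exp_ℂ] at this
    refine this.congr_eq (fun j => ?_) rfl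
    rw [mul_pow]; ring
  have hs' : ∀ u : ℝ, HasSum (fun j : ℕ => (‖z‖ ^ j / j.factorial * |u| ^ j))
      (Real.exp (‖z‖ * |u|)) := fun u => by
    have := (NormedSpace.expSeries_div_hasSum_exp (‖z‖ * |u|))
    rw [← Real.exp_eq_exp_ℝ] at this
    refine this.congr_eq (fun j => ?_) rfl
    rw [mul_pow]; ring
  have key : HasSum (fun j : ℕ => ∫ u in Ioi (0 : ℝ), z ^ j / j.factorial * (u : ℂ) ^ j * mWright α u)
      (∫ u in Ioi (0 : ℝ), Complex.exp (z * u) * mWright α u) := by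
    refine hasSum_integral_of_dominated_convergence (fun j u =>
      ‖z‖ ^ j / j.factorial * |u| ^ j * |mWright α u|) ?_ ?_ ?_ ?_ ?_
    · exact fun j => AEStronglyMeasurable.mul (by fun_prop)
        (Complex.continuous_ofReal.comp_aestronglyMeasurable (aestronglyMeasurable_mWright h0 h1))
    · refine fun j => Eventually.of_forall fun u => le_of_eq ?_
      simp
    · exact Eventually.of_forall fun u => ((hs' u).mul_right _).summable
    · refine ((integrableOn_pow_mul_exp_mul_mWright h0 h1 0 ‖z‖).norm).congr ?_
      refine (ae_restrict_iff' measurableSet_Ioi).2 (Eventually.of_forall fun u hu => ?_)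
      have hu' : (0 : ℝ) < u := hu
      simp only
      rw [((hs' u).mul_right _).tsum_eq, norm_mul, norm_mul, pow_zero, norm_one, one_mul,
        Real.norm_of_nonneg (Real.exp_pos _).le, Real.norm_eq_abs, abs_of_pos hu']
    · exact Eventually.of_forall fun u => (hs u).mul_right _
  refine key.congr_eq (fun j => ?_) rfl
  simp_rw [mul_assoc]
  rw [integral_const_mul]
  have : ∀ u : ℝ, (u : ℂ) ^ j * (mWright α u : ℂ) = ((u ^ j * mWright α u : ℝ) : ℂ) := fun u => by
    push_cast; rfl
  simp_rw [this]
  rw [integral_complex_ofReal, integral_pow_mul_mWright h0 h1]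
  have : (j.factorial : ℂ) ≠ 0 := by exact_mod_cast j.factorial_ne_zero
  push_cast
  field_simp

end
end FracHeat

namespace FracHeat

/-! ### Positivity from Laplace transforms -/

/-- The function s e^(1-s) is the weight t^N e^(-lt) after rescaling and taking N-th roots; its
strict maximum 1 at s = 1, with monotonicity on either side, is what makes the powers concentrate.
-/
lemma mul_exp_one_sub_lt {s : ℝ} (hs : s ≠ 1) : s * Real.exp (1 - s) < 1 := by
  have h := Real.add_one_lt_exp (sub_ne_zero.2 hs)
  rw [sub_add_cancel] at h
  calc s * Real.exp (1 - s) < Real.exp (s - 1) * Real.exp (1 - s) := by gcongr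
    _ = 1 := by rw [← Real.exp_add]; simp

lemma mul_exp_one_sub_anti {s s' : ℝ} (hs : 1 ≤ s) (hss : s ≤ s') :
    s' * Real.exp (1 - s') ≤ s * Real.exp (1 - s) := by
  have h0 : 0 < s := by linarith
  have h := Real.add_one_le_exp (s' / s - 1)
  rw [sub_add_cancel] at h
  have h2 : s' / s - 1 ≤ s' - s := by
    rw [div_sub_one h0.ne', div_le_iff₀ h0]; nlinarith
  have h3 : s' ≤ s * Real.exp (s' - s) := by
    rw [div_le_iff₀ h0] at h
    calc s' ≤ Real.exp (s' / s - 1) * s := h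
      _ ≤ Real.exp (s' - s) * s := by gcongr
      _ = _ := mul_comm _ _
  calc s' * Real.exp (1 - s') ≤ s * Real.exp (s' - s) * Real.exp (1 - s') := by gcongr
    _ = s * Real.exp (1 - s) := by rw [mul_assoc, ← Real.exp_add]; congr 2; ring

lemma mul_exp_one_sub_mono {s s' : ℝ} (h0 : 0 < s) (hss : s ≤ s') (hs : s' ≤ 1) :
    s * Real.exp (1 - s) ≤ s' * Real.exp (1 - s') := by
  have h0' : 0 < s' := by linarith
  have h := Real.add_one_le_exp (s / s' - 1)
  rw [sub_add_cancel] at h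
  have h2 : s / s' - 1 ≤ s - s' := by
    rw [div_sub_one h0'.ne', div_le_iff₀ h0']; nlinarith
  have h3 : s ≤ s' * Real.exp (s - s') := by
    rw [div_le_iff₀ h0'] at h
    calc s ≤ Real.exp (s / s' - 1) * s' := h
      _ ≤ Real.exp (s - s') * s' := by gcongr
      _ = _ := mul_comm _ _
  calc s * Real.exp (1 - s) ≤ s' * Real.exp (s - s') * Real.exp (1 - s) := by gcongr
    _ = s' * Real.exp (1 - s') := by rw [mul_assoc, ← Real.exp_add]; congr 2; ring

/-- A Post–Widder type criterion for non-negativity. -/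
lemma nonneg_of_forall_integral_pow_mul_exp_nonneg {f : ℝ → ℝ} {x Λ : ℝ} (hx : 0 < x)
    (hf : ContinuousAt f x)
    (hint : ∀ (N : ℕ) (l : ℝ), Λ < l → IntegrableOn (fun t => t ^ N * Real.exp (-l * t) * f t) (Ioi 0))
    (hpos : ∀ (N : ℕ) (l : ℝ), Λ < l → 0 ≤ ∫ t in Ioi (0 : ℝ), t ^ N * Real.exp (-l * t) * f t) :
    0 ≤ f x := by
  by_contra! hneg
  -- Up to a constant factor, K^N is the weight t^N e^(-lt) with l = N/x, normalised to have maximum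
  -- 1 at t = x.
  set K : ℝ → ℝ := fun t => t / x * Real.exp (1 - t / x) with hK
  have hKc : Continuous K := by fun_prop
  have hK0 : ∀ t, 0 < t → 0 ≤ K t := fun t ht => by positivity
  have hKx : K x = 1 := by simp [hK, hx.ne']
  obtain ⟨δ, hδ, hδf⟩ := Metric.eventually_nhds_iff.1 (hf.eventually (gt_mem_nhds
    (show f x < f x / 2 by linarith)))
  obtain ⟨d, hd0, hdδ, hdx⟩ : ∃ d : ℝ, 0 < d ∧ d < δ ∧ d < x :=
    ⟨min δ x / 2, by positivity, by linarith [min_le_left δ x, lt_min hδ hx],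
      by linarith [min_le_right δ x, lt_min hδ hx]⟩
  set ρ : ℝ := max (K (x - d)) (K (x + d)) with hρ
  have hρ1 : ρ < 1 := by
    refine max_lt (mul_exp_one_sub_lt ?_) (mul_exp_one_sub_lt ?_)
    · rw [Ne, div_eq_one_iff_eq hx.ne']; linarith
    · rw [Ne, div_eq_one_iff_eq hx.ne']; linarith
  have hρ0 : 0 < ρ := lt_max_of_lt_right (by positivity)
  have hoff : ∀ t, 0 < t → d ≤ |t - x| → K t ≤ ρ := by
    intro t ht hdt
    rcases le_abs.1 hdt with h | h
    · refine le_max_of_le_right (mul_exp_one_sub_anti ?_ (by gcongr; linarith))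
      rw [one_le_div hx]; linarith
    · refine le_max_of_le_left (mul_exp_one_sub_mono (by positivity) (by gcongr; linarith) ?_)
      rw [div_le_one hx]; linarith
  -- Any value strictly between ρ and 1 would do: K exceeds ρ' close to x and stays below ρ away
  -- from x, so the ratio ρ/ρ' is less than 1.
  set ρ' : ℝ := (1 + ρ) / 2 with hρ'
  obtain ⟨η, hη, hηK⟩ := Metric.eventually_nhds_iff.1 (hKc.continuousAt.eventually (lt_mem_nhds
    (show ρ' < K x by rw [hKx]; linarith)))
  set e : ℝ := min η d with he
  have he0 : 0 < e := lt_min hη hd0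
  -- From N₀ on, l = N/x exceeds Λ, where the hypotheses apply.
  obtain ⟨N₀, hN₀⟩ := exists_nat_gt (Λ * x)
  have hform : ∀ N : ℕ, ∀ t : ℝ, K t ^ N * f t =
      (Real.exp 1 / x) ^ N * (t ^ N * Real.exp (-(N / x) * t) * f t) := by
    intro N t
    have : Real.exp (-(N / x) * t) = Real.exp (-(t / x)) ^ N := by
      rw [← Real.exp_nat_mul]; congr 1; ring
    rw [this, hK]
    simp only
    rw [show 1 - t / x = 1 + -(t / x) by ring, Real.exp_add, div_pow, mul_pow, mul_pow, div_pow]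
    ring
  have hgt : ∀ m : ℕ, Λ < ((N₀ + m : ℕ) : ℝ) / x := fun m => by
    rw [lt_div_iff₀ hx]; push_cast
    have : (0 : ℝ) ≤ m := by positivity
    linarith
  have hKint : ∀ m : ℕ, IntegrableOn (fun t => K t ^ (N₀ + m) * f t) (Ioi 0) := fun m => by
    simp_rw [hform]
    exact (hint _ _ (hgt m)).const_mul _
  have hKpos : ∀ m : ℕ, 0 ≤ ∫ t in Ioi (0 : ℝ), K t ^ (N₀ + m) * f t := fun m => by
    simp_rw [hform]
    rw [integral_const_mul]
    exact mul_nonneg (by positivity) (hpos _ _ (hgt m))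
  set C : ℝ := ∫ t in Ioi (0 : ℝ), ‖K t ^ (N₀ + 0) * f t‖ with hC
  have hS : Ioo (x - e) (x + e) ⊆ Ioi 0 := fun t ht => by
    have := ht.1
    have : e ≤ d := min_le_right _ _
    simp only [mem_Ioi]; linarith
  -- If f(x) < 0, the window of half-width e contributes at most f(x)/2 · ρ'^(N₀+m) · 2e. The zone
  -- from e to d contributes nothing positive, and beyond d the total is at most C ρ^m.
  -- Non-negativity of the whole integral then contradicts ρ < ρ' for large m.
  have hmain : ∀ m : ℕ, -f x / 2 * ρ' ^ N₀ * (2 * e) * ρ' ^ m ≤ C * ρ ^ m := by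
    intro m
    have hi1 : IntegrableOn (fun t => (Ioo (x - e) (x + e)).indicator
        (fun _ => f x / 2 * ρ' ^ (N₀ + m)) t) (Ioi 0) :=
      (integrable_indicator_iff measurableSet_Ioo).2
        (integrableOn_const (by simp)) |>.integrableOn
    have hle : ∫ t in Ioi (0 : ℝ), K t ^ (N₀ + m) * f t ≤ ∫ t in Ioi (0 : ℝ),
        ((Ioo (x - e) (x + e)).indicator (fun _ => f x / 2 * ρ' ^ (N₀ + m)) t +
          ρ ^ m * ‖K t ^ (N₀ + 0) * f t‖) := by
      refine setIntegral_mono_on (hKint m) (hi1.add ((hKint 0).norm.const_mul _))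
        measurableSet_Ioi fun t ht => ?_
      have ht' : 0 < t := ht
      by_cases hd : |t - x| < d
      · have hft : f t < f x / 2 := hδf (by rw [Real.dist_eq]; linarith)
        have hnn : 0 ≤ ρ ^ m * ‖K t ^ (N₀ + 0) * f t‖ := by positivity
        by_cases hte : t ∈ Ioo (x - e) (x + e)
        · rw [indicator_of_mem hte]
          have hKt : ρ' < K t := hηK (by
            rw [Real.dist_eq, abs_lt]
            have : e ≤ η := min_le_left _ _
            exact ⟨by linarith [hte.1], by linarith [hte.2]⟩)
          have hp : ρ' ^ (N₀ + m) ≤ K t ^ (N₀ + m) := by gcongr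
          have hp0 : 0 ≤ ρ' ^ (N₀ + m) := by positivity
          nlinarith
        · rw [indicator_of_notMem hte]
          have : 0 ≤ K t ^ (N₀ + m) := pow_nonneg (hK0 t ht') _
          nlinarith
      · push Not at hd
        have hte : t ∉ Ioo (x - e) (x + e) := fun h => by
          have h1 : |t - x| < e := by
            rw [abs_lt]; exact ⟨by linarith [h.1], by linarith [h.2]⟩
          have : e ≤ d := min_le_right _ _
          linarith
        rw [indicator_of_notMem hte, zero_add]
        refine (le_abs_self _).trans ?_
        rw [abs_mul, norm_mul, abs_of_nonneg (pow_nonneg (hK0 t ht') _), Real.norm_eq_abs,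
          Real.norm_eq_abs, abs_of_nonneg (pow_nonneg (hK0 t ht') _), add_zero, pow_add,
          ← mul_assoc, mul_comm (K t ^ N₀)]
        gcongr
        exact hoff t ht' hd
    rw [integral_add hi1 ((hKint 0).norm.const_mul _), integral_const_mul, ← hC,
      setIntegral_indicator measurableSet_Ioo, inter_eq_right.2 hS, setIntegral_const] at hle
    have h2 := (hKpos m).trans hle
    rw [Real.volume_real_Ioo_of_le (by linarith), smul_eq_mul, pow_add] at h2
    nlinarith
  have hcon : Tendsto (fun m : ℕ => C * (ρ / ρ') ^ m) atTop (𝓝 (C * 0)) :=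
    (tendsto_pow_atTop_nhds_zero_of_lt_one (by positivity) (by
      rw [div_lt_one (by positivity)]; linarith)).const_mul C
  have hge : ∀ m : ℕ, -f x / 2 * ρ' ^ N₀ * (2 * e) ≤ C * (ρ / ρ') ^ m := fun m => by
    have hρp : 0 < ρ' ^ m := by positivity
    rw [div_pow ρ ρ', mul_div_assoc', le_div_iff₀ hρp]
    exact hmain m
  have h3 := ge_of_tendsto' hcon hge
  have h4 : 0 < -f x / 2 * ρ' ^ N₀ * (2 * e) :=
    mul_pos (mul_pos (by linarith) (by positivity)) (by positivity)
  linarith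

/-- `h` is completely monotone up to order `N` on `(0, ∞)`. -/
def CompletelyMonotoneUpTo : ℕ → (ℝ → ℝ) → Prop
  | 0, h => ∀ l, 0 < l → 0 ≤ h l
  | N + 1, h => (∀ l, 0 < l → 0 ≤ h l) ∧
      ∃ h' : ℝ → ℝ, (∀ l, 0 < l → HasDerivAt h (-h' l) l) ∧ CompletelyMonotoneUpTo N h'

namespace CompletelyMonotoneUpTo

lemma nonneg {N : ℕ} {h : ℝ → ℝ} (hh : CompletelyMonotoneUpTo N h) {l : ℝ} (hl : 0 < l) :
    0 ≤ h l := by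
  cases N with
  | zero => exact hh l hl
  | succ N => exact hh.1 l hl

lemma pred {N : ℕ} {h : ℝ → ℝ} (hh : CompletelyMonotoneUpTo (N + 1) h) :
    CompletelyMonotoneUpTo N h := by
  induction N generalizing h with
  | zero => exact hh.1
  | succ N ih =>
    obtain ⟨h1, h', h2, h3⟩ := hh
    exact ⟨h1, h', h2, ih h3⟩

lemma add {N : ℕ} {f g : ℝ → ℝ} (hf : CompletelyMonotoneUpTo N f)
    (hg : CompletelyMonotoneUpTo N g) : CompletelyMonotoneUpTo N fun l => f l + g l := by
  induction N generalizing f g with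
  | zero => exact fun l hl => add_nonneg (hf l hl) (hg l hl)
  | succ N ih =>
    obtain ⟨f1, f', f2, f3⟩ := hf
    obtain ⟨g1, g', g2, g3⟩ := hg
    refine ⟨fun l hl => add_nonneg (f1 l hl) (g1 l hl), fun l => f' l + g' l, fun l hl => ?_,
      ih f3 g3⟩
    exact ((f2 l hl).add (g2 l hl)).congr_deriv (by ring)

/-- Leibniz' rule: each derivative leaves one factor undifferentiated, and that factor is weakened
by `pred` to match the lower order. -/
lemma mul {N : ℕ} {f g : ℝ → ℝ} (hf : CompletelyMonotoneUpTo N f)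
    (hg : CompletelyMonotoneUpTo N g) : CompletelyMonotoneUpTo N fun l => f l * g l := by
  induction N generalizing f g with
  | zero => exact fun l hl => mul_nonneg (hf l hl) (hg l hl)
  | succ N ih =>
    have hf' := hf.pred
    have hg' := hg.pred
    obtain ⟨f1, f', f2, f3⟩ := hf
    obtain ⟨g1, g', g2, g3⟩ := hg
    refine ⟨fun l hl => mul_nonneg (f1 l hl) (g1 l hl), fun l => f' l * g l + f l * g' l,
      fun l hl => ?_, (ih f3 hg').add (ih hf' g3)⟩
    exact ((f2 l hl).mul (g2 l hl)).congr_deriv (by ring)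

lemma const_mul_rpow (N : ℕ) {a b : ℝ} (ha : 0 ≤ a) (hb : b ≤ 0) :
    CompletelyMonotoneUpTo N fun l => a * l ^ b := by
  induction N generalizing a b with
  | zero => exact fun l hl => by positivity
  | succ N ih =>
    refine ⟨fun l hl => by positivity, fun l => (a * -b) * l ^ (b - 1), fun l hl => ?_,
      ih (mul_nonneg ha (by linarith)) (by linarith)⟩
    exact ((Real.hasDerivAt_rpow_const (Or.inl hl.ne')).const_mul a).congr_deriv (by ring)

/-- Minus the derivative is α l^(α-1) (l^α + z)^(-2), a product of completely monotone functions
because α < 1, so the induction on the order closes. -/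
lemma inv_rpow_add (N : ℕ) {α z : ℝ} (h0 : 0 < α) (h1 : α < 1) (hz : 0 < z) :
    CompletelyMonotoneUpTo N fun l => (l ^ α + z)⁻¹ := by
  induction N with
  | zero => exact fun l hl => by positivity
  | succ N ih =>
    refine ⟨fun l hl => by positivity,
      fun l => α * l ^ (α - 1) * ((l ^ α + z)⁻¹ * (l ^ α + z)⁻¹), fun l hl => ?_,
      (const_mul_rpow N h0.le (by linarith)).mul (ih.mul ih)⟩
    have hne : l ^ α + z ≠ 0 := by positivity
    refine (((Real.hasDerivAt_rpow_const (p := α) (Or.inl hl.ne')).add_const z).fun_inv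
      hne).congr_deriv ?_
    field_simp

lemma pow {N : ℕ} {f : ℝ → ℝ} (hf : CompletelyMonotoneUpTo N f) (k : ℕ) :
    CompletelyMonotoneUpTo N fun l => f l ^ k := by
  induction k with
  | zero => simpa using const_mul_rpow N zero_le_one (le_refl (0 : ℝ))
  | succ k ih => simpa only [pow_succ] using ih.mul hf

end CompletelyMonotoneUpTo

lemma hasDerivAt_integral_exp_neg_mul {f : ℝ → ℝ} {Λ : ℝ}
    (hint : ∀ (N : ℕ) (l : ℝ), Λ < l → IntegrableOn (fun t => t ^ N * Real.exp (-l * t) * f t) (Ioi 0))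
    {l : ℝ} (hl : Λ < l) :
    HasDerivAt (fun l => ∫ t in Ioi (0 : ℝ), Real.exp (-l * t) * f t)
      (-∫ t in Ioi (0 : ℝ), Real.exp (-l * t) * (t * f t)) l := by
  have h0 : ∀ l, Λ < l → IntegrableOn (fun t => Real.exp (-l * t) * f t) (Ioi 0) := fun l hl => by
    simpa using hint 0 l hl
  have h1 : ∀ l, Λ < l → IntegrableOn (fun t => Real.exp (-l * t) * (t * f t)) (Ioi 0) :=
    fun l hl => by
      refine (hint 1 l hl).congr (Eventually.of_forall fun t => ?_)
      simp only; ring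
  have hm : Λ < (Λ + l) / 2 := by linarith
  rw [← integral_neg]
  refine (hasDerivAt_integral_of_dominated_loc_of_deriv_le (s := Ioi ((Λ + l) / 2))
    (bound := fun t => ‖Real.exp (-((Λ + l) / 2) * t) * (t * f t)‖)
    (F := fun l t => Real.exp (-l * t) * f t)
    (F' := fun l t => -(Real.exp (-l * t) * (t * f t)))
    (Ioi_mem_nhds (by linarith)) ?_ (h0 l hl) (h1 l hl).neg.aestronglyMeasurable ?_
    (h1 _ hm).norm ?_).2
  · filter_upwards [Ioi_mem_nhds hl] with l' hl' using (h0 l' hl').aestronglyMeasurable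
  · refine (ae_restrict_iff' measurableSet_Ioi).2 (Eventually.of_forall fun t ht l' hl' => ?_)
    rw [norm_neg, norm_mul, norm_mul (Real.exp _), Real.norm_of_nonneg (Real.exp_pos _).le,
      Real.norm_of_nonneg (Real.exp_pos _).le]
    have : (0 : ℝ) < t := ht
    have : (Λ + l) / 2 < l' := hl'
    gcongr
  · refine Eventually.of_forall fun t l' _ => ?_
    have : HasDerivAt (fun l : ℝ => Real.exp (-l * t) * f t)
        (Real.exp (-l' * t) * (-1 * t) * f t) l' :=
      (((hasDerivAt_id l').neg.mul_const t).exp).mul_const (f t)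
    exact this.congr_deriv (by ring)

/-- Each factor t under the integral is minus a derivative in l. The transform need agree with h
only on (Λ, ∞), because derivatives are local. -/
lemma CompletelyMonotoneUpTo.integral_nonneg {N : ℕ} {f h : ℝ → ℝ} {Λ : ℝ} (hΛ : 0 ≤ Λ)
    (hh : CompletelyMonotoneUpTo N h)
    (hint : ∀ (N : ℕ) (l : ℝ), Λ < l → IntegrableOn (fun t => t ^ N * Real.exp (-l * t) * f t) (Ioi 0))
    (heq : ∀ l, Λ < l → ∫ t in Ioi (0 : ℝ), Real.exp (-l * t) * f t = h l) {l : ℝ} (hl : Λ < l) :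
    0 ≤ ∫ t in Ioi (0 : ℝ), t ^ N * Real.exp (-l * t) * f t := by
  induction N generalizing f h with
  | zero =>
    simp only [pow_zero, one_mul]
    rw [heq l hl]
    exact hh.nonneg (hΛ.trans_lt hl)
  | succ N ih =>
    obtain ⟨_, h', h2, h3⟩ := hh
    have := ih (f := fun t => t * f t) h3 (fun N l hl => by
      refine (hint (N + 1) l hl).congr (Eventually.of_forall fun t => ?_)
      simp only; ring) (fun l hl => by
      have d1 := hasDerivAt_integral_exp_neg_mul hint hl
      have d2 := (h2 l (hΛ.trans_lt hl)).congr_of_eventuallyEq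
        (f₁ := fun l => ∫ t in Ioi (0 : ℝ), Real.exp (-l * t) * f t)
        (by filter_upwards [Ioi_mem_nhds hl] with l' hl' using heq l' hl')
      linarith [d1.unique d2])
    refine this.trans_eq ?_
    congr 1; ext t; ring

lemma integrableOn_rpow_mul_exp_neg {s l : ℝ} (hs : -1 < s) (hl : 0 < l) :
    IntegrableOn (fun t => t ^ s * Real.exp (-l * t)) (Ioi 0) := by
  simpa using integrableOn_rpow_mul_exp_neg_mul_rpow hs one_pos hl

/-! ### Non-negativity of the M-Wright function. -/

section
variable {α : ℝ} (h0 : 0 < α) (h1 : α < 1)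
include h0 h1

lemma continuousOn_integral_pow_mul_exp_mWright (k : ℕ) :
    ContinuousOn (fun s : ℝ => ∫ u in Ioi (0 : ℝ), u ^ k * Real.exp (-s * u) * mWright α u)
      (Ici 0) := by
  refine continuousOn_of_dominated (bound := fun u => ‖u ^ k * mWright α u‖) ?_ ?_
    (integrableOn_pow_mul_mWright h0 h1 k).norm ?_
  · exact fun s _ => AEStronglyMeasurable.mul (by fun_prop) (aestronglyMeasurable_mWright h0 h1)
  · refine fun s hs => (ae_restrict_iff' measurableSet_Ioi).2 (Eventually.of_forall fun u hu => ?_)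
    have hu' : (0 : ℝ) < u := hu
    have hs' : (0 : ℝ) ≤ s := hs
    rw [norm_mul, norm_mul, norm_mul (u ^ k), Real.norm_of_nonneg (Real.exp_pos _).le]
    gcongr
    refine mul_le_of_le_one_right (norm_nonneg _) (Real.exp_le_one_iff.2 ?_)
    nlinarith
  · exact Eventually.of_forall fun u => Continuous.continuousOn (by fun_prop)

lemma abs_integral_pow_mul_exp_mWright_le (k : ℕ) {s : ℝ} (hs : 0 ≤ s) :
    |∫ u in Ioi (0 : ℝ), u ^ k * Real.exp (-s * u) * mWright α u| ≤
      ∫ u in Ioi (0 : ℝ), ‖u ^ k * mWright α u‖ := by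
  rw [← Real.norm_eq_abs]
  refine norm_integral_le_of_norm_le (integrableOn_pow_mul_mWright h0 h1 k).norm ?_
  refine (ae_restrict_iff' measurableSet_Ioi).2 (Eventually.of_forall fun u hu => ?_)
  have hu' : (0 : ℝ) < u := hu
  rw [norm_mul, norm_mul, norm_mul (u ^ k), Real.norm_of_nonneg (Real.exp_pos _).le]
  gcongr
  refine mul_le_of_le_one_right (norm_nonneg _) (Real.exp_le_one_iff.2 ?_)
  nlinarith

/-- The Laplace transform in time of the derivatives of the Mittag-Leffler function. -/
lemma laplace_integral_pow_mul_exp_mWright (k : ℕ) {z l : ℝ} (hz : 0 < z) (hl0 : 0 < l)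
    (hl : z < l ^ α) :
    ∫ t in Ioi (0 : ℝ), Real.exp (-l * t) * (t ^ (α * k) *
      ∫ u in Ioi (0 : ℝ), u ^ k * Real.exp (-(z * t ^ α) * u) * mWright α u) =
      k.factorial * l ^ (α - 1) * ((l ^ α + z)⁻¹) ^ (k + 1) := by
  have hlα : 0 < l ^ α := by positivity
  have hbase : ∀ j : ℕ, ∫ t in Ioi (0 : ℝ), t ^ (α * (j + k)) * Real.exp (-l * t) =
      Real.Gamma (α * (j + k) + 1) * ((l ^ α)⁻¹ ^ (j + k) * l⁻¹) := by
    intro j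
    have := Real.integral_rpow_mul_exp_neg_mul_Ioi (a := α * (j + k) + 1) (r := l)
      (by positivity) hl0
    simp only [add_sub_cancel_right] at this
    simp only [neg_mul]
    rw [this, one_div, Real.inv_rpow hl0.le, Real.rpow_add hl0, Real.rpow_one, mul_inv,
      Real.rpow_mul hl0.le, ← Nat.cast_add, Real.rpow_natCast, inv_pow]
    ring
  set F : ℕ → ℝ → ℝ := fun j t => (-z) ^ j / j.factorial *
    ((j + k).factorial / Real.Gamma (α * (j + k) + 1)) *
    (t ^ (α * (j + k)) * Real.exp (-l * t)) with hF
  have hFi : ∀ j, IntegrableOn (F j) (Ioi 0) := fun j =>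
    (integrableOn_rpow_mul_exp_neg (by
      have : (0 : ℝ) ≤ α * (j + k) := by positivity
      linarith) hl0).const_mul _
  have hfac : ∀ j : ℕ, ((j + k).factorial : ℝ) / j.factorial = k.factorial * (j + k).choose k := by
    intro j
    rw [div_eq_iff (by positivity)]
    have := Nat.add_choose_mul_factorial_mul_factorial j k
    rw [← this]
    push_cast; ring
  have hFint : ∀ j, ∫ t in Ioi (0 : ℝ), F j t =
      k.factorial * (l ^ α)⁻¹ ^ k * l⁻¹ * ((j + k).choose k * (-z * (l ^ α)⁻¹) ^ j) := fun j => by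
    have hG : Real.Gamma (α * (j + k) + 1) ≠ 0 := (Real.Gamma_pos_of_pos (by positivity)).ne'
    rw [hF]
    simp only
    rw [integral_const_mul, hbase, mul_pow, pow_add]
    calc _ = ((j + k).factorial / j.factorial : ℝ) * ((-z) ^ j * ((l ^ α)⁻¹ ^ j * (l ^ α)⁻¹ ^ k) *
          l⁻¹) := by field_simp
      _ = _ := by rw [hfac]; ring
  have hr : ‖-z * (l ^ α)⁻¹‖ < 1 := by
    rw [norm_mul, norm_neg, norm_inv, Real.norm_of_nonneg hz.le, Real.norm_of_nonneg hlα.le,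
      ← div_eq_mul_inv, div_lt_one hlα]
    exact hl
  have hnorm : ∀ j, ∫ t in Ioi (0 : ℝ), ‖F j t‖ =
      k.factorial * (l ^ α)⁻¹ ^ k * l⁻¹ * ((j + k).choose k * (z * (l ^ α)⁻¹) ^ j) := fun j => by
    have hG : 0 < Real.Gamma (α * (j + k) + 1) := Real.Gamma_pos_of_pos (by positivity)
    have : ∫ t in Ioi (0 : ℝ), ‖F j t‖ = ∫ t in Ioi (0 : ℝ), z ^ j / j.factorial *
        ((j + k).factorial / Real.Gamma (α * (j + k) + 1)) *
        (t ^ (α * (j + k)) * Real.exp (-l * t)) := by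
      refine setIntegral_congr_fun measurableSet_Ioi fun t ht => ?_
      have ht' : (0 : ℝ) < t := ht
      simp only [hF]
      rw [norm_mul, norm_mul, norm_div, norm_pow, norm_neg, Real.norm_of_nonneg hz.le,
        Real.norm_of_nonneg (by positivity : (0 : ℝ) ≤ j.factorial),
        Real.norm_of_nonneg (by positivity :
          (0 : ℝ) ≤ (j + k).factorial / Real.Gamma (α * (j + k) + 1)),
        Real.norm_of_nonneg (by positivity)]
    rw [this, integral_const_mul, hbase, mul_pow, pow_add]
    calc _ = ((j + k).factorial / j.factorial : ℝ) * (z ^ j * ((l ^ α)⁻¹ ^ j * (l ^ α)⁻¹ ^ k) *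
          l⁻¹) := by field_simp
      _ = _ := by rw [hfac]; ring
  -- The condition z < l^α makes the negative binomial series of (1 + z l^(-α))^(-k-1) converge
  -- absolutely, which justifies the termwise Laplace transform.
  have hS := hasSum_integral_of_summable_integral_norm hFi (by
    simp_rw [hnorm]
    refine Summable.mul_left _ (summable_choose_mul_geometric_of_norm_lt_one k ?_)
    rw [norm_mul] at hr ⊢
    rwa [norm_neg] at hr)
  have hpt : ∀ t ∈ Ioi (0 : ℝ), Real.exp (-l * t) * (t ^ (α * k) *
      ∫ u in Ioi (0 : ℝ), u ^ k * Real.exp (-(z * t ^ α) * u) * mWright α u) = ∑' j, F j t := by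
    intro t ht
    have ht' : (0 : ℝ) < t := ht
    have hs := (hasSum_integral_pow_mul_exp_mWright h0 h1 k (-(z * t ^ α))).mul_left
      (Real.exp (-l * t) * t ^ (α * k))
    rw [← mul_assoc, ← hs.tsum_eq]
    congr 1; ext j
    simp only [hF]
    rw [mul_add α, Real.rpow_add ht', Real.rpow_mul ht'.le α j, Real.rpow_natCast, ← neg_mul,
      mul_pow]
    ring
  rw [setIntegral_congr_fun measurableSet_Ioi hpt]
  refine hS.unique ?_
  simp_rw [hFint]
  refine ((hasSum_choose_mul_geometric_of_norm_lt_one' k hr).mul_left _).congr_eq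
    (fun _ => rfl) ?_
  have h5 : 1 - -z * (l ^ α)⁻¹ = (l ^ α + z) * (l ^ α)⁻¹ := by field_simp; ring
  have h6 : l ^ (α - 1) = l ^ α * l⁻¹ := by
    rw [Real.rpow_sub hl0, Real.rpow_one, div_eq_mul_inv]
  rw [h5, h6, Ring.inverse_eq_inv', mul_inv, inv_inv, mul_pow, inv_pow, inv_pow,
    pow_succ (l ^ α)]
  field_simp

/-- The k-th moment with weight e^(-zu) is the value at t = 1 of a function of time whose Laplace
transform is completely monotone, so the Post–Widder criterion applies. The transform is only
computed for l > z^(1/α), which is why the criterion allows a threshold Λ. -/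
lemma integral_pow_mul_exp_mWright_nonneg (k : ℕ) {z : ℝ} (hz : 0 < z) :
    0 ≤ ∫ u in Ioi (0 : ℝ), u ^ k * Real.exp (-z * u) * mWright α u := by
  set f : ℝ → ℝ := fun t => t ^ (α * k) *
      ∫ u in Ioi (0 : ℝ), u ^ k * Real.exp (-(z * t ^ α) * u) * mWright α u with hf
  have hcont : ContinuousOn f (Ioi 0) := by
    refine ContinuousOn.mul (fun t ht => (Real.continuousAt_rpow_const _ _
      (Or.inl (ne_of_gt ht))).continuousWithinAt) ?_
    refine (continuousOn_integral_pow_mul_exp_mWright h0 h1 k).comp (f := fun t => z * t ^ α) ?_ ?_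
    · exact continuousOn_const.mul (fun t ht => (Real.continuousAt_rpow_const _ _
        (Or.inl (ne_of_gt ht))).continuousWithinAt)
    · intro t ht
      have : (0 : ℝ) < t := ht
      simp only [mem_Ici]; positivity
  set Λ : ℝ := z ^ (1 / α) with hΛ
  have hΛ0 : 0 ≤ Λ := by positivity
  have hΛl : ∀ l, Λ < l → z < l ^ α := fun l hl => by
    calc z = Λ ^ α := by rw [hΛ, ← Real.rpow_mul hz.le, one_div_mul_cancel h0.ne', Real.rpow_one]
      _ < l ^ α := by gcongr
  have hint : ∀ (N : ℕ) (l : ℝ), Λ < l →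
      IntegrableOn (fun t => t ^ N * Real.exp (-l * t) * f t) (Ioi 0) := by
    intro N l hl
    have h := (integrableOn_rpow_mul_exp_neg (s := N + α * k) (by
      have : (0 : ℝ) ≤ N + α * k := by positivity
      linarith) (hΛ0.trans_lt hl)).mul_const (∫ u in Ioi (0 : ℝ), ‖u ^ k * mWright α u‖)
    refine Integrable.mono' h ?_ ?_
    · exact (Continuous.aestronglyMeasurable (by fun_prop)).mul
        (hcont.aestronglyMeasurable measurableSet_Ioi)
    · refine (ae_restrict_iff' measurableSet_Ioi).2 (Eventually.of_forall fun t ht => ?_)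
      have ht' : (0 : ℝ) < t := ht
      simp only [hf]
      rw [norm_mul, norm_mul, norm_mul, Real.norm_of_nonneg (Real.exp_pos _).le,
        Real.norm_of_nonneg (by positivity : 0 ≤ t ^ N),
        Real.norm_of_nonneg (by positivity : 0 ≤ t ^ (α * k)), Real.rpow_add ht',
        Real.rpow_natCast]
      calc _ ≤ t ^ N * Real.exp (-l * t) * (t ^ (α * k) *
            ∫ u in Ioi (0 : ℝ), ‖u ^ k * mWright α u‖) := by
            gcongr
            exact abs_integral_pow_mul_exp_mWright_le h0 h1 k (by positivity)
        _ = _ := by ring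
  have := nonneg_of_forall_integral_pow_mul_exp_nonneg (f := f) (x := 1) (Λ := Λ) one_pos
    (hcont.continuousAt (Ioi_mem_nhds one_pos)) hint (fun N l hl =>
      CompletelyMonotoneUpTo.integral_nonneg hΛ0
        (((CompletelyMonotoneUpTo.const_mul_rpow N (by positivity : (0 : ℝ) ≤ k.factorial)
          (by linarith : α - 1 ≤ 0)).mul
          ((CompletelyMonotoneUpTo.inv_rpow_add N h0 h1 hz).pow (k + 1)))) hint
        (fun l hl => laplace_integral_pow_mul_exp_mWright h0 h1 k hz (hΛ0.trans_lt hl) (hΛl l hl))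
        hl)
  simpa [hf] using this

/-- The `M`-Wright function is non-negative on `[0, ∞)`. -/
lemma mWright_nonneg {u : ℝ} (hu : 0 ≤ u) : 0 ≤ mWright α u := by
  -- Second use of the criterion, now in the variable u and with Λ = 0.
  have hpos : ∀ u, 0 < u → 0 ≤ mWright α u := fun u hu =>
    nonneg_of_forall_integral_pow_mul_exp_nonneg (Λ := 0) hu
      ((continuousOn_mWright h0 h1).continuousAt (Ici_mem_nhds hu))
      (fun N l _ => integrableOn_pow_mul_exp_mul_mWright h0 h1 N (-l))
      (fun N l hl => integral_pow_mul_exp_mWright_nonneg h0 h1 N hl)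
  rcases hu.eq_or_lt with rfl | hu
  · have ht : Tendsto (mWright α) (𝓝[>] 0) (𝓝 (mWright α 0)) :=
      ((continuousOn_mWright h0 h1) 0 self_mem_Ici).mono_left
        (nhdsWithin_mono _ Ioi_subset_Ici_self)
    exact ge_of_tendsto ht (by filter_upwards [self_mem_nhdsWithin] with u hu using hpos u hu)
  · exact hpos u hu

end
end FracHeat

namespace FracHeat

/-! ### Fractional integrals -/

/-- The Riemann–Liouville fractional integral of order `a`, started at `0`. -/
noncomputable def fracInt (a : ℝ) (f : ℝ → ℂ) (t : ℝ) : ℂ :=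
  (1 / Real.Gamma a : ℝ) * ∫ s in (0 : ℝ)..t, (((t - s) ^ (a - 1) : ℝ) : ℂ) * f s

lemma integral_sub_rpow_mul_rpow {a b t : ℝ} (ha : 0 < a) (hb : 0 < b) (ht : 0 < t) :
    ∫ s in (0 : ℝ)..t, (t - s) ^ (a - 1) * s ^ (b - 1) =
      Real.Gamma a * Real.Gamma b / Real.Gamma (a + b) * t ^ (a + b - 1) := by
  have h1 := Complex.betaIntegral_scaled (b : ℂ) (a : ℂ) ht
  have h2 := Complex.Gamma_mul_Gamma_eq_betaIntegral (s := (b : ℂ)) (t := (a : ℂ))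
    (by simpa using hb) (by simpa using ha)
  have hG : Complex.Gamma ((b : ℂ) + a) ≠ 0 := Complex.Gamma_ne_zero_of_re_pos (by
    simp; linarith)
  have h3 : Complex.betaIntegral (b : ℂ) a =
      ((Real.Gamma a * Real.Gamma b / Real.Gamma (a + b) : ℝ) : ℂ) := by
    have : Complex.betaIntegral (b : ℂ) a = Complex.Gamma b * Complex.Gamma a /
        Complex.Gamma (b + a) := by
      rw [h2]; field_simp
    rw [this, Complex.Gamma_ofReal, Complex.Gamma_ofReal, ← Complex.ofReal_add,
      Complex.Gamma_ofReal, add_comm b a]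
    push_cast; ring
  rw [h3] at h1
  apply Complex.ofReal_injective
  rw [← intervalIntegral.integral_ofReal]
  have h4 : ((Real.Gamma a * Real.Gamma b / Real.Gamma (a + b) * t ^ (a + b - 1) : ℝ) : ℂ) =
      (t : ℂ) ^ ((b : ℂ) + a - 1) * ((Real.Gamma a * Real.Gamma b / Real.Gamma (a + b) : ℝ) : ℂ) := by
    rw [Complex.ofReal_mul _ (t ^ (a + b - 1)), Complex.ofReal_cpow ht.le, mul_comm]
    congr 2; push_cast; ring
  rw [h4, ← h1]
  refine intervalIntegral.integral_congr fun s hs => ?_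
  rw [uIcc_of_le ht.le] at hs
  rw [Complex.ofReal_mul, Complex.ofReal_cpow (by linarith [hs.2]), Complex.ofReal_cpow hs.1,
    mul_comm]
  push_cast
  rfl

/-- The integral of a non-integrable function is 0 by convention, whereas the Beta value is
positive. -/
lemma intervalIntegrable_sub_rpow_mul_rpow {a b t : ℝ} (ha : 0 < a) (hb : 0 < b) (ht : 0 < t) :
    IntervalIntegrable (fun s => (t - s) ^ (a - 1) * s ^ (b - 1)) volume 0 t := by
  by_contra h
  have := intervalIntegral.integral_undef h
  rw [integral_sub_rpow_mul_rpow ha hb ht] at this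
  have h1 := Real.Gamma_pos_of_pos ha
  have h2 := Real.Gamma_pos_of_pos hb
  have h3 := Real.Gamma_pos_of_pos (add_pos ha hb)
  have : 0 < Real.Gamma a * Real.Gamma b / Real.Gamma (a + b) * t ^ (a + b - 1) := by positivity
  linarith

lemma integral_sub_rpow_mul_sub_rpow {a b z t : ℝ} (ha : 0 < a) (hb : 0 < b) (ht : z < t) :
    ∫ s in z..t, (t - s) ^ (a - 1) * (s - z) ^ (b - 1) =
      Real.Gamma a * Real.Gamma b / Real.Gamma (a + b) * (t - z) ^ (a + b - 1) := by
  rw [← integral_sub_rpow_mul_rpow ha hb (sub_pos.2 ht)]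
  have := intervalIntegral.integral_comp_sub_right (a := z) (b := t)
    (fun s : ℝ => (t - z - s) ^ (a - 1) * s ^ (b - 1)) z
  rw [sub_self] at this
  rw [← this]
  congr 1; ext s; congr 2; ring

lemma intervalIntegrable_sub_rpow_mul_sub_rpow {a b z t : ℝ} (ha : 0 < a) (hb : 0 < b)
    (ht : z < t) :
    IntervalIntegrable (fun s => (t - s) ^ (a - 1) * (s - z) ^ (b - 1)) volume z t := by
  by_contra h
  have := intervalIntegral.integral_undef h
  rw [integral_sub_rpow_mul_sub_rpow ha hb ht] at this
  have h1 := Real.Gamma_pos_of_pos ha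
  have h2 := Real.Gamma_pos_of_pos hb
  have h3 := Real.Gamma_pos_of_pos (add_pos ha hb)
  have h4 := sub_pos.2 ht
  have : 0 < Real.Gamma a * Real.Gamma b / Real.Gamma (a + b) * (t - z) ^ (a + b - 1) := by
    positivity
  linarith

lemma fracInt_congr {a t : ℝ} (ht : 0 < t) {f g : ℝ → ℂ} (h : ∀ s, 0 < s → f s = g s) :
    fracInt a f t = fracInt a g t := by
  unfold fracInt
  congr 1
  rw [intervalIntegral.integral_of_le ht.le, intervalIntegral.integral_of_le ht.le]
  refine setIntegral_congr_fun measurableSet_Ioc fun s hs => ?_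
  simp only [h s hs.1]

lemma fracInt_one (f : ℝ → ℂ) (t : ℝ) : fracInt 1 f t = ∫ s in (0 : ℝ)..t, f s := by
  simp [fracInt]

/-- The semigroup property of fractional integrals. -/
lemma fracInt_fracInt {a b t : ℝ} (ha : 0 < a) (hb : 0 < b) (hab : 1 ≤ a + b) (ht : 0 < t)
    {f : ℝ → ℂ} (hf : IntervalIntegrable f volume 0 t) :
    fracInt a (fracInt b f) t = fracInt (a + b) f t := by
  set μ := (volume : Measure ℝ).restrict (Ioc 0 t) with hμ
  have hf' : Integrable f μ := (intervalIntegrable_iff_integrableOn_Ioc_of_le ht.le).1 hf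
  set k : ℝ → ℝ → ℝ := fun z s => (t - s) ^ (a - 1) * (s - z) ^ (b - 1) with hk
  -- Extension by 0 off the triangle z < s puts Fubini on a square. The inner integral is a multiple
  -- of (t-z)^(a+b-1), which is bounded because a + b ≥ 1, so mere integrability of f suffices.
  set F : ℝ × ℝ → ℂ := fun p => {p : ℝ × ℝ | p.1 < p.2}.indicator
    (fun p => ((k p.1 p.2 : ℝ) : ℂ) * f p.1) p with hF
  have hms : MeasurableSet {p : ℝ × ℝ | p.1 < p.2} := measurableSet_lt measurable_fst measurable_snd
  have hFm : AEStronglyMeasurable F (μ.prod μ) := by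
    refine AEStronglyMeasurable.indicator ?_ hms
    refine AEStronglyMeasurable.mul ?_ hf'.aestronglyMeasurable.comp_fst
    refine (Complex.measurable_ofReal.comp ?_).aestronglyMeasurable
    exact ((measurable_const.sub measurable_snd).pow_const _).mul
      ((measurable_snd.sub measurable_fst).pow_const _)
  set B : ℝ := Real.Gamma a * Real.Gamma b / Real.Gamma (a + b) with hB
  have hFz : ∀ z s, F (z, s) = (Ioi z).indicator (fun s => ((k z s : ℝ) : ℂ) * f z) s := by
    intro z s
    by_cases h : z < s
    · simp [hF, h]
    · simp [hF, h]
  have hset : ∀ z ∈ Ioc 0 t, Ioc 0 t ∩ Ioi z = Ioc z t := fun z hz => by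
    ext s; simp only [mem_inter_iff, mem_Ioc, mem_Ioi]
    constructor
    · rintro ⟨⟨_, h⟩, h'⟩; exact ⟨h', h⟩
    · rintro ⟨h, h'⟩; exact ⟨⟨hz.1.trans h, h'⟩, h⟩
  have hki : ∀ z ∈ Ioc 0 t, IntegrableOn (k z) (Ioc z t) := fun z hz => by
    rcases hz.2.eq_or_lt with rfl | h
    · simp
    · exact (intervalIntegrable_iff_integrableOn_Ioc_of_le h.le).1
        (intervalIntegrable_sub_rpow_mul_sub_rpow ha hb h)
  have hkI : ∀ z ∈ Ioo 0 t, ∫ s in Ioc z t, k z s = B * (t - z) ^ (a + b - 1) := fun z hz => by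
    rw [← intervalIntegral.integral_of_le hz.2.le, ← integral_sub_rpow_mul_sub_rpow ha hb hz.2]
  have hae : ∀ᵐ z ∂μ, z ∈ Ioo 0 t := by
    rw [hμ, restrict_Ioo_eq_restrict_Ioc.symm]
    exact ae_restrict_mem measurableSet_Ioo
  have hin : ∀ z ∈ Ioo 0 t, ∫ s, F (z, s) ∂μ =
      ((B * (t - z) ^ (a + b - 1) : ℝ) : ℂ) * f z := fun z hz => by
    simp_rw [hFz]
    rw [hμ, setIntegral_indicator measurableSet_Ioi, hset z ⟨hz.1, hz.2.le⟩, integral_mul_const,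
      integral_complex_ofReal, hkI z hz]
  have hnorm : ∀ z ∈ Ioo 0 t, ∫ s, ‖F (z, s)‖ ∂μ = B * (t - z) ^ (a + b - 1) * ‖f z‖ :=
    fun z hz => by
    have : ∀ s, ‖F (z, s)‖ = (Ioi z).indicator (fun s => ‖k z s‖ * ‖f z‖) s := fun s => by
      rw [hFz, norm_indicator_eq_indicator_norm]
      congr 1; ext s; simp
    simp_rw [this]
    rw [hμ, setIntegral_indicator measurableSet_Ioi, hset z ⟨hz.1, hz.2.le⟩, integral_mul_const,
      ← hkI z hz]
    congr 1
    refine setIntegral_congr_fun measurableSet_Ioc fun s hs => ?_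
    refine Real.norm_of_nonneg (mul_nonneg (Real.rpow_nonneg ?_ _) (Real.rpow_nonneg ?_ _))
    · linarith [hs.2]
    · linarith [hs.1]
  have hFi : Integrable F (μ.prod μ) := by
    rw [integrable_prod_iff hFm]
    constructor
    · filter_upwards [hae] with z hz
      simp_rw [hFz]
      rw [integrable_indicator_iff measurableSet_Ioi, hμ, IntegrableOn,
        Measure.restrict_restrict measurableSet_Ioi, inter_comm, hset z ⟨hz.1, hz.2.le⟩]
      exact ((hki z ⟨hz.1, hz.2.le⟩).ofReal).mul_const _
    · refine Integrable.mono' (hf'.norm.const_mul (|B| * t ^ (a + b - 1)))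
        hFm.norm.integral_prod_right' ?_
      filter_upwards [hae] with z hz
      rw [hnorm z hz, norm_mul, norm_mul, norm_norm, Real.norm_eq_abs]
      gcongr
      rw [Real.norm_of_nonneg (Real.rpow_nonneg (by linarith [hz.2]) _)]
      exact Real.rpow_le_rpow (by linarith [hz.2]) (by linarith [hz.1]) (by linarith)
  have hswap := integral_integral_swap (f := fun z s => F (z, s)) hFi
  have hL : ∫ z, ∫ s, F (z, s) ∂μ ∂μ = (B : ℂ) *
      ∫ s in (0 : ℝ)..t, (((t - s) ^ (a + b - 1) : ℝ) : ℂ) * f s := by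
    rw [intervalIntegral.integral_of_le ht.le, ← integral_const_mul]
    refine integral_congr_ae ?_
    filter_upwards [hae] with z hz
    rw [hin z hz]; push_cast; ring
  have hR : ∫ s, ∫ z, F (z, s) ∂μ ∂μ = ∫ s in (0 : ℝ)..t, (((t - s) ^ (a - 1) : ℝ) : ℂ) *
      ∫ z in (0 : ℝ)..s, (((s - z) ^ (b - 1) : ℝ) : ℂ) * f z := by
    rw [intervalIntegral.integral_of_le ht.le]
    refine setIntegral_congr_fun measurableSet_Ioc fun s hs => ?_
    have : ∀ z, F (z, s) = (Iio s).indicator (fun z => (((t - s) ^ (a - 1) : ℝ) : ℂ) *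
        ((((s - z) ^ (b - 1) : ℝ) : ℂ) * f z)) z := fun z => by
      by_cases h : z < s
      · simp [hF, h, hk, mul_assoc]
      · simp [hF, h]
    simp_rw [this]
    rw [hμ, setIntegral_indicator measurableSet_Iio, intervalIntegral.integral_of_le hs.1.le,
      integral_Ioc_eq_integral_Ioo, ← integral_const_mul]
    congr 2
    ext z; simp only [mem_inter_iff, mem_Ioc, mem_Iio, mem_Ioo]
    constructor
    · rintro ⟨⟨h, _⟩, h'⟩; exact ⟨h, h'⟩
    · rintro ⟨h, h'⟩; exact ⟨⟨h, h'.le.trans hs.2⟩, h'⟩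
  rw [hL, hR] at hswap
  have hGa := Real.Gamma_pos_of_pos ha
  have hGb := Real.Gamma_pos_of_pos hb
  have hGab := Real.Gamma_pos_of_pos (add_pos ha hb)
  unfold fracInt
  have e1 : ∀ s : ℝ, (((t - s) ^ (a - 1) : ℝ) : ℂ) * (((1 / Real.Gamma b : ℝ) : ℂ) *
      ∫ z in (0 : ℝ)..s, (((s - z) ^ (b - 1) : ℝ) : ℂ) * f z) = ((1 / Real.Gamma b : ℝ) : ℂ) *
      ((((t - s) ^ (a - 1) : ℝ) : ℂ) *
      ∫ z in (0 : ℝ)..s, (((s - z) ^ (b - 1) : ℝ) : ℂ) * f z) := fun s => by ring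
  simp_rw [e1]
  rw [intervalIntegral.integral_const_mul, ← hswap, ← mul_assoc, ← mul_assoc]
  congr 1
  rw [hB, ← Complex.ofReal_mul, ← Complex.ofReal_mul]
  congr 1
  field_simp

lemma fracInt_norm_le {a b C t : ℝ} (ha : 0 < a) (hb : 0 < b) (ht : 0 < t)
    {f : ℝ → ℂ} (hf : ∀ s, 0 < s → s ≤ t → ‖f s‖ ≤ C * s ^ (b - 1)) :
    ‖fracInt a f t‖ ≤ C * (Real.Gamma b / Real.Gamma (a + b)) * t ^ (a + b - 1) := by
  have hGa := Real.Gamma_pos_of_pos ha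
  have h1 : ‖∫ s in (0 : ℝ)..t, (((t - s) ^ (a - 1) : ℝ) : ℂ) * f s‖ ≤
      ∫ s in (0 : ℝ)..t, C * ((t - s) ^ (a - 1) * s ^ (b - 1)) := by
    refine intervalIntegral.norm_integral_le_of_norm_le ht.le (Eventually.of_forall fun s hs => ?_)
      ((intervalIntegrable_sub_rpow_mul_rpow ha hb ht).const_mul C)
    have h0 : 0 ≤ (t - s) ^ (a - 1) := Real.rpow_nonneg (by linarith [hs.2]) _
    rw [norm_mul, Complex.norm_real, Real.norm_of_nonneg h0]
    calc _ ≤ (t - s) ^ (a - 1) * (C * s ^ (b - 1)) := by gcongr; exact hf s hs.1 hs.2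
      _ = _ := by ring
  rw [intervalIntegral.integral_const_mul, integral_sub_rpow_mul_rpow ha hb ht] at h1
  rw [fracInt, norm_mul, Complex.norm_real, Real.norm_of_nonneg (by positivity)]
  calc _ ≤ 1 / Real.Gamma a * (C * (Real.Gamma a * Real.Gamma b / Real.Gamma (a + b) *
        t ^ (a + b - 1))) := by gcongr
    _ = _ := by field_simp

lemma fracInt_rpow {a b t : ℝ} (ha : 0 < a) (hb : 0 < b) (ht : 0 < t) :
    fracInt a (fun s => ((s ^ (b - 1) : ℝ) : ℂ)) t =
      ((Real.Gamma b / Real.Gamma (a + b) * t ^ (a + b - 1) : ℝ) : ℂ) := by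
  have hGa := Real.Gamma_pos_of_pos ha
  unfold fracInt
  simp_rw [← Complex.ofReal_mul]
  rw [intervalIntegral.integral_ofReal, integral_sub_rpow_mul_rpow ha hb ht, ← Complex.ofReal_mul]
  congr 1
  field_simp

end FracHeat

namespace FracHeat

/-! ### Caputo derivatives and Volterra equations -/

lemma natCeil_of_lt_one {ν : ℝ} (h0 : 0 < ν) (h1 : ν ≤ 1) : ⌈ν⌉₊ = 1 := by
  rw [Nat.ceil_eq_iff one_ne_zero]; constructor <;> simpa

lemma natCeil_of_one_lt {ν : ℝ} (h0 : 1 < ν) (h1 : ν ≤ 2) : ⌈ν⌉₊ = 2 := by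
  rw [Nat.ceil_eq_iff two_ne_zero]; constructor
  · simpa
  · exact_mod_cast h1

lemma caputo_eq_fracInt {ν : ℝ} (h : ν ≠ (⌈ν⌉₊ : ℝ)) (g : ℝ → ℂ) (t : ℝ) :
    caputo ν g t = fracInt (⌈ν⌉₊ - ν) (iteratedDeriv ⌈ν⌉₊ g) t := by
  rw [caputo, if_neg h, fracInt]
  simp_rw [show -(1 + ν - (⌈ν⌉₊ : ℝ)) = ⌈ν⌉₊ - ν - 1 by ring]

lemma hasDerivAt_of_contDiffOn {m : ℕ} (hm : 1 ≤ m) {g : ℝ → ℂ} (hg : ContDiffOn ℝ m g (Ioi 0))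
    {t : ℝ} (ht : 0 < t) : HasDerivAt g (deriv g t) t :=
  ((hg.differentiableOn (by exact_mod_cast (by omega))).differentiableAt
    (Ioi_mem_nhds ht)).hasDerivAt

lemma contDiffOn_deriv {m : ℕ} {g : ℝ → ℂ} (hg : ContDiffOn ℝ (m + 1 : ℕ) g (Ioi 0)) :
    ContDiffOn ℝ m (deriv g) (Ioi 0) :=
  ((contDiffOn_succ_iff_deriv_of_isOpen (n := m) isOpen_Ioi).1 (by exact_mod_cast hg)).2.2

lemma continuousOn_iteratedDeriv {m : ℕ} {g : ℝ → ℂ} (hg : ContDiffOn ℝ m g (Ioi 0)) :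
    ContinuousOn (iteratedDeriv m g) (Ioi 0) := by
  induction m generalizing g with
  | zero => simpa using hg.continuousOn
  | succ m ih => rw [iteratedDeriv_succ']; exact ih (contDiffOn_deriv hg)

/-- The Caputo weight has a negative exponent, so on (0,t) it is bounded below by a positive
constant and can be dropped from the integrability hypothesis. -/
lemma intervalIntegrable_iteratedDeriv {ν : ℝ} (h0 : 0 < ν) {g : ℝ → ℂ}
    (hν : ν ≠ (⌈ν⌉₊ : ℝ)) (hg : CaputoRegular ν g) {t : ℝ} (ht : 0 < t) :
    IntervalIntegrable (iteratedDeriv ⌈ν⌉₊ g) volume 0 t := by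
  have h := hg.2 hν t ht
  have hlt : (⌈ν⌉₊ : ℝ) < ν + 1 := Nat.ceil_lt_add_one h0.le
  rw [intervalIntegrable_iff_integrableOn_Ioc_of_le ht.le] at h ⊢
  refine Integrable.mono' (h.norm.const_mul (t ^ (1 + ν - ⌈ν⌉₊)))
    (((continuousOn_iteratedDeriv hg.1).mono Ioc_subset_Ioi_self).aestronglyMeasurable
      measurableSet_Ioc) ?_
  rw [← restrict_Ioo_eq_restrict_Ioc]
  refine (ae_restrict_iff' measurableSet_Ioo).2 (Eventually.of_forall fun s hs => ?_)
  have hs0 : 0 < t - s := by linarith [hs.2]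
  rw [norm_mul, Complex.norm_real, Real.norm_of_nonneg (by positivity), ← mul_assoc]
  refine le_mul_of_one_le_left (norm_nonneg _) ?_
  rw [Real.rpow_neg hs0.le, ← div_eq_mul_inv, one_le_div (by positivity)]
  exact Real.rpow_le_rpow hs0.le (by linarith [hs.1]) (by linarith)

lemma tendsto_nhdsLT_of_contDiffOn {g : ℝ → ℂ} (hg : ContinuousOn g (Ioi 0)) {t : ℝ} (ht : 0 < t) :
    Tendsto g (𝓝[<] t) (𝓝 (g t)) :=
  (hg.continuousAt (Ioi_mem_nhds ht)).mono_left nhdsWithin_le_nhds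

/-- Fractional integration of the Caputo derivative. -/
lemma eq_add_fracInt_of_caputo {ν : ℝ} (h0 : 0 < ν) (h2 : ν < 2) {g h : ℝ → ℂ} {c : ℂ}
    (hg : CaputoRegular ν g) (hc : Tendsto g (𝓝[>] 0) (𝓝 c))
    (hd : 1 < ν → Tendsto (deriv g) (𝓝[>] 0) (𝓝 0))
    (heq : ∀ t, 0 < t → caputo ν g t = h t)
    (hh : ∀ t, 0 < t → IntervalIntegrable h volume 0 t) {t : ℝ} (ht : 0 < t) :
    g t = c + fracInt ν h t := by
  by_cases hν : ν = (⌈ν⌉₊ : ℝ)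
  · have hν1 : ν ≤ 1 := by
      by_contra! h
      rw [natCeil_of_one_lt h h2.le] at hν
      norm_num at hν; linarith
    have hceil := natCeil_of_lt_one h0 hν1
    rw [hceil, Nat.cast_one] at hν
    have hreg := hg.1
    rw [hceil] at hreg
    rw [hν, fracInt_one]
    have hder : ∀ s, 0 < s → HasDerivAt g (h s) s := fun s hs => by
      have := heq s hs
      rw [caputo, if_pos (by rw [hceil, hν]; simp), hceil, iteratedDeriv_one] at this
      rw [← this]
      exact hasDerivAt_of_contDiffOn le_rfl hreg hs
    rw [intervalIntegral.integral_eq_sub_of_hasDerivAt_of_tendsto ht (fun s hs => hder s hs.1)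
      (hh t ht) hc (tendsto_nhdsLT_of_contDiffOn hreg.continuousOn ht)]
    ring
  · have hle : ν ≤ ⌈ν⌉₊ := Nat.le_ceil ν
    have hlt : ν < ⌈ν⌉₊ := lt_of_le_of_ne hle hν
    have hG : ∀ t, 0 < t → IntervalIntegrable (iteratedDeriv ⌈ν⌉₊ g) volume 0 t := fun t ht =>
      intervalIntegrable_iteratedDeriv h0 hν hg ht
    -- With m = ⌈ν⌉, J^ν J^(m-ν) = J^m, so it remains to integrate the m-th derivative m times.
    have e1 : fracInt ν h t = fracInt (⌈ν⌉₊ : ℝ) (iteratedDeriv ⌈ν⌉₊ g) t := by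
      rw [fracInt_congr ht (g := fracInt (⌈ν⌉₊ - ν) (iteratedDeriv ⌈ν⌉₊ g)) fun s hs => by
        rw [← heq s hs, caputo_eq_fracInt hν],
        fracInt_fracInt h0 (by linarith) (by
          have : 1 ≤ ⌈ν⌉₊ := Nat.one_le_ceil_iff.2 h0
          have : (1 : ℝ) ≤ ⌈ν⌉₊ := by exact_mod_cast this
          linarith) ht (hG t ht), add_sub_cancel]
    rw [e1]
    rcases le_or_gt ν 1 with hν1 | hν1
    · have hceil := natCeil_of_lt_one h0 hν1
      have hreg := hg.1
      rw [hceil] at hreg hG ⊢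
      rw [Nat.cast_one, fracInt_one, iteratedDeriv_one]
      rw [iteratedDeriv_one] at hG
      rw [intervalIntegral.integral_eq_sub_of_hasDerivAt_of_tendsto ht
        (fun s hs => hasDerivAt_of_contDiffOn le_rfl hreg hs.1)
        (hG t ht) hc (tendsto_nhdsLT_of_contDiffOn hreg.continuousOn ht)]
      ring
    · have hceil := natCeil_of_one_lt hν1 h2.le
      have hreg := hg.1
      rw [hceil] at hreg hG ⊢
      have hreg' : ContDiffOn ℝ (1 : ℕ) (deriv g) (Ioi 0) := contDiffOn_deriv hreg
      have e2 : iteratedDeriv 2 g = deriv (deriv g) := by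
        rw [iteratedDeriv_succ', iteratedDeriv_one]
      rw [e2] at hG ⊢
      have e3 : fracInt ((2 : ℕ) : ℝ) (deriv (deriv g)) t =
          ∫ s in (0 : ℝ)..t, ((t : ℂ) - s) * deriv (deriv g) s := by
        rw [fracInt]
        norm_num
      -- The primitive of (t-s) g''(s) found by parts; at s = 0 it tends to c because g' tends to 0,
      -- and at s = t it equals g(t).
      have hder : ∀ s, 0 < s → HasDerivAt (fun s : ℝ => ((t : ℂ) - s) * deriv g s + g s)
          (((t : ℂ) - s) * deriv (deriv g) s) s := fun s hs => by
        have d1 : HasDerivAt (fun s : ℝ => (t : ℂ) - s) (-1) s := by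
          simpa using (Complex.ofRealCLM.hasDerivAt (x := s)).const_sub (t : ℂ)
        refine ((d1.mul (hasDerivAt_of_contDiffOn le_rfl hreg' hs)).add
          (hasDerivAt_of_contDiffOn (by norm_num) hreg hs)).congr_deriv ?_
        ring
      have hlim0 : Tendsto (fun s : ℝ => ((t : ℂ) - s) * deriv g s + g s) (𝓝[>] 0)
          (𝓝 (((t : ℂ) - (0 : ℝ)) * 0 + c)) := by
        refine Tendsto.add (Tendsto.mul ?_ (hd hν1)) hc
        exact (Continuous.tendsto (by fun_prop) (0 : ℝ)).mono_left nhdsWithin_le_nhds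
      have hcont : ContinuousOn (fun s : ℝ => ((t : ℂ) - s) * deriv g s + g s) (Ioi 0) := fun s hs =>
        (hder s hs).continuousAt.continuousWithinAt
      rw [e3, intervalIntegral.integral_eq_sub_of_hasDerivAt_of_tendsto ht (fun s hs => hder s hs.1)
        ((hG t ht).continuousOn_mul (by fun_prop)) hlim0
        (tendsto_nhdsLT_of_contDiffOn hcont ht)]
      simp

lemma hasDerivAt_fracInt_one {y : ℝ → ℂ} (hy : ContinuousOn y (Ioi 0))
    (hyi : ∀ t, 0 < t → IntervalIntegrable y volume 0 t) {t : ℝ} (ht : 0 < t) :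
    HasDerivAt (fracInt 1 y) (y t) t := by
  have : fracInt 1 y = fun t => ∫ s in (0 : ℝ)..t, y s := funext fun t => fracInt_one y t
  rw [this]
  exact intervalIntegral.integral_hasDerivAt_right (hyi t ht)
    (hy.stronglyMeasurableAtFilter isOpen_Ioi t ht) (hy.continuousAt (Ioi_mem_nhds ht))

lemma eq_of_fracInt_one_eq {y h : ℝ → ℂ} (hy : ContinuousOn y (Ioi 0))
    (hyi : ∀ t, 0 < t → IntervalIntegrable y volume 0 t) (hh : ContinuousOn h (Ioi 0))
    (hhi : ∀ t, 0 < t → IntervalIntegrable h volume 0 t)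
    (heq : ∀ t, 0 < t → fracInt 1 y t = fracInt 1 h t) {t : ℝ} (ht : 0 < t) : y t = h t := by
  refine ((hasDerivAt_fracInt_one hy hyi ht).congr_of_eventuallyEq ?_).unique
    (hasDerivAt_fracInt_one hh hhi ht)
  filter_upwards [Ioi_mem_nhds ht] with s hs using (heq s hs).symm

lemma intervalIntegrable_of_norm_le_rpow {f : ℝ → ℂ} (hf : ContinuousOn f (Ioi 0)) {C b : ℝ}
    (hb : 0 < b) (hC : ∀ t, 0 < t → ‖f t‖ ≤ C * t ^ (b - 1)) {t : ℝ} (ht : 0 < t) :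
    IntervalIntegrable f volume 0 t := by
  have h := (intervalIntegral.intervalIntegrable_rpow' (a := 0) (b := t)
    (show -1 < b - 1 by linarith)).const_mul C
  rw [intervalIntegrable_iff_integrableOn_Ioc_of_le ht.le] at h ⊢
  refine Integrable.mono' h ((hf.mono Ioc_subset_Ioi_self).aestronglyMeasurable
    measurableSet_Ioc) ?_
  exact (ae_restrict_iff' measurableSet_Ioc).2 (Eventually.of_forall fun s hs => hC s hs.1)

lemma intervalIntegrable_sub_rpow_mul {f : ℝ → ℂ} (hf : ContinuousOn f (Ioi 0)) {C a b : ℝ}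
    (ha : 0 < a) (hb : 0 < b) {t : ℝ} (ht : 0 < t)
    (hC : ∀ s, 0 < s → s ≤ t → ‖f s‖ ≤ C * s ^ (b - 1)) :
    IntervalIntegrable (fun s => (((t - s) ^ (a - 1) : ℝ) : ℂ) * f s) volume 0 t := by
  have h := (intervalIntegrable_sub_rpow_mul_rpow ha hb ht).const_mul C
  rw [intervalIntegrable_iff_integrableOn_Ioc_of_le ht.le] at h ⊢
  refine Integrable.mono' h (AEStronglyMeasurable.mul ?_
    ((hf.mono Ioc_subset_Ioi_self).aestronglyMeasurable measurableSet_Ioc)) ?_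
  · exact (Complex.measurable_ofReal.comp
      ((measurable_const.sub measurable_id).pow_const _)).aestronglyMeasurable
  · refine (ae_restrict_iff' measurableSet_Ioc).2 (Eventually.of_forall fun s hs => ?_)
    have h0 : 0 ≤ (t - s) ^ (a - 1) := Real.rpow_nonneg (by linarith [hs.2]) _
    rw [norm_mul, Complex.norm_real, Real.norm_of_nonneg h0]
    calc _ ≤ (t - s) ^ (a - 1) * (C * s ^ (b - 1)) := by gcongr; exact hC s hs.1 hs.2
      _ = _ := by ring

/-- The substitution s ↦ ts fixes the interval and moves t into the argument of f, after which
dominated convergence applies. -/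
lemma continuousOn_fracInt {f : ℝ → ℂ} (hf : ContinuousOn f (Ioi 0)) {C a b : ℝ}
    (ha : 0 < a) (hb : 0 < b) (hC : ∀ t, 0 < t → ‖f t‖ ≤ C * t ^ (b - 1)) :
    ContinuousOn (fracInt a f) (Ioi 0) := by
  have hscale : ∀ t, 0 < t → fracInt a f t = (1 / Real.Gamma a : ℝ) * (((t ^ a : ℝ) : ℂ) *
      ∫ s in Ioc (0 : ℝ) 1, (((1 - s) ^ (a - 1) : ℝ) : ℂ) * f (t * s)) := fun t ht => by
    rw [fracInt, ← intervalIntegral.integral_of_le zero_le_one]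
    congr 1
    have := intervalIntegral.smul_integral_comp_mul_left (a := 0) (b := 1)
      (fun s => (((t - s) ^ (a - 1) : ℝ) : ℂ) * f s) t
    rw [mul_zero, mul_one] at this
    rw [← this, ← intervalIntegral.integral_const_mul, ← intervalIntegral.integral_smul]
    refine intervalIntegral.integral_congr fun s hs => ?_
    rw [uIcc_of_le zero_le_one] at hs
    have h1 : (t - t * s) ^ (a - 1) = t ^ (a - 1) * (1 - s) ^ (a - 1) := by
      rw [← Real.mul_rpow ht.le (by linarith [hs.2])]; congr 1; ring
    have h2 : t ^ a = t * t ^ (a - 1) := by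
      rw [Real.rpow_sub ht, Real.rpow_one]; field_simp
    simp only [h1, h2, Complex.real_smul]
    push_cast; ring
  refine ContinuousOn.congr ?_ hscale
  refine continuousOn_const.mul (ContinuousOn.mul ?_ ?_)
  · exact Complex.continuous_ofReal.comp_continuousOn fun t ht =>
      (Real.continuousAt_rpow_const _ _ (Or.inl (ne_of_gt ht))).continuousWithinAt
  · have hm : ∀ x ∈ Ioi (0 : ℝ), AEStronglyMeasurable
        (fun s => (((1 - s) ^ (a - 1) : ℝ) : ℂ) * f (x * s)) (volume.restrict (Ioc 0 1)) := by
      intro x hx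
      refine AEStronglyMeasurable.mul (Complex.measurable_ofReal.comp
        ((measurable_const.sub measurable_id).pow_const _)).aestronglyMeasurable ?_
      refine ContinuousOn.aestronglyMeasurable (hf.comp (by fun_prop) fun s hs => ?_)
        measurableSet_Ioc
      exact mul_pos hx hs.1
    intro t ht
    have ht' : (0 : ℝ) < t := ht
    refine ContinuousAt.continuousWithinAt ?_
    have hnb : Icc (t / 2) (2 * t) ∈ 𝓝 t := Icc_mem_nhds (by linarith) (by linarith)
    refine continuousAt_of_dominated (bound := fun s => |C| *
      ((t / 2) ^ (b - 1) + (2 * t) ^ (b - 1)) * ((1 - s) ^ (a - 1) * s ^ (b - 1))) ?_ ?_ ?_ ?_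
    · filter_upwards [Ioi_mem_nhds ht'] with x hx using hm x hx
    · filter_upwards [hnb] with x hx
      refine (ae_restrict_iff' measurableSet_Ioc).2 (Eventually.of_forall fun s hs => ?_)
      have hx0 : 0 < x := by linarith [hx.1]
      have h0 : 0 ≤ (1 - s) ^ (a - 1) := Real.rpow_nonneg (by linarith [hs.2]) _
      have h1 : 0 ≤ s ^ (b - 1) := Real.rpow_nonneg hs.1.le _
      have hxb : x ^ (b - 1) ≤ (t / 2) ^ (b - 1) + (2 * t) ^ (b - 1) := by
        rcases le_total 0 (b - 1) with hb1 | hb1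
        · have := Real.rpow_le_rpow hx0.le hx.2 hb1
          have : 0 ≤ (t / 2) ^ (b - 1) := by positivity
          linarith
        · have := Real.rpow_le_rpow_of_nonpos (by positivity) hx.1 hb1
          have : 0 ≤ (2 * t) ^ (b - 1) := by positivity
          linarith
      rw [norm_mul, Complex.norm_real, Real.norm_of_nonneg h0]
      calc _ ≤ (1 - s) ^ (a - 1) * (C * (x * s) ^ (b - 1)) := by
            gcongr; exact hC _ (mul_pos hx0 hs.1)
        _ ≤ (1 - s) ^ (a - 1) * (|C| * (x * s) ^ (b - 1)) := by
            gcongr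
            · exact Real.rpow_nonneg (mul_nonneg hx0.le hs.1.le) _
            · exact le_abs_self C
        _ = |C| * x ^ (b - 1) * ((1 - s) ^ (a - 1) * s ^ (b - 1)) := by
            rw [Real.mul_rpow hx0.le hs.1.le]; ring
        _ ≤ _ := by gcongr
    · exact ((intervalIntegrable_iff_integrableOn_Ioc_of_le zero_le_one).1
        (intervalIntegrable_sub_rpow_mul_rpow ha hb one_pos)).const_mul _
    · refine (ae_restrict_iff' measurableSet_Ioc).2 (Eventually.of_forall fun s hs => ?_)
      refine continuousAt_const.mul (ContinuousAt.comp (f := fun x => x * s)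
        (hf.continuousAt (Ioi_mem_nhds (mul_pos ht' hs.1))) (by fun_prop))

/-- A solution of the Volterra equation with a regular enough top derivative solves the Caputo
equation. -/
lemma caputo_eq_of_eq_add_fracInt {ν : ℝ} (h0 : 0 < ν) (h2 : ν < 2) {g h : ℝ → ℂ} {c : ℂ}
    {C D : ℝ} (hg : ContDiffOn ℝ ⌈ν⌉₊ g (Ioi 0))
    (hgb : ∀ t, 0 < t → ‖iteratedDeriv ⌈ν⌉₊ g t‖ ≤ C * t ^ (ν - ⌈ν⌉₊))
    (hc : Tendsto g (𝓝[>] 0) (𝓝 c))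
    (hd : 1 < ν → Tendsto (deriv g) (𝓝[>] 0) (𝓝 0))
    (hh : ContinuousOn h (Ioi 0)) (hhb : ∀ t, 0 < t → ‖h t‖ ≤ D)
    (heq : ∀ t, 0 < t → g t = c + fracInt ν h t) :
    CaputoRegular ν g ∧ ∀ t, 0 < t → caputo ν g t = h t := by
  have hhi : ∀ t, 0 < t → IntervalIntegrable h volume 0 t := fun t ht =>
    intervalIntegrable_of_norm_le_rpow hh one_pos (C := D) (by simpa using hhb) ht
  have hceil1 : 1 ≤ ⌈ν⌉₊ := Nat.one_le_ceil_iff.2 h0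
  have hceil1' : (1 : ℝ) ≤ ⌈ν⌉₊ := by exact_mod_cast hceil1
  by_cases hν : ν = (⌈ν⌉₊ : ℝ)
  · refine ⟨⟨hg, fun h => absurd hν h⟩, fun t ht => ?_⟩
    have hν1 : ν ≤ 1 := by
      by_contra! h
      rw [natCeil_of_one_lt h h2.le] at hν
      norm_num at hν; linarith
    have hceil := natCeil_of_lt_one h0 hν1
    have hν' : ν = 1 := by rw [hceil] at hν; simpa using hν
    rw [caputo, if_pos hν, hceil, iteratedDeriv_one]
    refine HasDerivAt.deriv ?_
    refine ((hasDerivAt_fracInt_one hh hhi ht).const_add c).congr_of_eventuallyEq ?_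
    filter_upwards [Ioi_mem_nhds ht] with s hs
    rw [heq s hs, hν']
  · have hlt : ν < ⌈ν⌉₊ := lt_of_le_of_ne (Nat.le_ceil ν) hν
    have hlt2 : (⌈ν⌉₊ : ℝ) < ν + 1 := Nat.ceil_lt_add_one h0.le
    set δ : ℝ := ⌈ν⌉₊ - ν with hδ
    have hδ0 : 0 < δ := by linarith
    have hδ1 : 0 < 1 - δ := by linarith
    set G := iteratedDeriv ⌈ν⌉₊ g with hG
    have hGc : ContinuousOn G (Ioi 0) := continuousOn_iteratedDeriv hg
    have hGb : ∀ t, 0 < t → ‖G t‖ ≤ C * t ^ (1 - δ - 1) := fun t ht => by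
      refine (hgb t ht).trans_eq ?_
      congr 2; rw [hδ]; ring
    have hreg : CaputoRegular ν g := by
      refine ⟨hg, fun _ t ht => ?_⟩
      have := intervalIntegrable_sub_rpow_mul hGc hδ0 hδ1 ht fun s hs _ => hGb s hs
      simpa only [show -(1 + ν - (⌈ν⌉₊ : ℝ)) = δ - 1 by rw [hδ]; ring] using this
    set y := fracInt δ G with hy
    have hyc : ContinuousOn y (Ioi 0) := continuousOn_fracInt hGc hδ0 hδ1 hGb
    have hyi : ∀ t, 0 < t → IntervalIntegrable y volume 0 t := fun t ht =>
      intervalIntegrable_of_norm_le_rpow hyc one_pos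
        (C := C * (Real.Gamma (1 - δ) / Real.Gamma (δ + (1 - δ)))) (fun t ht => by
          have := fracInt_norm_le hδ0 hδ1 ht (f := G) (C := C) (fun s hs _ => hGb s hs)
          simpa using this) ht
    have hcap : ∀ t, 0 < t → caputo ν g t = y t := fun t _ => caputo_eq_fracInt hν g t
    refine ⟨hreg, fun t ht => ?_⟩
    rw [hcap t ht]
    -- Both y, the Caputo derivative, and h have the same J^ν. Applying J^δ raises this to equality
    -- of J^m for the integer m = ⌈ν⌉, and m differentiations recover y = h.
    have e1 : ∀ t, 0 < t → fracInt ν y t = fracInt ν h t := fun t ht => by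
      have := eq_add_fracInt_of_caputo h0 h2 hreg hc hd hcap hyi ht
      rw [heq t ht] at this
      exact (add_left_cancel this).symm
    have e2 : ∀ t, 0 < t → fracInt (⌈ν⌉₊ : ℝ) y t = fracInt (⌈ν⌉₊ : ℝ) h t := fun t ht => by
      have hs : δ + ν = ⌈ν⌉₊ := by rw [hδ]; ring
      rw [← hs, ← fracInt_fracInt hδ0 h0 (by linarith) ht (hyi t ht),
        ← fracInt_fracInt hδ0 h0 (by linarith) ht (hhi t ht)]
      exact fracInt_congr ht e1
    rcases le_or_gt ν 1 with hν1 | hν1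
    · rw [natCeil_of_lt_one h0 hν1, Nat.cast_one] at e2
      exact eq_of_fracInt_one_eq hyc hyi hh hhi e2 ht
    · rw [natCeil_of_one_lt hν1 h2.le] at e2
      have e3 : ∀ t, 0 < t → fracInt 1 (fracInt 1 y) t = fracInt 1 (fracInt 1 h) t := fun t ht => by
        rw [fracInt_fracInt one_pos one_pos (by norm_num) ht (hyi t ht),
          fracInt_fracInt one_pos one_pos (by norm_num) ht (hhi t ht)]
        have := e2 t ht
        norm_num at this ⊢
        exact this
      have hci : ∀ f : ℝ → ℂ, ContinuousOn f (Ioi 0) → (∀ t, 0 < t → IntervalIntegrable f volume 0 t) →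
          ContinuousOn (fracInt 1 f) (Ioi 0) ∧
          ∀ t, 0 < t → IntervalIntegrable (fracInt 1 f) volume 0 t := by
        intro f hf hfi
        refine ⟨fun s hs => (hasDerivAt_fracInt_one hf hfi hs).continuousAt.continuousWithinAt,
          fun t ht => ContinuousOn.intervalIntegrable ?_⟩
        have : fracInt 1 f = fun t => ∫ s in (0 : ℝ)..t, f s := funext fun t => fracInt_one f t
        rw [this]
        refine intervalIntegral.continuousOn_primitive_interval' (hfi t ht) ?_
        exact left_mem_uIcc
      exact eq_of_fracInt_one_eq hyc hyi hh hhi (fun t ht =>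
        eq_of_fracInt_one_eq (hci y hyc hyi).1 (hci y hyc hyi).2 (hci h hh hhi).1 (hci h hh hhi).2
          e3 ht) ht

end FracHeat

namespace FracHeat

/-! ### The Schwartz space: completeness and band-limited functions -/

lemma schwartz_tendsto_iff {ι : Type*} {l : Filter ι} {f : ι → 𝓢(ℝ, ℂ)} {g : 𝓢(ℝ, ℂ)} :
    Tendsto f l (𝓝 g) ↔ ∀ k n : ℕ,
      Tendsto (fun i => SchwartzMap.seminorm ℂ k n (f i - g)) l (𝓝 0) := by
  rw [(schwartz_withSeminorms ℂ ℝ ℂ).tendsto_nhds]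
  constructor
  · intro h k n
    rw [Metric.tendsto_nhds]
    intro ε hε
    filter_upwards [h (k, n) ε hε] with i hi
    rw [Real.dist_eq, sub_zero, abs_of_nonneg (apply_nonneg _ _)]
    exact hi
  · intro h i ε hε
    exact (h i.1 i.2).eventually (gt_mem_nhds hε)

lemma cauchySeq_seminorm {f : ℕ → 𝓢(ℝ, ℂ)} (hf : CauchySeq f) (k n : ℕ) {ε : ℝ} (hε : 0 < ε) :
    ∃ N, ∀ i ≥ N, ∀ j ≥ N, SchwartzMap.seminorm ℂ k n (f i - f j) ≤ ε := by
  have hc : Continuous (SchwartzMap.seminorm ℂ k n : 𝓢(ℝ, ℂ) → ℝ) :=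
    (schwartz_withSeminorms ℂ ℝ ℂ).continuous_seminorm (k, n)
  have hU : {p : 𝓢(ℝ, ℂ) × 𝓢(ℝ, ℂ) | SchwartzMap.seminorm ℂ k n (p.2 - p.1) < ε} ∈
      uniformity 𝓢(ℝ, ℂ) := by
    rw [uniformity_eq_comap_nhds_zero]
    refine ⟨{x | SchwartzMap.seminorm ℂ k n x < ε}, ?_, fun p hp => hp⟩
    exact hc.continuousAt.eventually (gt_mem_nhds (by simpa using hε))
  obtain ⟨N, hN⟩ := cauchySeq_iff.1 hf _ hU
  refine ⟨N, fun i hi j hj => ?_⟩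
  exact le_of_lt (hN j hj i hi)

/-- All derivatives of a Cauchy sequence converge uniformly, so their limits are the derivatives of
one function, and the weighted bounds pass to the limit. Completeness is what the uniform
boundedness principle needs. -/
instance completeSpace_schwartzMap : CompleteSpace 𝓢(ℝ, ℂ) := by
  have : (uniformity 𝓢(ℝ, ℂ)).IsCountablyGenerated :=
    IsUniformAddGroup.uniformity_countably_generated
  refine UniformSpace.complete_of_cauchySeq_tendsto fun f hf => ?_
  have hdiff : ∀ (l i j : ℕ) (x : ℝ), iteratedDeriv l (f i - f j : 𝓢(ℝ, ℂ)) x =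
      iteratedDeriv l (f i) x - iteratedDeriv l (f j) x := fun l i j x => by
    have : ((f i - f j : 𝓢(ℝ, ℂ)) : ℝ → ℂ) = (f i : ℝ → ℂ) - (f j : ℝ → ℂ) := by ext; simp
    rw [this, iteratedDeriv_sub ((f i).smooth l).contDiffAt ((f j).smooth l).contDiffAt]
  have hbound : ∀ (k l : ℕ) {ε : ℝ}, 0 < ε → ∃ N, ∀ i ≥ N, ∀ j ≥ N, ∀ x : ℝ,
      |x| ^ k * ‖iteratedDeriv l (f i) x - iteratedDeriv l (f j) x‖ ≤ ε := by
    intro k l ε hε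
    obtain ⟨N, hN⟩ := cauchySeq_seminorm hf k l hε
    refine ⟨N, fun i hi j hj x => ?_⟩
    rw [← hdiff]
    exact (SchwartzMap.le_seminorm' ℂ k l _ x).trans (hN i hi j hj)
  have hpt : ∀ (l : ℕ) (x : ℝ), ∃ y, Tendsto (fun i => iteratedDeriv l (f i) x) atTop (𝓝 y) := by
    intro l x
    refine cauchySeq_tendsto_of_complete (Metric.cauchySeq_iff.2 fun ε hε => ?_)
    obtain ⟨N, hN⟩ := hbound 0 l (half_pos hε)
    refine ⟨N, fun i hi j hj => ?_⟩
    have := hN i hi j hj x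
    rw [dist_eq_norm]
    simp only [pow_zero, one_mul] at this
    linarith
  choose g hg using hpt
  have hlim : ∀ (k l : ℕ) {ε : ℝ}, 0 < ε → ∃ N, ∀ i ≥ N, ∀ x : ℝ,
      |x| ^ k * ‖iteratedDeriv l (f i) x - g l x‖ ≤ ε := by
    intro k l ε hε
    obtain ⟨N, hN⟩ := hbound k l hε
    refine ⟨N, fun i hi x => ?_⟩
    refine le_of_tendsto (((tendsto_const_nhds.sub (hg l x)).norm).const_mul (|x| ^ k)) ?_
    filter_upwards [eventually_ge_atTop N] with j hj using hN i hi j hj x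
  have hunif : ∀ l, TendstoUniformly (fun i => iteratedDeriv l (f i)) (g l) atTop := by
    intro l
    refine Metric.tendstoUniformly_iff.2 fun ε hε => ?_
    obtain ⟨N, hN⟩ := hlim 0 l (half_pos hε)
    filter_upwards [eventually_ge_atTop N] with i hi x
    have := hN i hi x
    rw [dist_comm, dist_eq_norm]
    simp only [pow_zero, one_mul] at this
    linarith
  have hder : ∀ l x, HasDerivAt (g l) (g (l + 1) x) x := fun l x =>
    hasDerivAt_of_tendstoUniformly (hunif (l + 1)) (Eventually.of_forall fun i x => by
      rw [iteratedDeriv_succ]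
      exact (((f i).smooth ⊤).differentiable_iteratedDeriv l
        (by exact_mod_cast ENat.natCast_lt_top l) x).hasDerivAt) (fun x => hg l x) x
  have hit : ∀ l, iteratedDeriv l (g 0) = g l := by
    intro l
    induction l with
    | zero => simp
    | succ l ih => rw [iteratedDeriv_succ, ih]; ext x; exact (hder l x).deriv
  have hsmooth : ContDiff ℝ ((⊤ : ℕ∞) : WithTop ℕ∞) (g 0) := by
    refine contDiff_of_differentiable_iteratedDeriv fun m _ => ?_
    rw [hit m]
    exact fun x => (hder m x).differentiableAt
  let G : 𝓢(ℝ, ℂ) :=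
    { toFun := g 0
      smooth' := hsmooth
      decay' := by
        intro k l
        obtain ⟨N, hN⟩ := hlim k l one_pos
        refine ⟨1 + SchwartzMap.seminorm ℂ k l (f N), fun x => ?_⟩
        rw [norm_iteratedFDeriv_eq_norm_iteratedDeriv, hit, Real.norm_eq_abs]
        have h1 := hN N le_rfl x
        have h2 := SchwartzMap.le_seminorm' ℂ k l (f N) x
        have h3 : ‖g l x‖ ≤ ‖iteratedDeriv l (f N) x - g l x‖ + ‖iteratedDeriv l (f N) x‖ := by
          have := norm_sub_le (iteratedDeriv l (f N) x) (iteratedDeriv l (f N) x - g l x)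
          rw [sub_sub_cancel] at this
          linarith
        have h4 : 0 ≤ |x| ^ k := by positivity
        nlinarith }
  refine ⟨G, schwartz_tendsto_iff.2 fun k l => ?_⟩
  rw [Metric.tendsto_atTop]
  intro ε hε
  obtain ⟨N, hN⟩ := hlim k l (half_pos hε)
  refine ⟨N, fun i hi => ?_⟩
  rw [Real.dist_eq, sub_zero, abs_of_nonneg (apply_nonneg _ _)]
  refine lt_of_le_of_lt (SchwartzMap.seminorm_le_bound' ℂ k l _ (half_pos hε).le fun x => ?_)
    (half_lt_self hε)
  have e1 : ((f i - G : 𝓢(ℝ, ℂ)) : ℝ → ℂ) = (f i : ℝ → ℂ) - (G : ℝ → ℂ) := by ext; simp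
  have e2 : iteratedDeriv l (G : ℝ → ℂ) = g l := hit l
  rw [e1, iteratedDeriv_sub ((f i).smooth l).contDiffAt (G.smooth l).contDiffAt, e2]
  exact hN i hi x

/-- Countably many seminorms make the uniformity (pseudo)metrizable; with completeness the space is
Baire, hence barrelled. -/
instance barrelledSpace_schwartzMap : BarrelledSpace ℂ 𝓢(ℝ, ℂ) := by
  have : (uniformity 𝓢(ℝ, ℂ)).IsCountablyGenerated :=
    IsUniformAddGroup.uniformity_countably_generated
  have : BaireSpace 𝓢(ℝ, ℂ) := by
    let _ := UniformSpace.pseudoMetricSpace 𝓢(ℝ, ℂ)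
    infer_instance
  infer_instance

/-- The uniform boundedness principle for tempered distributions. -/
lemma exists_seminorm_of_pointwise_bounded {ι : Type*} (W : ι → 𝓢(ℝ, ℂ) →L[ℂ] ℂ)
    (h : ∀ φ, ∃ C, ∀ i, ‖W i φ‖ ≤ C) :
    ∃ (s : Finset (ℕ × ℕ)) (C : ℝ), 0 ≤ C ∧ ∀ i φ,
      ‖W i φ‖ ≤ C * (s.sup (schwartzSeminormFamily ℂ ℝ ℂ)) φ := by
  set P : ι → Seminorm ℂ 𝓢(ℝ, ℂ) := fun i => (normSeminorm ℂ ℂ).comp (W i).toLinearMap with hP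
  have hb : BddAbove (range P) := by
    rw [Seminorm.bddAbove_range_iff]
    intro φ
    obtain ⟨C, hC⟩ := h φ
    exact ⟨C, by rintro _ ⟨i, rfl⟩; exact hC i⟩
  have hc : Continuous (⨆ i, P i : Seminorm ℂ 𝓢(ℝ, ℂ)) :=
    by
    have := Seminorm.continuous_iSup P (fun i => (W i).continuous.norm) hb
    rwa [Seminorm.coe_iSup_eq hb]
  obtain ⟨s, C, _, hle⟩ := Seminorm.bound_of_continuous (schwartz_withSeminorms ℂ ℝ ℂ) _ hc
  refine ⟨s, C, C.2, fun i φ => ?_⟩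
  calc ‖W i φ‖ = P i φ := rfl
    _ ≤ (⨆ i, P i : Seminorm ℂ 𝓢(ℝ, ℂ)) φ := by
        rw [Seminorm.iSup_apply hb]
        obtain ⟨D, hD⟩ := h φ
        exact le_ciSup (f := fun i => P i φ) ⟨D, by rintro _ ⟨i, rfl⟩; exact hD i⟩ i
    _ ≤ _ := hle φ

end FracHeat

namespace FracHeat

/-- Powers of a smooth symbol grow at most geometrically in `C^L` on a compact support. -/
lemma exists_norm_iteratedFDeriv_pow_mul_le {a ψ : ℝ → ℂ} (ha : ContDiff ℝ ((⊤ : ℕ∞) : WithTop ℕ∞) a)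
    (hψ : ContDiff ℝ ((⊤ : ℕ∞) : WithTop ℕ∞) ψ) (hc : HasCompactSupport ψ) (L : ℕ) :
    ∃ A B : ℝ, 0 ≤ A ∧ 0 ≤ B ∧ ∀ N l : ℕ, l ≤ L → ∀ x,
      ‖iteratedFDeriv ℝ l (fun x => a x ^ N * ψ x) x‖ ≤ B * A ^ N := by
  have hbd : ∀ f : ℝ → ℂ, ContDiff ℝ ((⊤ : ℕ∞) : WithTop ℕ∞) f → ∃ M : ℝ, 0 ≤ M ∧ ∀ l ≤ L,
      ∀ x ∈ tsupport ψ, ‖iteratedFDeriv ℝ l f x‖ ≤ M := by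
    intro f hf
    have : ∀ l : ℕ, ∃ M : ℝ, ∀ x ∈ tsupport ψ, ‖iteratedFDeriv ℝ l f x‖ ≤ M := fun l =>
      hc.isCompact.exists_bound_of_continuousOn
        (hf.continuous_iteratedFDeriv (by exact_mod_cast le_top)).continuousOn
    choose M hM using this
    refine ⟨∑ l ∈ Finset.range (L + 1), |M l|, by positivity, fun l hl x hx => ?_⟩
    refine (hM l x hx).trans ((le_abs_self _).trans ?_)
    exact Finset.single_le_sum (f := fun l => |M l|) (fun _ _ => abs_nonneg _)
      (Finset.mem_range.2 (by omega))
  obtain ⟨M, hM0, hM⟩ := hbd a ha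
  obtain ⟨B, hB0, hB⟩ := hbd ψ hψ
  -- M bounds the derivatives of a up to order L on the support of ψ, and 2^L bounds the sum of
  -- binomial coefficients in one application of Leibniz' rule.
  refine ⟨2 ^ L * M, B, by positivity, hB0, fun N => ?_⟩
  have hsm : ∀ N : ℕ, ContDiff ℝ ((⊤ : ℕ∞) : WithTop ℕ∞) (fun x => a x ^ N * ψ x) := fun N =>
    (ha.pow N).mul hψ
  have hsupp : ∀ (N l : ℕ), ∀ x ∉ tsupport ψ,
      iteratedFDeriv ℝ l (fun x => a x ^ N * ψ x) x = 0 := by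
    intro N l x hx
    by_contra hne
    have h1 : x ∈ tsupport (fun x => a x ^ N * ψ x) :=
      support_iteratedFDeriv_subset (𝕜 := ℝ) l hne
    exact hx (closure_mono (Function.support_mul_subset_right _ _) h1)
  suffices h : ∀ l ≤ L, ∀ x ∈ tsupport ψ,
      ‖iteratedFDeriv ℝ l (fun x => a x ^ N * ψ x) x‖ ≤ B * (2 ^ L * M) ^ N by
    intro l hl x
    by_cases hx : x ∈ tsupport ψ
    · exact h l hl x hx
    · rw [hsupp N l x hx, norm_zero]; positivity
  induction N with
  | zero => simpa using hB
  | succ N ih =>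
    intro l hl x hx
    have e : (fun x => a x ^ (N + 1) * ψ x) = fun x => a x * (a x ^ N * ψ x) := by
      ext x; ring
    rw [e]
    refine (norm_iteratedFDeriv_mul_le ha (hsm N) x (n := l)
      (by exact_mod_cast le_top)).trans ?_
    calc ∑ i ∈ Finset.range (l + 1), (l.choose i : ℝ) * ‖iteratedFDeriv ℝ i a x‖ *
          ‖iteratedFDeriv ℝ (l - i) (fun x => a x ^ N * ψ x) x‖
        ≤ ∑ i ∈ Finset.range (l + 1), (l.choose i : ℝ) * (M * (B * (2 ^ L * M) ^ N)) := by
          refine Finset.sum_le_sum fun i hi => ?_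
          have hi' : i ≤ l := by simpa [Nat.lt_succ_iff] using hi
          rw [mul_assoc]
          gcongr
          · exact hM i (hi'.trans hl) x hx
          · exact ih (l - i) ((Nat.sub_le _ _).trans hl) x hx
      _ = 2 ^ l * (M * (B * (2 ^ L * M) ^ N)) := by
          rw [← Finset.sum_mul]
          congr 1
          exact_mod_cast Nat.sum_range_choose l
      _ ≤ 2 ^ L * (M * (B * (2 ^ L * M) ^ N)) := by
          gcongr
          norm_num
      _ = _ := by ring

/-- Finitely many seminorms involve finitely many derivatives, and on the compact support the
polynomial weights are bounded. What matters is that A and B do not depend on N. -/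
lemma exists_sup_seminorm_le {a : ℝ → ℂ} (ha : ContDiff ℝ ((⊤ : ℕ∞) : WithTop ℕ∞) a)
    (ψ : 𝓢(ℝ, ℂ)) (hc : HasCompactSupport ψ) (s : Finset (ℕ × ℕ)) :
    ∃ A B : ℝ, 0 ≤ A ∧ 0 ≤ B ∧ ∀ (N : ℕ) (f : 𝓢(ℝ, ℂ)), (∀ x, f x = a x ^ N * ψ x) →
      (s.sup (schwartzSeminormFamily ℂ ℝ ℂ)) f ≤ B * A ^ N := by
  obtain ⟨R, hR⟩ := hc.isCompact.isBounded.subset_closedBall (0 : ℝ)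
  obtain ⟨A, B, hA, hB, h⟩ := exists_norm_iteratedFDeriv_pow_mul_le ha (ψ.smooth ⊤) hc
    (s.sup Prod.snd)
  refine ⟨A, (1 + |R|) ^ (s.sup Prod.fst) * B, hA, by positivity, fun N f hf => ?_⟩
  have hf' : (f : ℝ → ℂ) = fun x => a x ^ N * ψ x := funext hf
  refine Seminorm.finset_sup_apply_le (by positivity) fun i hi => ?_
  refine SchwartzMap.seminorm_le_bound ℂ i.1 i.2 f (by positivity) fun x => ?_
  rw [hf']
  have hi1 : i.1 ≤ s.sup Prod.fst := Finset.le_sup (f := Prod.fst) hi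
  have hi2 : i.2 ≤ s.sup Prod.snd := Finset.le_sup (f := Prod.snd) hi
  by_cases hx : x ∈ tsupport ψ
  · have hxR : ‖x‖ ≤ 1 + |R| := by
      have := hR hx
      rw [mem_closedBall_zero_iff] at this
      linarith [le_abs_self R]
    calc _ ≤ (1 + |R|) ^ i.1 * (B * A ^ N) := by gcongr; exact h N i.2 hi2 x
      _ ≤ (1 + |R|) ^ (s.sup Prod.fst) * (B * A ^ N) := by
          gcongr
          linarith [abs_nonneg R]
      _ = _ := by ring
  · have : iteratedFDeriv ℝ i.2 (fun x => a x ^ N * ψ x) x = 0 := by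
      by_contra hne
      have h1 : x ∈ tsupport (fun x => a x ^ N * ψ x) :=
        support_iteratedFDeriv_subset (𝕜 := ℝ) i.2 hne
      exact hx (closure_mono (Function.support_mul_subset_right _ _) h1)
    rw [this, norm_zero, mul_zero]
    positivity

/-- Compactly supported functions are dense in the Schwartz space. -/
lemma exists_compactSupport_tendsto (ψ : 𝓢(ℝ, ℂ)) :
    ∃ f : ℕ → 𝓢(ℝ, ℂ), (∀ i, HasCompactSupport (f i)) ∧ Tendsto f atTop (𝓝 ψ) := by
  let χ : ContDiffBump (0 : ℝ) := ⟨1, 2, one_pos, one_lt_two⟩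
  set X : ℕ → ℝ → ℂ := fun i x => ((χ ((i + 1 : ℝ)⁻¹ * x) : ℝ) : ℂ) with hX
  have hχs : ContDiff ℝ ((⊤ : ℕ∞) : WithTop ℕ∞) (fun x : ℝ => ((χ x : ℝ) : ℂ)) :=
    Complex.ofRealCLM.contDiff.comp χ.contDiff
  have hXs : ∀ i, ContDiff ℝ ((⊤ : ℕ∞) : WithTop ℕ∞) (X i) := fun i =>
    hχs.comp (contDiff_const.mul contDiff_id)
  have hXc : ∀ i, HasCompactSupport (X i) := by
    intro i
    have h1 : HasCompactSupport (fun x : ℝ => ((χ x : ℝ) : ℂ)) :=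
      χ.hasCompactSupport.comp_left (g := fun y : ℝ => (y : ℂ)) (by simp)
    have := h1.comp_smul (c := ((i + 1 : ℝ)⁻¹)) (by positivity)
    simpa [smul_eq_mul] using this
  have hcs : ∀ i, HasCompactSupport fun x => X i x * ψ x := fun i => (hXc i).mul_right
  set f : ℕ → 𝓢(ℝ, ℂ) := fun i => (hcs i).toSchwartzMap ((hXs i).mul (ψ.smooth ⊤)) with hf
  have hfx : ∀ i x, f i x = X i x * ψ x := fun i x => rfl
  refine ⟨f, fun i => hcs i, schwartz_tendsto_iff.2 fun k l => ?_⟩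
  have hY : ∀ i x, (f i - ψ) x = (X i x - 1) * ψ x := fun i x => by
    rw [sub_apply, hfx]; ring
  have hbχ : ∀ j : ℕ, ∃ M : ℝ, 0 ≤ M ∧ ∀ (i : ℕ) x, ‖iteratedDeriv j (fun x => X i x - 1) x‖ ≤ M := by
    intro j
    have hb : ∃ M, ∀ x, ‖iteratedDeriv j (fun x : ℝ => ((χ x : ℝ) : ℂ) - 1) x‖ ≤ M := by
      rcases Nat.eq_zero_or_pos j with rfl | hj
      · refine ⟨2, fun x => ?_⟩
        rw [iteratedDeriv_zero]
        refine (norm_sub_le _ _).trans ?_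
        rw [Complex.norm_real, Real.norm_of_nonneg χ.nonneg, norm_one]
        linarith [χ.le_one (x := x)]
      · have hcomp : HasCompactSupport (iteratedDeriv j (fun x : ℝ => ((χ x : ℝ) : ℂ) - 1)) := by
          have h1 : HasCompactSupport (fun x : ℝ => ((χ x : ℝ) : ℂ)) :=
            χ.hasCompactSupport.comp_left (g := fun y : ℝ => (y : ℂ)) (by simp)
          obtain ⟨m, rfl⟩ : ∃ m, j = m + 1 := ⟨j - 1, by omega⟩
          have e : iteratedDeriv (m + 1) (fun x : ℝ => ((χ x : ℝ) : ℂ) - 1) =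
              iteratedDeriv (m + 1) (fun x : ℝ => ((χ x : ℝ) : ℂ)) := by
            rw [iteratedDeriv_succ', iteratedDeriv_succ']
            congr 1; ext x; simp
          rw [e]
          refine HasCompactSupport.intro h1.isCompact fun x hx => ?_
          have h3 : iteratedFDeriv ℝ (m + 1) (fun x : ℝ => ((χ x : ℝ) : ℂ)) x = 0 := by
            by_contra hne
            exact hx (support_iteratedFDeriv_subset (𝕜 := ℝ) (m + 1) hne)
          rw [iteratedDeriv_eq_iteratedFDeriv, h3]; simp
        exact hcomp.exists_bound_of_continuous ((hχs.sub contDiff_const).continuous_iteratedDeriv j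
          (by exact_mod_cast le_top))
    obtain ⟨M, hM⟩ := hb
    refine ⟨M, (norm_nonneg _).trans (hM 0), fun i x => ?_⟩
    have e := congrFun (iteratedDeriv_comp_const_smul (n := j)
      (f := fun x : ℝ => ((χ x : ℝ) : ℂ) - 1) ((hχs.sub contDiff_const).of_le
        (by exact_mod_cast le_top)) ((i + 1 : ℝ)⁻¹)) x
    simp only [hX]
    rw [e, norm_smul]
    refine (mul_le_of_le_one_left (norm_nonneg _) ?_).trans (hM _)
    rw [norm_pow, norm_inv]
    refine pow_le_one₀ (by positivity) (inv_le_one_of_one_le₀ ?_)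
    rw [Real.norm_of_nonneg (by positivity)]
    linarith [(Nat.cast_nonneg i : (0 : ℝ) ≤ i)]
  choose M hM0 hM using hbχ
  set D : ℝ := ∑ j ∈ Finset.range (l + 1), (l.choose j : ℝ) * M j *
    SchwartzMap.seminorm ℂ (k + 1) (l - j) ψ with hD
  have hD0 : 0 ≤ D := Finset.sum_nonneg fun j _ =>
    mul_nonneg (mul_nonneg (by positivity) (hM0 j)) (apply_nonneg _ _)
  -- The cutoff error vanishes for |x| < i + 1; outside, one extra power of |x| is bought from a
  -- higher seminorm and yields the factor 1/(i+1).
  have hmain : ∀ i : ℕ, SchwartzMap.seminorm ℂ k l (f i - ψ) ≤ D * (1 / ((i : ℝ) + 1)) := by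
    intro i
    refine SchwartzMap.seminorm_le_bound ℂ k l _ (by positivity) fun x => ?_
    have hfun : ((f i - ψ : 𝓢(ℝ, ℂ)) : ℝ → ℂ) = fun x => (X i x - 1) * ψ x := funext (hY i)
    rw [hfun]
    have hi0 : (0 : ℝ) < i + 1 := by positivity
    by_cases hx : |x| < i + 1
    · have : (fun x => (X i x - 1) * ψ x) =ᶠ[𝓝 x] fun _ => 0 := by
        filter_upwards [(isOpen_lt continuous_abs continuous_const).mem_nhds hx] with y hy
        have : χ ((i + 1 : ℝ)⁻¹ * y) = 1 := χ.one_of_mem_closedBall (by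
          rw [mem_closedBall_zero_iff, norm_mul, norm_inv, Real.norm_of_nonneg hi0.le,
            Real.norm_eq_abs, inv_mul_le_one₀ hi0]
          exact le_of_lt hy)
        simp [hX, this]
      rw [(Filter.EventuallyEq.iteratedFDeriv ℝ this l).eq_of_nhds]
      simp only [iteratedFDeriv_fun_zero, Pi.zero_apply, norm_zero, mul_zero]
      positivity
    · push Not at hx
      have h1 := norm_iteratedFDeriv_mul_le ((hXs i).sub contDiff_const) (ψ.smooth ⊤) x (n := l)
        (by exact_mod_cast le_top) (𝕜 := ℝ) (f := fun x => X i x - 1)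
      have h2 : ‖x‖ ^ k ≤ ‖x‖ ^ (k + 1) * (1 / ((i : ℝ) + 1)) := by
        rw [pow_succ, mul_assoc]
        refine le_mul_of_one_le_right (by positivity) ?_
        rw [mul_one_div, one_le_div hi0]
        exact hx
      calc _ ≤ ‖x‖ ^ (k + 1) * (1 / ((i : ℝ) + 1)) * (∑ j ∈ Finset.range (l + 1),
            (l.choose j : ℝ) * ‖iteratedFDeriv ℝ j (fun x => X i x - 1) x‖ *
              ‖iteratedFDeriv ℝ (l - j) ψ x‖) := by gcongr
        _ = (∑ j ∈ Finset.range (l + 1),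
            (l.choose j : ℝ) * ‖iteratedFDeriv ℝ j (fun x => X i x - 1) x‖ *
              (‖x‖ ^ (k + 1) * ‖iteratedFDeriv ℝ (l - j) ψ x‖)) * (1 / ((i : ℝ) + 1)) := by
            rw [mul_right_comm, Finset.mul_sum]
            congr 1
            refine Finset.sum_congr rfl fun j _ => ?_
            ring
        _ ≤ _ := by
            rw [hD]
            gcongr with j hj
            · exact mul_nonneg (by positivity) (hM0 j)
            · rw [norm_iteratedFDeriv_eq_norm_iteratedDeriv]; exact hM j i x
            · exact SchwartzMap.le_seminorm ℂ (k + 1) (l - j) ψ x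
  refine squeeze_zero (fun i => apply_nonneg _ _) hmain ?_
  simpa using tendsto_one_div_add_atTop_nhds_zero_nat.const_mul D

end FracHeat

namespace FracHeat

/-! ### Uniqueness of the fundamental solution -/

/-- The formal adjoint of `∂_x^n` on test functions. -/
noncomputable def adjDeriv (n : ℕ) : 𝓢(ℝ, ℂ) → 𝓢(ℝ, ℂ) :=
  (fun φ => -SchwartzMap.derivCLM ℂ ℂ φ)^[n]

/-- The Fourier symbol of `adjDeriv n`. -/
noncomputable def derivSymbol (n : ℕ) (ξ : ℝ) : ℂ := (-(2 * Real.pi * Complex.I * ξ)) ^ n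

lemma iterate_derivCLM_apply (n : ℕ) (T : 𝓢'(ℝ, ℂ)) (φ : 𝓢(ℝ, ℂ)) :
    ((TemperedDistribution.derivCLM ℂ)^[n] T) φ = T (adjDeriv n φ) := by
  unfold adjDeriv
  induction n generalizing T φ with
  | zero => rfl
  | succ n ih =>
    rw [Function.iterate_succ_apply, ih, Function.iterate_succ_apply',
      TemperedDistribution.derivCLM_apply_apply]

lemma fourier_adjDeriv (n : ℕ) (φ : 𝓢(ℝ, ℂ)) (ξ : ℝ) :
    (𝓕 (adjDeriv n φ) : 𝓢(ℝ, ℂ)) ξ = derivSymbol n ξ * (𝓕 φ : 𝓢(ℝ, ℂ)) ξ := by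
  unfold adjDeriv derivSymbol
  induction n with
  | zero => simp
  | succ n ih =>
    rw [Function.iterate_succ_apply']
    set ψ : 𝓢(ℝ, ℂ) := (fun φ => -SchwartzMap.derivCLM ℂ ℂ φ)^[n] φ
    have h2 : (𝓕 (SchwartzMap.derivCLM ℂ ℂ ψ) : 𝓢(ℝ, ℂ)) ξ =
        (2 * Real.pi * Complex.I * ξ) * (𝓕 ψ : 𝓢(ℝ, ℂ)) ξ := by
      rw [SchwartzMap.fourier_coe, SchwartzMap.fourier_coe]
      have h3 : (SchwartzMap.derivCLM ℂ ℂ ψ : ℝ → ℂ) = deriv ψ := by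
        ext x; exact SchwartzMap.derivCLM_apply ℂ ψ x
      rw [h3, Real.fourier_deriv ψ.integrable ψ.differentiable
        (by rw [← h3]; exact (SchwartzMap.derivCLM ℂ ℂ ψ).integrable)]
      rfl
    have h4 : (𝓕 (-(SchwartzMap.derivCLM ℂ ℂ ψ)) : 𝓢(ℝ, ℂ)) =
        -(𝓕 (SchwartzMap.derivCLM ℂ ℂ ψ) : 𝓢(ℝ, ℂ)) := by
      rw [← neg_one_smul ℂ, FourierTransform.fourier_smul, neg_one_smul]
    rw [h4, neg_apply, h2, ih, pow_succ]
    ring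

lemma fourier_iterate_adjDeriv (n N : ℕ) (φ : 𝓢(ℝ, ℂ)) (ξ : ℝ) :
    (𝓕 ((adjDeriv n)^[N] φ) : 𝓢(ℝ, ℂ)) ξ = derivSymbol n ξ ^ N * (𝓕 φ : 𝓢(ℝ, ℂ)) ξ := by
  induction N with
  | zero => simp
  | succ N ih => rw [Function.iterate_succ_apply', fourier_adjDeriv, ih, pow_succ]; ring

lemma contDiff_derivSymbol (n : ℕ) : ContDiff ℝ ((⊤ : ℕ∞) : WithTop ℕ∞) (derivSymbol n) := by
  unfold derivSymbol
  exact ((contDiff_const.mul Complex.ofRealCLM.contDiff).neg).pow n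

lemma exists_bound_of_tendsto {f : ℝ → ℂ} (hf : ContinuousOn f (Ioi 0)) {c : ℂ}
    (hc : Tendsto f (𝓝[>] 0) (𝓝 c)) (T : ℝ) : ∃ C : ℝ, ∀ t, 0 < t → t ≤ T → ‖f t‖ ≤ C := by
  have h1 : ∀ᶠ t in 𝓝[>] (0 : ℝ), ‖f t‖ < ‖c‖ + 1 :=
    hc.norm.eventually (gt_mem_nhds (by linarith))
  obtain ⟨δ, hδ, h2⟩ := mem_nhdsGT_iff_exists_Ioo_subset.1 h1
  obtain ⟨M, hM⟩ := (isCompact_Icc (a := δ) (b := T)).exists_bound_of_continuousOn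
    (hf.mono fun t ht => lt_of_lt_of_le hδ ht.1)
  refine ⟨max (‖c‖ + 1) M, fun t ht htT => ?_⟩
  rcases lt_or_ge t δ with h | h
  · exact le_max_of_le_left (le_of_lt (h2 ⟨ht, h⟩))
  · exact le_max_of_le_right (hM t ⟨h, htT⟩)

/-- These are the even-indexed terms, at √x, of a convergent exponential moment series of the
M-Wright function of parameter ν/2. Halving brings ν < 2 into the range (0,1). -/
lemma tendsto_pow_div_Gamma {ν : ℝ} (h0 : 0 < ν) (h2 : ν < 2) {x : ℝ} (hx : 0 ≤ x) :
    Tendsto (fun N : ℕ => x ^ N / Real.Gamma (ν * N + 1)) atTop (𝓝 0) := by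
  have h := (hasSum_integral_pow_mul_exp_mWright (α := ν / 2) (by linarith) (by linarith) 0
    (Real.sqrt x)).summable.tendsto_atTop_zero
  have h' := h.comp (tendsto_id.const_mul_atTop' (show 0 < 2 by norm_num) : Tendsto
    (fun N : ℕ => 2 * N) atTop atTop)
  refine h'.congr fun N => ?_
  simp only [Function.comp, add_zero, Nat.cast_zero]
  rw [pow_mul, Real.sq_sqrt hx]
  have : ((2 * N).factorial : ℝ) ≠ 0 := by positivity
  push_cast
  rw [show ν / 2 * (2 * (N : ℝ)) = ν * N by ring]
  field_simp

lemma IsFundamentalSolution.continuousOn {ν : ℝ} {n : ℕ} {k : ℝ} {U : ℝ → 𝓢'(ℝ, ℂ)}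
    (hU : IsFundamentalSolution ν n k U) (φ : 𝓢(ℝ, ℂ)) :
    ContinuousOn (fun s => U s φ) (Ioi 0) :=
  (hU.regular φ).1.continuousOn

lemma tendsto_apply_of_tendsto {U : ℝ → 𝓢'(ℝ, ℂ)} {T : 𝓢'(ℝ, ℂ)} {l : Filter ℝ}
    (h : Tendsto U l (𝓝 T)) (φ : 𝓢(ℝ, ℂ)) : Tendsto (fun s => U s φ) l (𝓝 (T φ)) :=
  (PointwiseConvergenceCLM.tendsto_iff_forall_tendsto.1 h) φ

lemma IsFundamentalSolution.tendsto {ν : ℝ} {n : ℕ} {k : ℝ} {U : ℝ → 𝓢'(ℝ, ℂ)}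
    (hU : IsFundamentalSolution ν n k U) (φ : 𝓢(ℝ, ℂ)) :
    Tendsto (fun s => U s φ) (𝓝[>] 0) (𝓝 (φ 0)) := by
  simpa using tendsto_apply_of_tendsto hU.initial φ

/-- Integrating the Caputo equation needs the right side to be bounded near t = 0, which follows
from the convergence of U_t to δ. Integrability of the kernel is recorded so that two such equations
can be subtracted. -/
lemma IsFundamentalSolution.volterra {ν : ℝ} (h0 : 0 < ν) (h2 : ν < 2) {n : ℕ} {k : ℝ}
    {U : ℝ → 𝓢'(ℝ, ℂ)} (hU : IsFundamentalSolution ν n k U) (φ : 𝓢(ℝ, ℂ)) {t : ℝ} (ht : 0 < t) :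
    IntervalIntegrable (fun s => (((t - s) ^ (ν - 1) : ℝ) : ℂ) * (k * U s (adjDeriv n φ)))
      volume 0 t ∧
    U t φ = φ 0 + fracInt ν (fun s => k * U s (adjDeriv n φ)) t := by
  have hc : ContinuousOn (fun s => (k : ℂ) * U s (adjDeriv n φ)) (Ioi 0) :=
    continuousOn_const.mul (hU.continuousOn _)
  have hb := fun T => exists_bound_of_tendsto hc ((hU.tendsto (adjDeriv n φ)).const_mul (k : ℂ)) T
  constructor
  · obtain ⟨C, hC⟩ := hb t
    exact intervalIntegrable_sub_rpow_mul hc h0 one_pos ht (C := C) fun s hs hst => by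
      simpa using hC s hs hst
  · refine eq_add_fracInt_of_caputo h0 h2 (hU.regular φ) (hU.tendsto φ)
      (fun h => hU.initial_deriv h φ) (fun s hs => ?_) (fun T hT => ?_) ht
    · rw [hU.equation φ s hs, iterate_derivCLM_apply]
    · obtain ⟨C, hC⟩ := hb T
      have := intervalIntegrable_sub_rpow_mul hc one_pos one_pos hT (C := C) fun s hs hst => by
        simpa using hC s hs hst
      simpa using this

/-- There is at most one fundamental solution. -/
theorem IsFundamentalSolution.unique {ν : ℝ} (h0 : 0 < ν) (h2 : ν < 2) {n : ℕ} {k : ℝ}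
    {U V : ℝ → 𝓢'(ℝ, ℂ)} (hU : IsFundamentalSolution ν n k U)
    (hV : IsFundamentalSolution ν n k V) {T : ℝ} (hT : 0 < T) : V T = U T := by
  have hW : ∀ φ t, 0 < t → V t φ - U t φ =
      fracInt ν (fun s => k * (V s (adjDeriv n φ) - U s (adjDeriv n φ))) t := by
    intro φ t ht
    obtain ⟨i1, e1⟩ := hV.volterra h0 h2 φ ht
    obtain ⟨i2, e2⟩ := hU.volterra h0 h2 φ ht
    rw [e1, e2, add_sub_add_left_eq_sub, fracInt, fracInt, fracInt, ← mul_sub,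
      ← intervalIntegral.integral_sub i1 i2]
    congr 2; ext s; ring
  -- Pointwise boundedness on all of (0,T] uses the limit at 0. Composing with the inverse Fourier
  -- transform states the bound on the Fourier side, where the adjoint operator is a multiplication.
  obtain ⟨s, C, hC, hbd⟩ := exists_seminorm_of_pointwise_bounded
    (ι := Ioc (0 : ℝ) T)
    (fun t => (show 𝓢(ℝ, ℂ) →L[ℂ] ℂ from V t.1 - U t.1).comp
      (FourierTransform.fourierInvCLM ℂ 𝓢(ℝ, ℂ))) (fun ψ => by
      obtain ⟨A, hA⟩ := exists_bound_of_tendsto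
        ((hV.continuousOn (𝓕⁻ ψ)).sub (hU.continuousOn (𝓕⁻ ψ)))
        ((hV.tendsto (𝓕⁻ ψ)).sub (hU.tendsto (𝓕⁻ ψ))) T
      exact ⟨A, fun t => hA t.1 t.2.1 t.2.2⟩)
  have hbd' : ∀ t, 0 < t → t ≤ T → ∀ φ : 𝓢(ℝ, ℂ), ‖V t φ - U t φ‖ ≤
      C * (s.sup (schwartzSeminormFamily ℂ ℝ ℂ)) (𝓕 φ : 𝓢(ℝ, ℂ)) := fun t ht htT φ => by
    have := hbd ⟨t, ht, htT⟩ (𝓕 φ)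
    have e : (FourierTransform.fourierInvCLM ℂ 𝓢(ℝ, ℂ)) (𝓕 φ : 𝓢(ℝ, ℂ)) = φ := by
      rw [FourierTransform.fourierInvCLM_apply, FourierTransform.fourierInv_fourier_eq]
    rw [ContinuousLinearMap.comp_apply, e] at this
    exact this
  -- Each use of the Volterra equation moves one adjoint onto φ and sends t^(νN)/Γ(νN+1) to the next
  -- such power.
  have hiter : ∀ (N : ℕ) (φ : 𝓢(ℝ, ℂ)) (t : ℝ), 0 < t → t ≤ T → ‖V t φ - U t φ‖ ≤
      C * (s.sup (schwartzSeminormFamily ℂ ℝ ℂ)) (𝓕 ((adjDeriv n)^[N] φ) : 𝓢(ℝ, ℂ)) * |k| ^ N /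
        Real.Gamma (ν * N + 1) * t ^ (ν * N) := by
    intro N
    induction N with
    | zero => intro φ t ht htT; simpa using hbd' t ht htT φ
    | succ N ih =>
      intro φ t ht htT
      rw [hW φ t ht]
      have hG := Real.Gamma_pos_of_pos (show 0 < ν * N + 1 by positivity)
      have := fracInt_norm_le h0 (show 0 < ν * N + 1 by positivity) ht
        (f := fun s => k * (V s (adjDeriv n φ) - U s (adjDeriv n φ)))
        (C := |k| * (C * (s.sup (schwartzSeminormFamily ℂ ℝ ℂ))
          (𝓕 ((adjDeriv n)^[N] (adjDeriv n φ)) : 𝓢(ℝ, ℂ)) * |k| ^ N / Real.Gamma (ν * N + 1)))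
        (fun r hr hrt => by
          rw [norm_mul, Complex.norm_real, Real.norm_eq_abs, add_sub_cancel_right, mul_assoc |k|]
          gcongr
          exact ih (adjDeriv n φ) r hr (hrt.trans htT))
      refine this.trans_eq ?_
      rw [Function.iterate_succ_apply, show ν + (ν * N + 1) - 1 = ν * ((N + 1 : ℕ) : ℝ) by
        push_cast; ring, show ν + (ν * N + 1) = ν * ((N + 1 : ℕ) : ℝ) + 1 by push_cast; ring]
      field_simp
      ring
  -- On a compact frequency band the powers of the symbol cost only A^N, which Γ(νN+1) defeats.
  have hband : ∀ φ : 𝓢(ℝ, ℂ), HasCompactSupport (𝓕 φ : 𝓢(ℝ, ℂ)) → V T φ = U T φ := by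
    intro φ hφ
    obtain ⟨A, B, hA, hB, hAB⟩ := exists_sup_seminorm_le (contDiff_derivSymbol n) (𝓕 φ) hφ s
    have hle : ∀ N : ℕ, ‖V T φ - U T φ‖ ≤
        C * B * ((A * |k| * T ^ ν) ^ N / Real.Gamma (ν * N + 1)) := fun N => by
      have hG := Real.Gamma_pos_of_pos (show 0 < ν * N + 1 by positivity)
      refine (hiter N φ T hT le_rfl).trans ?_
      rw [Real.rpow_mul hT.le, Real.rpow_natCast]
      calc _ ≤ C * (B * A ^ N) * |k| ^ N / Real.Gamma (ν * N + 1) * (T ^ ν) ^ N := by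
            gcongr
            exact hAB N _ (fourier_iterate_adjDeriv n N φ)
        _ = _ := by rw [mul_pow, mul_pow]; ring
    have hlim := (tendsto_pow_div_Gamma h0 h2 (x := A * |k| * T ^ ν) (by positivity)).const_mul (C * B)
    have := ge_of_tendsto' hlim hle
    rw [mul_zero] at this
    exact sub_eq_zero.1 (norm_le_zero_iff.1 this)
  ext φ
  obtain ⟨f, hfc, hft⟩ := exists_compactSupport_tendsto (𝓕 φ)
  have hcont : Continuous (fun ψ : 𝓢(ℝ, ℂ) => (𝓕⁻ ψ : 𝓢(ℝ, ℂ))) :=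
    (FourierTransform.fourierInvCLM ℂ 𝓢(ℝ, ℂ)).continuous
  have hft' : Tendsto (fun i => (𝓕⁻ (f i) : 𝓢(ℝ, ℂ))) atTop (𝓝 φ) := by
    have := (hcont.tendsto (𝓕 φ)).comp hft
    rwa [FourierTransform.fourierInv_fourier_eq] at this
  have hv := ((V T).continuous.tendsto φ).comp hft'
  have hu := ((U T).continuous.tendsto φ).comp hft'
  refine tendsto_nhds_unique hv (hu.congr fun i => (hband _ ?_).symm)
  rw [FourierTransform.fourier_fourierInv_eq]
  exact hfc i

end FracHeat

namespace FracHeat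

/-! ### Existence of a fundamental solution from its Fourier symbol -/

lemma integrable_norm_mul_one_add_pow (ψ : 𝓢(ℝ, ℂ)) (A : ℕ) :
    Integrable fun ξ => ‖ψ ξ‖ * (1 + |ξ| ^ A) := by
  refine ((ψ.integrable (μ := volume)).norm.add (ψ.integrable_pow_mul volume A)).congr
    (Eventually.of_forall fun ξ => ?_)
  simp only [Pi.add_apply, Real.norm_eq_abs]
  ring

section SymbolPairing

variable {F F' : ℝ → ℝ → ℂ} {b b' : ℝ → ℝ} {A : ℕ}

lemma continuous_symbol (hF : ContinuousOn (Function.uncurry F) (Ioi 0 ×ˢ univ)) {t : ℝ}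
    (ht : 0 < t) : Continuous (F t) :=
  continuousOn_univ.1 (hF.comp (f := fun ξ => (t, ξ)) (by fun_prop) fun _ _ => ⟨ht, mem_univ _⟩)

lemma integrable_schwartz_mul_symbol (hF : ContinuousOn (Function.uncurry F) (Ioi 0 ×ˢ univ))
    (hb : ∀ t ξ, 0 < t → ‖F t ξ‖ ≤ b t * (1 + |ξ| ^ A)) (ψ : 𝓢(ℝ, ℂ)) {t : ℝ} (ht : 0 < t) :
    Integrable fun ξ => ψ ξ * F t ξ := by
  refine ((integrable_norm_mul_one_add_pow ψ A).const_mul (b t)).mono'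
    (ψ.continuous.mul (continuous_symbol hF ht)).aestronglyMeasurable
    (Eventually.of_forall fun ξ => ?_)
  rw [norm_mul]
  nlinarith [hb t ξ ht, norm_nonneg (ψ ξ)]

lemma norm_integral_schwartz_mul_symbol_le
    (hb : ∀ t ξ, 0 < t → ‖F t ξ‖ ≤ b t * (1 + |ξ| ^ A)) (ψ : 𝓢(ℝ, ℂ)) {t : ℝ} (ht : 0 < t) :
    ‖∫ ξ, ψ ξ * F t ξ‖ ≤ (∫ ξ, ‖ψ ξ‖ * (1 + |ξ| ^ A)) * b t := by
  rw [mul_comm, ← integral_const_mul]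
  refine norm_integral_le_of_norm_le ((integrable_norm_mul_one_add_pow ψ A).const_mul (b t))
    (Eventually.of_forall fun ξ => ?_)
  rw [norm_mul]
  nlinarith [hb t ξ ht, norm_nonneg (ψ ξ)]

lemma exists_local_bound (hbc : ContinuousOn b (Ioi 0))
    (hb : ∀ t ξ, 0 < t → ‖F t ξ‖ ≤ b t * (1 + |ξ| ^ A)) {t : ℝ} (ht : 0 < t) :
    ∃ K : ℝ, ∀ s ∈ Icc (t / 2) (2 * t), ∀ ξ, ‖F s ξ‖ ≤ K * (1 + |ξ| ^ A) := by
  obtain ⟨K, hK⟩ := (isCompact_Icc (a := t / 2) (b := 2 * t)).exists_bound_of_continuousOn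
    (hbc.mono fun s hs => lt_of_lt_of_le (half_pos ht) hs.1)
  refine ⟨K, fun s hs ξ => (hb s ξ (lt_of_lt_of_le (half_pos ht) hs.1)).trans ?_⟩
  gcongr
  exact (le_abs_self _).trans (hK s hs)

lemma Icc_half_two_mul_mem_nhds {t : ℝ} (ht : 0 < t) : Icc (t / 2) (2 * t) ∈ 𝓝 t :=
  Icc_mem_nhds (by linarith) (by linarith)

lemma continuousOn_integral_schwartz_mul_symbol
    (hF : ContinuousOn (Function.uncurry F) (Ioi 0 ×ˢ univ)) (hbc : ContinuousOn b (Ioi 0))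
    (hb : ∀ t ξ, 0 < t → ‖F t ξ‖ ≤ b t * (1 + |ξ| ^ A)) (ψ : 𝓢(ℝ, ℂ)) :
    ContinuousOn (fun t => ∫ ξ, ψ ξ * F t ξ) (Ioi 0) := by
  intro t (ht : 0 < t)
  obtain ⟨K, hK⟩ := exists_local_bound hbc hb ht
  refine (continuousAt_of_dominated (bound := fun ξ => K * (‖ψ ξ‖ * (1 + |ξ| ^ A))) ?_ ?_
    ((integrable_norm_mul_one_add_pow ψ A).const_mul K) ?_).continuousWithinAt
  · filter_upwards [Ioi_mem_nhds ht] with s hs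
    exact (integrable_schwartz_mul_symbol hF hb ψ hs).aestronglyMeasurable
  · filter_upwards [Icc_half_two_mul_mem_nhds ht] with s hs
    refine Eventually.of_forall fun ξ => ?_
    rw [norm_mul]
    nlinarith [hK s hs ξ, norm_nonneg (ψ ξ)]
  · refine Eventually.of_forall fun ξ => ?_
    have h1 : ContinuousOn (fun s => F s ξ) (Ioi 0) :=
      hF.comp (f := fun s => (s, ξ)) (by fun_prop) fun s hs => ⟨hs, mem_univ _⟩
    exact continuousAt_const.mul (h1.continuousAt (Ioi_mem_nhds ht))

lemma hasDerivAt_integral_schwartz_mul_symbol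
    (hF : ContinuousOn (Function.uncurry F) (Ioi 0 ×ˢ univ))
    (hb : ∀ t ξ, 0 < t → ‖F t ξ‖ ≤ b t * (1 + |ξ| ^ A))
    (hF' : ContinuousOn (Function.uncurry F') (Ioi 0 ×ˢ univ)) (hbc' : ContinuousOn b' (Ioi 0))
    (hb' : ∀ t ξ, 0 < t → ‖F' t ξ‖ ≤ b' t * (1 + |ξ| ^ A))
    (hd : ∀ t ξ, 0 < t → HasDerivAt (fun s => F s ξ) (F' t ξ) t) (ψ : 𝓢(ℝ, ℂ)) {t : ℝ}
    (ht : 0 < t) : HasDerivAt (fun t => ∫ ξ, ψ ξ * F t ξ) (∫ ξ, ψ ξ * F' t ξ) t := by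
  obtain ⟨K, hK⟩ := exists_local_bound hbc' hb' ht
  refine (hasDerivAt_integral_of_dominated_loc_of_deriv_le (Icc_half_two_mul_mem_nhds ht)
    (F := fun t ξ => ψ ξ * F t ξ) (F' := fun t ξ => ψ ξ * F' t ξ)
    (bound := fun ξ => K * (‖ψ ξ‖ * (1 + |ξ| ^ A))) ?_
    (integrable_schwartz_mul_symbol hF hb ψ ht)
    (integrable_schwartz_mul_symbol hF' hb' ψ ht).aestronglyMeasurable
    (Eventually.of_forall fun ξ s hs => ?_)
    ((integrable_norm_mul_one_add_pow ψ A).const_mul K)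
    (Eventually.of_forall fun ξ s hs => ?_)).2
  · filter_upwards [Ioi_mem_nhds ht] with s hs
    exact (integrable_schwartz_mul_symbol hF hb ψ hs).aestronglyMeasurable
  · rw [norm_mul]
    nlinarith [hK s hs ξ, norm_nonneg (ψ ξ)]
  · exact (hd s ξ (lt_of_lt_of_le (half_pos ht) hs.1)).const_mul _

end SymbolPairing

/-- The integral of the Fourier transform is the value at the origin. -/
lemma integral_fourier_eq (φ : 𝓢(ℝ, ℂ)) : ∫ ξ, (𝓕 φ : 𝓢(ℝ, ℂ)) ξ = φ 0 := by
  have h : (𝓕⁻ (𝓕 φ : 𝓢(ℝ, ℂ)) : 𝓢(ℝ, ℂ)) 0 = φ 0 := by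
    rw [FourierTransform.fourierInv_fourier_eq]
  rw [← h, SchwartzMap.fourierInv_coe, Real.fourierInv_eq']
  simp

open Classical in
/-- The tempered distribution with Fourier symbol `m`: `φ ↦ ∫ 𝓕φ(ξ) m(ξ) dξ`. -/
noncomputable def symbolDistribution (m : ℝ → ℂ) : 𝓢'(ℝ, ℂ) :=
  if h : MemLp m ⊤ (volume : Measure ℝ) then 𝓕 (Lp.toTemperedDistribution (h.toLp m)) else 0

lemma symbolDistribution_apply {m : ℝ → ℂ} (hm : Continuous m) {C : ℝ} (hC : ∀ ξ, ‖m ξ‖ ≤ C)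
    (φ : 𝓢(ℝ, ℂ)) : symbolDistribution m φ = ∫ ξ, (𝓕 φ : 𝓢(ℝ, ℂ)) ξ * m ξ := by
  have h : MemLp m ⊤ (volume : Measure ℝ) :=
    memLp_top_of_bound hm.aestronglyMeasurable C (Eventually.of_forall hC)
  rw [symbolDistribution, dif_pos h, TemperedDistribution.fourier_apply,
    Lp.toTemperedDistribution_apply]
  refine integral_congr_ae ?_
  filter_upwards [h.coeFn_toLp] with ξ hξ
  rw [hξ, smul_eq_mul]

lemma integral_mul_fracInt {F : ℝ → ℝ → ℂ}
    (hF : ContinuousOn (Function.uncurry F) (Ioi 0 ×ˢ univ)) {C : ℝ}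
    (hb : ∀ t ξ, 0 < t → ‖F t ξ‖ ≤ C) (ψ : 𝓢(ℝ, ℂ)) {ν t : ℝ} (h0 : 0 < ν) (ht : 0 < t) :
    Integrable (fun ξ => ψ ξ * fracInt ν (fun s => F s ξ) t) ∧
    ∫ ξ, ψ ξ * fracInt ν (fun s => F s ξ) t = fracInt ν (fun s => ∫ ξ, ψ ξ * F s ξ) t := by
  set c : ℂ := ((1 / Real.Gamma ν : ℝ) : ℂ) with hc
  set μ := (volume : Measure ℝ).restrict (Ioc 0 t) with hμ
  set f : ℝ → ℝ → ℂ := fun ξ s => ψ ξ * ((((t - s) ^ (ν - 1) : ℝ) : ℂ) * F s ξ) with hf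
  have hint : Integrable (Function.uncurry f) (volume.prod μ) := by
    have h1 : Integrable (fun s => C * (t - s) ^ (ν - 1)) μ := by
      have := (intervalIntegrable_iff_integrableOn_Ioc_of_le ht.le).1
        ((intervalIntegrable_sub_rpow_mul_rpow h0 one_pos ht).const_mul C)
      simpa [IntegrableOn] using this
    have h2 : Integrable (fun z : ℝ × ℝ => ‖ψ z.1‖ * (C * (t - z.2) ^ (ν - 1)))
        (volume.prod μ) := (ψ.integrable (μ := volume)).norm.mul_prod h1
    have hms : MeasurableSet ((univ : Set ℝ) ×ˢ Ioc (0 : ℝ) t) :=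
      MeasurableSet.univ.prod measurableSet_Ioc
    have hprod : (volume : Measure ℝ).prod μ =
        ((volume : Measure ℝ).prod volume).restrict (univ ×ˢ Ioc (0 : ℝ) t) := by
      rw [← Measure.prod_restrict, Measure.restrict_univ]
    refine h2.mono' ?_ ?_
    · have h3 : AEStronglyMeasurable (fun z : ℝ × ℝ => F z.2 z.1) (volume.prod μ) := by
        rw [hprod]
        refine ContinuousOn.aestronglyMeasurable ?_ hms
        exact hF.comp (f := fun z : ℝ × ℝ => (z.2, z.1)) (by fun_prop)
          fun z hz => ⟨hz.2.1, mem_univ _⟩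
      have h4 : Measurable fun z : ℝ × ℝ => (((t - z.2) ^ (ν - 1) : ℝ) : ℂ) :=
        Complex.measurable_ofReal.comp ((measurable_const.sub measurable_snd).pow_const _)
      exact (ψ.continuous.comp continuous_fst).aestronglyMeasurable.mul
        (h4.aestronglyMeasurable.mul h3)
    · rw [hprod]
      filter_upwards [ae_restrict_mem hms] with z hz
      have h5 : 0 ≤ (t - z.2) ^ (ν - 1) := Real.rpow_nonneg (by linarith [hz.2.2]) _
      simp only [Function.uncurry, hf, norm_mul, Complex.norm_real, Real.norm_eq_abs,
        abs_of_nonneg h5]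
      rw [mul_comm C]
      gcongr
      exact hb _ _ hz.2.1
  have e1 : ∀ ξ, ψ ξ * fracInt ν (fun s => F s ξ) t = c * ∫ s, f ξ s ∂μ := fun ξ => by
    simp only [hf]
    rw [fracInt, intervalIntegral.integral_of_le ht.le, integral_const_mul]
    ring
  simp_rw [e1]
  refine ⟨hint.integral_prod_left.const_mul c, ?_⟩
  rw [integral_const_mul, integral_integral_swap hint, fracInt,
    intervalIntegral.integral_of_le ht.le]
  congr 1
  refine integral_congr_ae (Eventually.of_forall fun s => ?_)
  simp only [hf]
  rw [← integral_const_mul]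
  congr 1; ext ξ; ring

lemma tendsto_zero_of_norm_le_rpow {f : ℝ → ℂ} {C a : ℝ} (ha : 0 < a)
    (hf : ∀ t, 0 < t → ‖f t‖ ≤ C * t ^ a) : Tendsto f (𝓝[>] 0) (𝓝 0) := by
  have h1 : Tendsto (fun t : ℝ => C * t ^ a) (𝓝[>] 0) (𝓝 0) := by
    have := ((Real.continuousAt_rpow_const 0 a (Or.inr ha.le)).tendsto.const_mul C)
    rw [Real.zero_rpow ha.ne', mul_zero] at this
    exact this.mono_left nhdsWithin_le_nhds
  exact squeeze_zero_norm' (eventually_mem_nhdsWithin.mono fun t ht => hf t ht) h1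

/-- A family of symbols `q 0`, with its time derivatives `q i`, which solves the Volterra equation
`q t ξ = 1 + k (-2πiξ)^n J^ν q(·, ξ) (t)`, gives a fundamental solution. -/
theorem exists_isFundamentalSolution {ν : ℝ} (h0 : 0 < ν) (h2 : ν < 2) {n : ℕ} {k : ℝ}
    {q : ℕ → ℝ → ℝ → ℂ} {C : ℝ} {A : ℕ}
    (hcont : ∀ i ≤ ⌈ν⌉₊, ContinuousOn (Function.uncurry (q i)) (Ioi 0 ×ˢ univ))
    (hder : ∀ i < ⌈ν⌉₊, ∀ t ξ, 0 < t → HasDerivAt (fun s => q i s ξ) (q (i + 1) t ξ) t)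
    (hb0 : ∀ t ξ, 0 < t → ‖q 0 t ξ‖ ≤ C)
    (hb : ∀ i, 1 ≤ i → i ≤ ⌈ν⌉₊ → ∀ t ξ, 0 < t →
      ‖q i t ξ‖ ≤ C * t ^ (ν - i) * (1 + |ξ| ^ A))
    (hvol : ∀ t ξ, 0 < t →
      q 0 t ξ = 1 + k * derivSymbol n ξ * fracInt ν (fun s => q 0 s ξ) t) :
    ∃ U : ℝ → 𝓢'(ℝ, ℂ), IsFundamentalSolution ν n k U ∧
      ∀ t, 0 < t → ∀ φ : 𝓢(ℝ, ℂ), U t φ = ∫ ξ, (𝓕 φ : 𝓢(ℝ, ℂ)) ξ * q 0 t ξ := by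
  have hC : 0 ≤ C := (norm_nonneg _).trans (hb0 1 0 one_pos)
  have hm1 : 1 ≤ ⌈ν⌉₊ := Nat.one_le_ceil_iff.2 h0
  -- The symbol itself is bounded in t; its i-th derivative may blow up like t^(ν-i), which is the
  -- growth that the Caputo integral tolerates at i = ⌈ν⌉.
  set b : ℕ → ℝ → ℝ := fun i t => if i = 0 then C else C * t ^ (ν - i) with hbdef
  have hbc : ∀ i, ContinuousOn (b i) (Ioi 0) := fun i => by
    rcases Nat.eq_zero_or_pos i with rfl | hi
    · simpa [hbdef] using continuousOn_const
    · simp only [hbdef, hi.ne', if_false]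
      exact continuousOn_const.mul (continuousOn_id.rpow_const fun t ht => Or.inl (ne_of_gt ht))
  have hb' : ∀ i ≤ ⌈ν⌉₊, ∀ t ξ, 0 < t → ‖q i t ξ‖ ≤ b i t * (1 + |ξ| ^ A) := fun i hi t ξ ht => by
    rcases Nat.eq_zero_or_pos i with rfl | hi0
    · simp only [hbdef, if_true]
      exact (hb0 t ξ ht).trans (le_mul_of_one_le_right hC (by simp))
    · simp only [hbdef, hi0.ne', if_false]
      exact hb i hi0 hi t ξ ht
  set U : ℝ → 𝓢'(ℝ, ℂ) := fun t => symbolDistribution (q 0 t) with hU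
  have hUe : ∀ t, 0 < t → ∀ φ : 𝓢(ℝ, ℂ), U t φ = ∫ ξ, (𝓕 φ : 𝓢(ℝ, ℂ)) ξ * q 0 t ξ :=
    fun t ht φ => symbolDistribution_apply (continuous_symbol (hcont 0 (Nat.zero_le _)) ht)
      (fun ξ => hb0 t ξ ht) φ
  set G : 𝓢(ℝ, ℂ) → ℕ → ℝ → ℂ := fun ψ i t => ∫ ξ, ψ ξ * q i t ξ with hG
  have hGd : ∀ ψ, ∀ i < ⌈ν⌉₊, ∀ t, 0 < t → HasDerivAt (G ψ i) (G ψ (i + 1) t) t :=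
    fun ψ i hi t ht => hasDerivAt_integral_schwartz_mul_symbol (hcont i hi.le) (hb' i hi.le)
      (hcont (i + 1) hi) (hbc _) (hb' (i + 1) hi) (hder i hi) ψ ht
  have hGc : ∀ ψ, ∀ i ≤ ⌈ν⌉₊, ContinuousOn (G ψ i) (Ioi 0) := fun ψ i hi =>
    continuousOn_integral_schwartz_mul_symbol (hcont i hi) (hbc i) (hb' i hi) ψ
  have hGb : ∀ ψ, ∀ i ≤ ⌈ν⌉₊, ∀ t, 0 < t →
      ‖G ψ i t‖ ≤ (∫ ξ, ‖ψ ξ‖ * (1 + |ξ| ^ A)) * b i t := fun ψ i hi t ht =>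
    norm_integral_schwartz_mul_symbol_le (hb' i hi) ψ ht
  have hsmooth : ∀ ψ (j i : ℕ), i + j = ⌈ν⌉₊ → ContDiffOn ℝ j (G ψ i) (Ioi 0) := by
    intro ψ j
    induction j with
    | zero => intro i hi; exact contDiffOn_zero.2 (hGc ψ i (by omega))
    | succ j ih =>
      intro i hi
      push_cast
      rw [contDiffOn_succ_iff_deriv_of_isOpen isOpen_Ioi]
      refine ⟨fun t ht => (hGd ψ i (by omega) t ht).differentiableAt.differentiableWithinAt,
        by simp, (ih (i + 1) (by omega)).congr fun t ht => (hGd ψ i (by omega) t ht).deriv⟩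
  have hUG : ∀ φ : 𝓢(ℝ, ℂ), ∀ t, 0 < t → U t φ = G (𝓕 φ) 0 t := fun φ t ht => hUe t ht φ
  have hiter : ∀ φ : 𝓢(ℝ, ℂ), ∀ i ≤ ⌈ν⌉₊, ∀ t, 0 < t →
      iteratedDeriv i (fun s => U s φ) t = G (𝓕 φ) i t := by
    intro φ i
    induction i with
    | zero => intro _ t ht; simpa using hUG φ t ht
    | succ i ih =>
      intro hi t ht
      rw [iteratedDeriv_succ]
      have : iteratedDeriv i (fun s => U s φ) =ᶠ[𝓝 t] G (𝓕 φ) i := by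
        filter_upwards [isOpen_Ioi.mem_nhds (show t ∈ Ioi (0 : ℝ) from ht)] with s hs
        exact ih (by omega) s hs
      rw [this.deriv_eq]
      exact (hGd _ i (by omega) t ht).deriv
  -- The scalar Volterra equations are integrated against 𝓕φ: the constant 1 gives φ(0), and the
  -- factor `derivSymbol` becomes the adjoint acting on φ.
  have heq : ∀ φ : 𝓢(ℝ, ℂ), ∀ t, 0 < t →
      U t φ = φ 0 + fracInt ν (fun s => k * U s (adjDeriv n φ)) t := by
    intro φ t ht
    obtain ⟨i1, e1⟩ := integral_mul_fracInt (hcont 0 (Nat.zero_le _)) hb0 (𝓕 (adjDeriv n φ)) h0 ht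
    have e2 : fracInt ν (fun s => k * U s (adjDeriv n φ)) t =
        k * fracInt ν (fun s => ∫ ξ, (𝓕 (adjDeriv n φ) : 𝓢(ℝ, ℂ)) ξ * q 0 s ξ) t := by
      unfold fracInt
      rw [mul_left_comm (k : ℂ), intervalIntegral.integral_of_le ht.le,
        intervalIntegral.integral_of_le ht.le, ← integral_const_mul (k : ℂ)]
      refine congrArg _ (setIntegral_congr_fun measurableSet_Ioc fun s hs => ?_)
      simp only [hUe s hs.1]
      ring
    rw [e2, ← e1, hUe t ht, ← integral_fourier_eq, ← integral_const_mul,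
      ← integral_add (SchwartzMap.integrable _) (i1.const_mul _)]
    congr 1; ext ξ
    rw [hvol t ξ ht, fourier_adjDeriv]; ring
  have hhc : ∀ φ : 𝓢(ℝ, ℂ), ContinuousOn (fun s => (k : ℂ) * U s (adjDeriv n φ)) (Ioi 0) :=
    fun φ => continuousOn_const.mul
      ((hGc (𝓕 (adjDeriv n φ)) 0 (Nat.zero_le _)).congr fun t ht => hUG _ t ht)
  have hhb : ∀ φ : 𝓢(ℝ, ℂ), ∃ D, ∀ t, 0 < t → ‖(k : ℂ) * U t (adjDeriv n φ)‖ ≤ D := fun φ =>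
    ⟨|k| * ((∫ ξ, ‖(𝓕 (adjDeriv n φ) : 𝓢(ℝ, ℂ)) ξ‖ * (1 + |ξ| ^ A)) * C), fun t ht => by
      rw [norm_mul, Complex.norm_real, Real.norm_eq_abs, hUG _ t ht]
      have := hGb (𝓕 (adjDeriv n φ)) 0 (Nat.zero_le _) t ht
      simp only [hbdef, if_true] at this
      gcongr⟩
  have hlim : ∀ φ : 𝓢(ℝ, ℂ), Tendsto (fun t => U t φ) (𝓝[>] 0) (𝓝 (φ 0)) := fun φ => by
    obtain ⟨D, hD⟩ := hhb φ
    have h3 := tendsto_zero_of_norm_le_rpow (f := fracInt ν (fun s => k * U s (adjDeriv n φ)))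
      (C := D * (Real.Gamma 1 / Real.Gamma (ν + 1))) (a := ν) h0 fun t ht => by
        have := fracInt_norm_le h0 one_pos ht (C := D)
          (f := fun s => (k : ℂ) * U s (adjDeriv n φ)) fun s hs _ => by simpa using hD s hs
        simpa using this
    have h4 := h3.const_add (φ 0)
    rw [add_zero] at h4
    exact h4.congr' (eventually_mem_nhdsWithin.mono fun t ht => (heq φ t ht).symm)
  have hdlim : 1 < ν → ∀ φ : 𝓢(ℝ, ℂ),
      Tendsto (deriv fun s => U s φ) (𝓝[>] 0) (𝓝 0) := fun h1 φ => by
    refine tendsto_zero_of_norm_le_rpow (a := ν - 1) (by linarith)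
      (C := (∫ ξ, ‖(𝓕 φ : 𝓢(ℝ, ℂ)) ξ‖ * (1 + |ξ| ^ A)) * C) fun t ht => ?_
    rw [← iteratedDeriv_one, hiter φ 1 hm1 t ht]
    have := hGb (𝓕 φ) 1 hm1 t ht
    simp only [hbdef, one_ne_zero, if_false, Nat.cast_one] at this
    rwa [mul_assoc]
  have hcap : ∀ φ : 𝓢(ℝ, ℂ), CaputoRegular ν (fun s => U s φ) ∧ ∀ t, 0 < t →
      caputo ν (fun s => U s φ) t = k * U t (adjDeriv n φ) := fun φ => by
    obtain ⟨D, hD⟩ := hhb φ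
    refine caputo_eq_of_eq_add_fracInt h0 h2
      (C := (∫ ξ, ‖(𝓕 φ : 𝓢(ℝ, ℂ)) ξ‖ * (1 + |ξ| ^ A)) * C)
      ((hsmooth (𝓕 φ) ⌈ν⌉₊ 0 (by omega)).congr fun t ht => hUG φ t ht) (fun t ht => ?_) (hlim φ)
      (fun h => hdlim h φ) (hhc φ) hD (heq φ)
    rw [hiter φ _ le_rfl t ht]
    have := hGb (𝓕 φ) _ le_rfl t ht
    simp only [hbdef, (show ⌈ν⌉₊ ≠ 0 by omega), if_false] at this
    rwa [mul_assoc]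
  refine ⟨U, ⟨fun φ => (hcap φ).1, fun φ t ht => ?_, ?_, hdlim⟩, hUe⟩
  · rw [(hcap φ).2 t ht, iterate_derivCLM_apply]
  · rw [PointwiseConvergenceCLM.tendsto_iff_forall_tendsto]
    intro φ
    simpa using hlim φ

end FracHeat

namespace FracHeat

/-! ### The Laplace transform of the density and the symbols of the solutions -/

/-- `∫_0^∞ u^j e^{zu} M(u) du`, where `M` is the `M`-Wright function. -/
noncomputable def mWrightLaplace (α : ℝ) (j : ℕ) (z : ℂ) : ℂ :=
  ∫ u in Ioi (0 : ℝ), (u : ℂ) ^ j * Complex.exp (z * u) * mWright α u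

section
variable {α : ℝ} (h0 : 0 < α) (h1 : α < 1)

lemma norm_pow_mul_cexp_mul_mWright {u : ℝ} (hu : 0 < u) (j : ℕ) (z : ℂ) :
    ‖(u : ℂ) ^ j * Complex.exp (z * u) * mWright α u‖ =
      u ^ j * Real.exp (z.re * u) * |mWright α u| := by
  rw [norm_mul, norm_mul, norm_pow, Complex.norm_real, Complex.norm_real, Complex.norm_exp,
    Real.norm_of_nonneg hu.le, Real.norm_eq_abs]
  simp

include h0 h1

lemma aestronglyMeasurable_pow_mul_cexp_mul_mWright (j : ℕ) (z : ℂ) :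
    AEStronglyMeasurable (fun u : ℝ => (u : ℂ) ^ j * Complex.exp (z * u) * mWright α u)
      (volume.restrict (Ioi 0)) :=
  (Continuous.aestronglyMeasurable (by fun_prop)).mul
    (Complex.continuous_ofReal.comp_aestronglyMeasurable (aestronglyMeasurable_mWright h0 h1))

lemma integrableOn_pow_mul_cexp_mul_mWright (j : ℕ) (z : ℂ) :
    IntegrableOn (fun u : ℝ => (u : ℂ) ^ j * Complex.exp (z * u) * mWright α u) (Ioi 0) := by
  refine (integrableOn_pow_mul_exp_mul_mWright h0 h1 j z.re).norm.mono'
    (aestronglyMeasurable_pow_mul_cexp_mul_mWright h0 h1 j z) ?_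
  filter_upwards [ae_restrict_mem measurableSet_Ioi] with u hu
  have hu' : (0 : ℝ) < u := hu
  rw [norm_pow_mul_cexp_mul_mWright hu]
  simp [abs_of_pos hu']

lemma hasDerivAt_mWrightLaplace (j : ℕ) (z : ℂ) :
    HasDerivAt (mWrightLaplace α j) (mWrightLaplace α (j + 1) z) z := by
  refine (hasDerivAt_integral_of_dominated_loc_of_deriv_le (Metric.ball_mem_nhds z one_pos)
    (F := fun z (u : ℝ) => (u : ℂ) ^ j * Complex.exp (z * u) * mWright α u)
    (F' := fun z (u : ℝ) => (u : ℂ) ^ (j + 1) * Complex.exp (z * u) * mWright α u)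
    (bound := fun u => ‖u ^ (j + 1) * Real.exp ((z.re + 1) * u) * mWright α u‖)
    (Eventually.of_forall fun w => aestronglyMeasurable_pow_mul_cexp_mul_mWright h0 h1 j w)
    (integrableOn_pow_mul_cexp_mul_mWright h0 h1 j z)
    (aestronglyMeasurable_pow_mul_cexp_mul_mWright h0 h1 (j + 1) z) ?_
    (integrableOn_pow_mul_exp_mul_mWright h0 h1 (j + 1) (z.re + 1)).norm ?_).2
  · filter_upwards [ae_restrict_mem measurableSet_Ioi] with u hu w hw
    have hu' : (0 : ℝ) < u := hu
    have hw' : w.re ≤ z.re + 1 := by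
      have := (Complex.abs_re_le_norm (w - z)).trans (mem_ball_iff_norm.1 hw).le
      rw [Complex.sub_re] at this
      linarith [le_abs_self (w.re - z.re)]
    rw [norm_pow_mul_cexp_mul_mWright hu, norm_mul, norm_mul, Real.norm_of_nonneg (by positivity),
      Real.norm_of_nonneg (Real.exp_nonneg _), Real.norm_eq_abs]
    gcongr
  · refine Eventually.of_forall fun u w _ => ?_
    have := (((hasDerivAt_id w).mul_const (u : ℂ)).cexp.const_mul ((u : ℂ) ^ j)).mul_const
      ((mWright α u : ℝ) : ℂ)
    refine this.congr_deriv ?_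
    simp only [id]
    ring

lemma continuous_mWrightLaplace (j : ℕ) : Continuous (mWrightLaplace α j) :=
  continuous_iff_continuousAt.2 fun z => (hasDerivAt_mWrightLaplace h0 h1 j z).continuousAt

/-- Here M ≥ 0 is essential: |e^(zu)| ≤ 1 leaves exactly the j-th moment, a bound uniform over the
half-plane. -/
lemma norm_mWrightLaplace_le (j : ℕ) {z : ℂ} (hz : z.re ≤ 0) :
    ‖mWrightLaplace α j z‖ ≤ j.factorial / Real.Gamma (α * j + 1) := by
  rw [← integral_pow_mul_mWright h0 h1 j]
  refine norm_integral_le_of_norm_le (integrableOn_pow_mul_mWright h0 h1 j) ?_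
  filter_upwards [ae_restrict_mem measurableSet_Ioi] with u hu
  have hu' : (0 : ℝ) < u := hu
  rw [norm_pow_mul_cexp_mul_mWright hu, abs_of_nonneg (mWright_nonneg h0 h1 hu'.le)]
  have hM := mWright_nonneg h0 h1 hu'.le
  have : Real.exp (z.re * u) ≤ 1 := Real.exp_le_one_iff.2 (by nlinarith)
  calc _ ≤ u ^ j * 1 * mWright α u := by gcongr
    _ = _ := by ring

lemma norm_mWrightLaplace_sub_le (j : ℕ) {z w : ℂ} (hz : z.re ≤ 0) (hw : w.re ≤ 0) :
    ‖mWrightLaplace α j z - mWrightLaplace α j w‖ ≤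
      (j + 1).factorial / Real.Gamma (α * (j + 1 : ℕ) + 1) * ‖z - w‖ := by
  have hconv : Convex ℝ {z : ℂ | z.re ≤ 0} := convex_halfSpace_re_le 0
  exact hconv.norm_image_sub_le_of_norm_hasDerivWithin_le (𝕜 := ℂ)
    (fun x _ => (hasDerivAt_mWrightLaplace h0 h1 j x).hasDerivWithinAt)
    (fun x hx => norm_mWrightLaplace_le h0 h1 (j + 1) hx) hw hz

lemma hasSum_mWrightLaplace_zero (z : ℂ) :
    HasSum (fun j : ℕ => z ^ j / Real.Gamma (α * j + 1)) (mWrightLaplace α 0 z) := by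
  simpa [mWrightLaplace] using hasSum_integral_cexp_mWright h0 h1 z

end

/-- The Mittag-Leffler series solves the Volterra equation `f = 1 + c J^ν f`. -/
lemma eq_one_add_mul_fracInt_of_hasSum {ν : ℝ} (h0 : 0 < ν) {c : ℂ} {f : ℝ → ℂ}
    (hf : ∀ s, 0 < s → HasSum (fun j : ℕ => (c * ((s ^ ν : ℝ) : ℂ)) ^ j / Real.Gamma (ν * j + 1))
      (f s)) {t : ℝ} (ht : 0 < t) : f t = 1 + c * fracInt ν f t := by
  have hG : ∀ j : ℕ, 0 < Real.Gamma (ν * j + 1) := fun j =>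
    Real.Gamma_pos_of_pos (by positivity)
  have hpow : ∀ s : ℝ, 0 < s → ∀ j : ℕ, (c * ((s ^ ν : ℝ) : ℂ)) ^ j =
      c ^ j * ((s ^ (ν * j + 1 - 1) : ℝ) : ℂ) := fun s hs j => by
    rw [mul_pow, ← Complex.ofReal_pow, ← Real.rpow_natCast, ← Real.rpow_mul hs.le,
      add_sub_cancel_right]
  have hint : HasSum (fun j : ℕ => ∫ s in (0 : ℝ)..t, (((t - s) ^ (ν - 1) : ℝ) : ℂ) *
      ((c * ((s ^ ν : ℝ) : ℂ)) ^ j / Real.Gamma (ν * j + 1)))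
      (∫ s in (0 : ℝ)..t, (((t - s) ^ (ν - 1) : ℝ) : ℂ) * f s) := by
    refine intervalIntegral.hasSum_integral_of_dominated_convergence
      (fun j s => (t - s) ^ (ν - 1) * ‖(c * ((t ^ ν : ℝ) : ℂ)) ^ j / Real.Gamma (ν * j + 1)‖)
      (fun j => ?_) (fun j => Eventually.of_forall fun s hs => ?_)
      (Eventually.of_forall fun s hs => (hf t ht).summable.norm.mul_left _) ?_
      (Eventually.of_forall fun s hs => ?_)
    · refine Measurable.aestronglyMeasurable ?_
      have : Measurable fun s : ℝ => (t - s) ^ (ν - 1) :=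
        (measurable_const.sub measurable_id).pow_const _
      have h3 : Measurable fun s : ℝ => s ^ ν := measurable_id.pow_const _
      fun_prop
    · rw [uIoc_of_le ht.le] at hs
      have h4 : 0 ≤ (t - s) ^ (ν - 1) := Real.rpow_nonneg (by linarith [hs.2]) _
      have h5 : s ^ ν ≤ t ^ ν := Real.rpow_le_rpow hs.1.le hs.2 h0.le
      have h6 : 0 ≤ s ^ ν := Real.rpow_nonneg hs.1.le _
      have h7 : 0 ≤ t ^ ν := h6.trans h5
      simp only [norm_mul, norm_div, norm_pow, Complex.norm_real, Real.norm_of_nonneg h4,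
        Real.norm_of_nonneg h6, Real.norm_of_nonneg h7]
      gcongr
    · simp_rw [tsum_mul_left]
      have := (intervalIntegrable_sub_rpow_mul_rpow h0 one_pos ht)
      simp only [sub_self, Real.rpow_zero, mul_one] at this
      exact this.mul_const _
    · rw [uIoc_of_le ht.le] at hs
      exact (hf s hs.1).mul_left _
  -- The operator c J^ν shifts the series by one index, so that c J^ν f is the series without its
  -- first term 1.
  have hterm : ∀ j : ℕ, c * ((1 / Real.Gamma ν : ℝ) * ∫ s in (0 : ℝ)..t,
      (((t - s) ^ (ν - 1) : ℝ) : ℂ) * ((c * ((s ^ ν : ℝ) : ℂ)) ^ j / Real.Gamma (ν * j + 1))) =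
      (c * ((t ^ ν : ℝ) : ℂ)) ^ (j + 1) / Real.Gamma (ν * ((j + 1 : ℕ) : ℝ) + 1) := fun j => by
    have e1 := fracInt_rpow h0 (show 0 < ν * j + 1 by positivity) ht
    have e2 : ∫ s in (0 : ℝ)..t, (((t - s) ^ (ν - 1) : ℝ) : ℂ) *
        ((c * ((s ^ ν : ℝ) : ℂ)) ^ j / Real.Gamma (ν * j + 1)) =
        c ^ j / Real.Gamma (ν * j + 1) * ∫ s in (0 : ℝ)..t, (((t - s) ^ (ν - 1) : ℝ) : ℂ) *
          ((s ^ (ν * j + 1 - 1) : ℝ) : ℂ) := by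
      rw [← intervalIntegral.integral_const_mul, intervalIntegral.integral_of_le ht.le,
        intervalIntegral.integral_of_le ht.le]
      refine setIntegral_congr_fun measurableSet_Ioc fun s hs => ?_
      simp only [hpow s hs.1 j]
      ring
    rw [fracInt] at e1
    rw [e2, mul_left_comm ((1 / Real.Gamma ν : ℝ) : ℂ), e1, hpow t ht,
      show ν + (ν * j + 1) = ν * ((j + 1 : ℕ) : ℝ) + 1 by push_cast; ring]
    have g1 : (Real.Gamma (ν * j + 1) : ℂ) ≠ 0 := by exact_mod_cast (hG j).ne'
    have g2 : (Real.Gamma (ν * ((j + 1 : ℕ) : ℝ) + 1) : ℂ) ≠ 0 := by exact_mod_cast (hG (j + 1)).ne'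
    rw [Complex.ofReal_mul, Complex.ofReal_div]
    field_simp
    ring
  have hs1 := (hint.mul_left (((1 / Real.Gamma ν : ℝ) : ℂ))).mul_left c
  have hs2 := hs1.congr_eq (fun j => (hterm j).symm) rfl
  have hs3 := (hasSum_nat_add_iff' 1).2 (hf t ht)
  have := hs3.unique hs2
  simp only [Finset.sum_range_one, pow_zero, Nat.cast_zero, mul_zero, zero_add,
    Real.Gamma_one, Complex.ofReal_one, div_one] at this
  rw [sub_eq_iff_eq_add] at this
  rw [this, fracInt]
  ring

lemma norm_derivSymbol (n : ℕ) (ξ : ℝ) : ‖derivSymbol n ξ‖ = (2 * Real.pi) ^ n * |ξ| ^ n := by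
  rw [derivSymbol, norm_pow, ← mul_pow]
  simp [abs_of_pos Real.pi_pos]

lemma derivSymbol_two_mul (q : ℕ) (ξ : ℝ) :
    derivSymbol (2 * q) ξ = (((-1) ^ q * (2 * Real.pi * ξ) ^ (2 * q) : ℝ) : ℂ) := by
  have h : (-(2 * (Real.pi : ℂ) * Complex.I * ξ)) ^ 2 = ((-1 * (2 * Real.pi * ξ) ^ 2 : ℝ) : ℂ) := by
    push_cast
    linear_combination (4 * (Real.pi : ℂ) ^ 2 * ξ ^ 2) * Complex.I_sq
  rw [derivSymbol, pow_mul, h, pow_mul, ← mul_pow, Complex.ofReal_pow]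

/-- This is where the choice of k_n enters: for n = 2q the signs combine to -(2πξ)^(2q), and for odd
n the symbol is purely imaginary. -/
lemma re_mul_derivSymbol_nonpos {n : ℕ} {k : ℝ} (hk : IsHeatCoeff n k) (ξ : ℝ) :
    ((k : ℂ) * derivSymbol n ξ).re ≤ 0 := by
  rcases Nat.even_or_odd' n with ⟨q, rfl | rfl⟩
  · rw [hk.1 q rfl, derivSymbol_two_mul, ← Complex.ofReal_mul, Complex.ofReal_re, ← mul_assoc,
      ← pow_add, show q + 1 + q = 2 * q + 1 by ring, pow_succ, pow_mul, pow_mul]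
    norm_num
    positivity
  · rw [derivSymbol, pow_succ, ← derivSymbol, derivSymbol_two_mul, ← mul_assoc,
      ← Complex.ofReal_mul, Complex.re_ofReal_mul]
    simp

section
variable {α : ℝ} (h0 : 0 < α) (h1 : α < 1)

lemma hasDerivAt_mul_rpow (c : ℂ) (a : ℝ) {t : ℝ} (ht : 0 < t) :
    HasDerivAt (fun s : ℝ => c * ((s ^ a : ℝ) : ℂ)) (c * ((a * t ^ (a - 1) : ℝ) : ℂ)) t :=
  ((Real.hasDerivAt_rpow_const (Or.inl ht.ne')).ofReal_comp).const_mul c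

lemma continuousOn_fst_rpow (a : ℝ) :
    ContinuousOn (fun p : ℝ × ℝ => ((p.1 ^ a : ℝ) : ℂ)) (Ioi 0 ×ˢ univ) :=
  Complex.continuous_ofReal.comp_continuousOn
    (continuousOn_fst.rpow_const fun _ hp => Or.inl (ne_of_gt hp.1))

lemma continuous_derivSymbol (n : ℕ) : Continuous (derivSymbol n) := (contDiff_derivSymbol n).continuous

include h0 h1

/-- Existence of the fundamental solution of `∂_t^α u = k ∂_x^n u` for a dissipative symbol. -/
theorem exists_fundamentalSolution_mWrightLaplace {n : ℕ} {k : ℝ}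
    (hre : ∀ ξ, ((k : ℂ) * derivSymbol n ξ).re ≤ 0) :
    ∃ U : ℝ → 𝓢'(ℝ, ℂ), IsFundamentalSolution α n k U ∧ ∀ t, 0 < t → ∀ φ : 𝓢(ℝ, ℂ),
      U t φ = ∫ ξ, (𝓕 φ : 𝓢(ℝ, ℂ)) ξ *
        mWrightLaplace α 0 (k * derivSymbol n ξ * ((t ^ α : ℝ) : ℂ)) := by
  have hceil : ⌈α⌉₊ = 1 := natCeil_of_lt_one h0 h1.le
  have hre' : ∀ t ξ, 0 < t → ((k : ℂ) * derivSymbol n ξ * ((t ^ α : ℝ) : ℂ)).re ≤ 0 :=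
    fun t ξ ht => by
      rw [Complex.re_mul_ofReal]
      exact mul_nonpos_of_nonpos_of_nonneg (hre ξ) (by positivity)
  have hds : Continuous fun p : ℝ × ℝ => derivSymbol n p.2 :=
    (continuous_derivSymbol n).comp continuous_snd
  -- The symbol E_α(k σ t^α) and its time derivative by the chain rule; the derivative has size
  -- t^(α-1) |ξ|^n since the argument stays in Re z ≤ 0.
  set q : ℕ → ℝ → ℝ → ℂ := fun i t ξ =>
    if i = 0 then mWrightLaplace α 0 (k * derivSymbol n ξ * ((t ^ α : ℝ) : ℂ)) else
      mWrightLaplace α 1 (k * derivSymbol n ξ * ((t ^ α : ℝ) : ℂ)) *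
        (k * derivSymbol n ξ * ((α * t ^ (α - 1) : ℝ) : ℂ)) with hq
  have harg : ContinuousOn (fun p : ℝ × ℝ => (k : ℂ) * derivSymbol n p.2 * ((p.1 ^ α : ℝ) : ℂ))
      (Ioi 0 ×ˢ univ) := (continuous_const.mul hds).continuousOn.mul (continuousOn_fst_rpow α)
  set m1 : ℝ := (Nat.factorial 1) / Real.Gamma (α * (1 : ℕ) + 1) with hm1
  have hm1' : 0 ≤ m1 := div_nonneg (by positivity)
    (Real.Gamma_nonneg_of_nonneg (by positivity))
  refine Exists.imp (fun U h => ⟨h.1, fun t ht φ => ?_⟩) <| exists_isFundamentalSolution (ν := α) h0 (by linarith) (n := n) (k := k)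
    (q := q) (C := 1 + m1 * (|k| * (2 * Real.pi) ^ n * α)) (A := n)
    (fun i hi => ?_) (fun i hi t ξ ht => ?_) (fun t ξ ht => ?_) (fun i hi1 hi t ξ ht => ?_)
    (fun t ξ ht => ?_)
  · simpa [hq] using h.2 t ht φ
  · rw [hceil] at hi
    interval_cases i
    · exact (continuous_mWrightLaplace h0 h1 0).comp_continuousOn harg
    · refine ((continuous_mWrightLaplace h0 h1 1).comp_continuousOn harg).mul
        ((continuous_const.mul hds).continuousOn.mul ?_)
      simp only [Complex.ofReal_mul]
      exact continuousOn_const.mul (continuousOn_fst_rpow (α - 1))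
  · rw [hceil, Nat.lt_one_iff] at hi
    subst hi
    exact (hasDerivAt_mWrightLaplace h0 h1 0 _).comp t (hasDerivAt_mul_rpow _ α ht)
  · simp only [hq, if_true]
    refine (norm_mWrightLaplace_le h0 h1 0 (hre' t ξ ht)).trans ?_
    simp only [Nat.factorial_zero, Nat.cast_one, Nat.cast_zero, mul_zero, zero_add,
      Real.Gamma_one, div_one, le_add_iff_nonneg_right]
    have := Real.pi_pos
    positivity
  · have hi' : i = 1 := by omega
    subst hi'
    have hp := Real.pi_pos
    simp only [hq, one_ne_zero, if_false, norm_mul, norm_derivSymbol, Complex.norm_real,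
      Real.norm_eq_abs, Nat.cast_one]
    rw [abs_of_nonneg (show 0 ≤ α by linarith), abs_of_nonneg (show 0 ≤ t ^ (α - 1) by positivity)]
    calc _ ≤ m1 * (|k| * ((2 * Real.pi) ^ n * |ξ| ^ n) * (α * t ^ (α - 1))) := by
          gcongr
          exact norm_mWrightLaplace_le h0 h1 1 (hre' t ξ ht)
      _ = (m1 * (|k| * (2 * Real.pi) ^ n * α)) * t ^ (α - 1) * |ξ| ^ n := by ring
      _ ≤ _ := by
          gcongr
          · linarith
          · linarith
  · simp only [hq, if_true]
    exact eq_one_add_mul_fracInt_of_hasSum h0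
      (fun s _ => hasSum_mWrightLaplace_zero h0 h1 _) ht

/-- Odd powers cancel, leaving E_2α(z²): orders above 1 are reached from a parameter α < 1. -/
lemma hasSum_even_mWrightLaplace (z : ℂ) :
    HasSum (fun j : ℕ => (z ^ 2) ^ j / Real.Gamma (2 * α * j + 1))
      ((mWrightLaplace α 0 z + mWrightLaplace α 0 (-z)) / 2) := by
  have h := ((hasSum_mWrightLaplace_zero h0 h1 z).add
    (hasSum_mWrightLaplace_zero h0 h1 (-z))).div_const 2
  have hinj : Function.Injective fun j : ℕ => 2 * j := fun a b h => by simpa using h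
  rw [← hinj.hasSum_iff] at h
  · refine h.congr_eq (fun j => ?_) rfl
    simp only [Function.comp]
    rw [(even_two_mul j).neg_pow, ← pow_mul]
    push_cast
    rw [show α * (2 * (j : ℝ)) = 2 * α * j by ring]
    ring
  · intro i hi
    have hodd : Odd i := by
      rw [← Nat.not_even_iff_odd]
      rintro ⟨r, hr⟩
      exact hi ⟨r, by simp only; omega⟩
    rw [hodd.neg_pow]
    ring

/-- Existence of the fundamental solution of `∂_t^{2α} v = ∂_x^2 v`. -/
theorem exists_fundamentalSolution_diffusion :
    ∃ U : ℝ → 𝓢'(ℝ, ℂ), IsFundamentalSolution (2 * α) 2 1 U ∧ ∀ t, 0 < t → ∀ φ : 𝓢(ℝ, ℂ),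
      U t φ = ∫ ξ, (𝓕 φ : 𝓢(ℝ, ℂ)) ξ *
        ((mWrightLaplace α 0 (2 * Real.pi * ξ * Complex.I * ((t ^ α : ℝ) : ℂ)) +
          mWrightLaplace α 0 (-(2 * Real.pi * ξ * Complex.I * ((t ^ α : ℝ) : ℂ)))) / 2) := by
  have hceil : ⌈2 * α⌉₊ ≤ 2 := by
    rw [Nat.ceil_le]; push_cast; linarith
  set w : ℝ → ℂ := fun ξ => 2 * Real.pi * ξ * Complex.I with hw
  have hwn : ∀ ξ, ‖w ξ‖ = 2 * Real.pi * |ξ| := fun ξ => by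
    simp [hw, abs_of_pos Real.pi_pos]
  have hwc : Continuous fun p : ℝ × ℝ => w p.2 := by
    simp only [hw]; fun_prop
  set z : ℝ → ℝ → ℂ := fun t ξ => w ξ * ((t ^ α : ℝ) : ℂ) with hz
  have hzre : ∀ t ξ, (z t ξ).re ≤ 0 := fun t ξ => by
    simp [hz, hw]
  have hzre' : ∀ t ξ, (-z t ξ).re ≤ 0 := fun t ξ => by
    simp [hz, hw]
  have hzn : ∀ t ξ, 0 < t → ‖z t ξ‖ = 2 * Real.pi * |ξ| * t ^ α := fun t ξ ht => by
    rw [hz, norm_mul, hwn, Complex.norm_real, Real.norm_of_nonneg (by positivity)]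
  have harg : ContinuousOn (fun p : ℝ × ℝ => z p.1 p.2) (Ioi 0 ×ˢ univ) :=
    hwc.continuousOn.mul (continuousOn_fst_rpow α)
  have hzd : ∀ t ξ, 0 < t → HasDerivAt (fun s => z s ξ) (w ξ * ((α * t ^ (α - 1) : ℝ) : ℂ)) t :=
    fun t ξ ht => hasDerivAt_mul_rpow _ α ht
  set S : ℕ → ℝ → ℝ → ℂ := fun j t ξ =>
    (mWrightLaplace α j (z t ξ) + (-1) ^ j * mWrightLaplace α j (-z t ξ)) / 2 with hS
  have hSc : ∀ j, ContinuousOn (Function.uncurry (S j)) (Ioi 0 ×ˢ univ) := fun j =>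
    (((continuous_mWrightLaplace h0 h1 j).comp_continuousOn harg).add
      (continuousOn_const.mul
        ((continuous_mWrightLaplace h0 h1 j).comp_continuousOn harg.neg))).div_const 2
  have hSd : ∀ j t ξ, 0 < t → HasDerivAt (fun s => S j s ξ)
      (S (j + 1) t ξ * (w ξ * ((α * t ^ (α - 1) : ℝ) : ℂ))) t := fun j t ξ ht => by
    have e := (((hasDerivAt_mWrightLaplace h0 h1 j (z t ξ)).comp t (hzd t ξ ht)).add
      (((hasDerivAt_mWrightLaplace h0 h1 j (-z t ξ)).comp t (hzd t ξ ht).neg).const_mul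
        ((-1 : ℂ) ^ j))).div_const 2
    refine e.congr_deriv ?_
    simp only [hS, pow_succ]
    ring
  set m : ℕ → ℝ := fun j => (j.factorial : ℝ) / Real.Gamma (α * j + 1) with hm
  have hm' : ∀ j, 0 ≤ m j := fun j => div_nonneg (by positivity)
    (Real.Gamma_nonneg_of_nonneg (by positivity))
  have hSb : ∀ j t ξ, ‖S j t ξ‖ ≤ m j := fun j t ξ => by
    simp only [hS, norm_div]
    have h3 := norm_add_le (mWrightLaplace α j (z t ξ)) ((-1) ^ j * mWrightLaplace α j (-z t ξ))
    have h4 := norm_mWrightLaplace_le h0 h1 j (hzre t ξ)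
    have h5 := norm_mWrightLaplace_le h0 h1 j (hzre' t ξ)
    rw [norm_mul, norm_pow, norm_neg, norm_one, one_pow, one_mul] at h3
    rw [Complex.norm_ofNat, div_le_iff₀ two_pos]
    simp only [hm]
    linarith
  -- The first derivative of the even part is a difference of values at z and -z, hence O(|z|) =
  -- O(t^α). This extra factor improves t^(α-1) to the required t^(2α-1), and likewise one order
  -- higher.
  have hS1 : ∀ t ξ, 0 < t → ‖S 1 t ξ‖ ≤ m 2 * (2 * Real.pi * |ξ| * t ^ α) := fun t ξ ht => by
    have h3 := norm_mWrightLaplace_sub_le h0 h1 1 (hzre t ξ) (hzre' t ξ)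
    rw [sub_neg_eq_add, ← two_mul (z t ξ), norm_mul, hzn t ξ ht, Complex.norm_ofNat] at h3
    simp only [hS, norm_div, pow_one, neg_one_mul, ← sub_eq_add_neg]
    rw [Complex.norm_ofNat, div_le_iff₀ two_pos]
    refine h3.trans_eq ?_
    simp only [hm]
    ring
  set q : ℕ → ℝ → ℝ → ℂ := fun i t ξ =>
    if i = 0 then S 0 t ξ else if i = 1 then S 1 t ξ * (w ξ * ((α * t ^ (α - 1) : ℝ) : ℂ)) else
      S 2 t ξ * (w ξ * ((α * t ^ (α - 1) : ℝ) : ℂ)) * (w ξ * ((α * t ^ (α - 1) : ℝ) : ℂ)) +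
        S 1 t ξ * (w ξ * α * (((α - 1) * t ^ (α - 1 - 1) : ℝ) : ℂ)) with hq
  have hp := Real.pi_pos
  have hrc : ∀ a b : ℝ, ContinuousOn (fun p : ℝ × ℝ => w p.2 * ((a * p.1 ^ b : ℝ) : ℂ))
      (Ioi 0 ×ˢ univ) := fun a b => by
    simp only [Complex.ofReal_mul]
    exact hwc.continuousOn.mul (continuousOn_const.mul (continuousOn_fst_rpow b))
  -- One constant for all bounds: the summand 1 serves q 0, the term with α serves q 1, and those
  -- with α² and α|α-1| serve q 2.
  refine Exists.imp (fun U h => ⟨h.1, fun t ht φ => ?_⟩) <| exists_isFundamentalSolution (ν := 2 * α) (by linarith) (by linarith)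
    (n := 2) (k := 1) (q := q) (C := 1 + m 2 * (2 * Real.pi) ^ 2 * (α ^ 2 + α * |α - 1| + α))
    (A := 2) (fun i hi => ?_) (fun i hi t ξ ht => ?_) (fun t ξ ht => ?_)
    (fun i hi1 hi t ξ ht => ?_) (fun t ξ ht => ?_)
  · simpa [hq, hS, hz, hw] using h.2 t ht φ
  · have hi' := hi.trans hceil
    interval_cases i
    · exact hSc 0
    · exact (hSc 1).mul (hrc α (α - 1))
    · refine (((hSc 2).mul (hrc α (α - 1))).mul (hrc α (α - 1))).add ((hSc 1).mul ?_)
      refine (hrc (α * (α - 1)) (α - 1 - 1)).congr fun p _ => ?_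
      simp only
      push_cast
      ring
  · have hi' := hi.trans_le hceil
    interval_cases i
    · exact hSd 0 t ξ ht
    · have e := (hSd 1 t ξ ht).mul ((hasDerivAt_mul_rpow (w ξ * α) (α - 1) ht))
      refine (e.congr_deriv ?_).congr_of_eventuallyEq (Eventually.of_forall fun s => ?_)
      · simp only [hq, Complex.ofReal_mul]
        norm_num
        ring_nf
        simp
      · simp only [hq, Complex.ofReal_mul, Pi.mul_apply]
        norm_num
        ring_nf
        simp
  · simp only [hq, if_true]
    refine (hSb 0 t ξ).trans ?_
    have := hm' 2
    simp only [hm, Nat.factorial_zero, Nat.cast_one, Nat.cast_zero, mul_zero, zero_add,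
      Real.Gamma_one, div_one, le_add_iff_nonneg_right]
    positivity
  · have hi' := hi.trans hceil
    have hm2 := hm' 2
    have e0 : 0 ≤ t ^ (α - 1) := by positivity
    have e1 : 0 ≤ t ^ (α - 1 - 1) := by positivity
    have x1 : |ξ| ^ 2 ≤ 1 + |ξ| ^ 2 := by linarith
    interval_cases i
    · simp only [hq, one_ne_zero, if_false, if_true, norm_mul, hwn, Complex.norm_real,
        Real.norm_eq_abs, Nat.cast_one]
      rw [abs_of_pos h0, abs_of_nonneg e0]
      calc _ ≤ m 2 * (2 * Real.pi * |ξ| * t ^ α) * (2 * Real.pi * |ξ| * (α * t ^ (α - 1))) := by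
            gcongr
            exact hS1 t ξ ht
        _ = (m 2 * (2 * Real.pi) ^ 2 * α) * t ^ (2 * α - 1) * |ξ| ^ 2 := by
            rw [show 2 * α - 1 = α + (α - 1) by ring, Real.rpow_add ht]; ring
        _ ≤ _ := by
            gcongr
            have : 0 ≤ m 2 * (2 * Real.pi) ^ 2 * (α ^ 2 + α * |α - 1|) := by positivity
            linarith
    · simp only [hq, if_false, Nat.cast_ofNat, OfNat.ofNat_ne_zero,
        OfNat.ofNat_ne_one]
      refine (norm_add_le _ _).trans ?_
      simp only [norm_mul, hwn, Complex.norm_real, Real.norm_eq_abs]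
      rw [abs_of_pos h0, abs_of_nonneg e0, abs_of_nonneg e1]
      calc _ ≤ m 2 * (2 * Real.pi * |ξ| * (α * t ^ (α - 1))) *
            (2 * Real.pi * |ξ| * (α * t ^ (α - 1))) + m 2 * (2 * Real.pi * |ξ| * t ^ α) *
            (2 * Real.pi * |ξ| * α * (|α - 1| * t ^ (α - 1 - 1))) := by
            gcongr
            · exact hSb 2 t ξ
            · exact hS1 t ξ ht
        _ = (m 2 * (2 * Real.pi) ^ 2 * (α ^ 2 + α * |α - 1|)) * t ^ (2 * α - 2) * |ξ| ^ 2 := by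
            have r1 : t ^ (α - 1) * t ^ (α - 1) = t ^ (2 * α - 2) := by
              rw [← Real.rpow_add ht]; congr 1; ring
            have r2 : t ^ α * t ^ (α - 1 - 1) = t ^ (2 * α - 2) := by
              rw [← Real.rpow_add ht]; congr 1; ring
            linear_combination (m 2 * (2 * Real.pi) ^ 2 * α ^ 2 * |ξ| ^ 2) * r1 +
              (m 2 * (2 * Real.pi) ^ 2 * α * |α - 1| * |ξ| ^ 2) * r2
        _ ≤ _ := by
            gcongr
            have : 0 ≤ m 2 * (2 * Real.pi) ^ 2 * α := by positivity
            linarith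
  · simp only [hq, if_true]
    rw [Complex.ofReal_one, one_mul]
    refine eq_one_add_mul_fracInt_of_hasSum (by linarith) (f := fun s => S 0 s ξ)
      (fun s hs => ?_) ht
    refine (hasSum_even_mWrightLaplace h0 h1 (z s ξ)).congr_eq (fun j => ?_) ?_
    · congr 2
      simp only [hz, hw, derivSymbol]
      rw [show 2 * α = α * 2 by ring, Real.rpow_mul hs.le]
      rw [Real.rpow_ofNat]
      push_cast
      ring
    · simp [hS]

end

end FracHeat

namespace FracHeat

/-! ### Oscillatory integrals -/

section VanDerCorput

variable {f f' f'' : ℝ → ℝ} {a b l : ℝ}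

/-- First derivative test for oscillatory integrals. -/
lemma norm_integral_cexp_le_of_le_abs_deriv (hf : ∀ z, HasDerivAt f (f' z) z)
    (hf' : ∀ z, HasDerivAt f' (f'' z) z) (hf'' : Continuous f'') (hab : a ≤ b) (hl : 0 < l)
    (h1 : ∀ z ∈ Icc a b, l ≤ |f' z|) (h2 : ∀ z ∈ Icc a b, 0 ≤ f'' z) :
    ‖∫ z in a..b, Complex.exp (Complex.I * f z)‖ ≤ 4 / l := by
  have hcf : Continuous f := continuous_iff_continuousAt.2 fun z => (hf z).continuousAt
  have hcf' : Continuous f' := continuous_iff_continuousAt.2 fun z => (hf' z).continuousAt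
  have hne : ∀ z ∈ uIcc a b, f' z ≠ 0 := fun z hz => by
    rw [uIcc_of_le hab] at hz
    exact abs_pos.1 (hl.trans_le (h1 z hz))
  have hne' : ∀ z ∈ uIcc a b, (f' z : ℂ) ≠ 0 := fun z hz => by exact_mod_cast hne z hz
  set E : ℝ → ℂ := fun z => Complex.exp (Complex.I * f z) with hE
  have hEn : ∀ z, ‖E z‖ = 1 := fun z => by
    simp only [hE]; rw [mul_comm]; exact Complex.norm_exp_ofReal_mul_I _
  have hEc : Continuous E := by simp only [hE]; fun_prop
  -- Integration by parts: E/(i f') has derivative E - g. Since f'' ≥ 0, |g| = f''/f'^2 is the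
  -- derivative of -1/f', so g costs at most 2/l, as do the boundary terms.
  set g : ℝ → ℂ := fun z => E z * (f'' z / (Complex.I * (f' z : ℂ) ^ 2)) with hg
  have hgc : ContinuousOn g (uIcc a b) := by
    refine hEc.continuousOn.mul (ContinuousOn.div ?_ ?_ fun z hz => ?_)
    · exact (Complex.continuous_ofReal.comp hf'').continuousOn
    · exact (continuous_const.mul ((Complex.continuous_ofReal.comp hcf').pow 2)).continuousOn
    · exact mul_ne_zero Complex.I_ne_zero (pow_ne_zero _ (hne' z hz))
  have hF : ∀ z ∈ uIcc a b, HasDerivAt (fun z => E z / (Complex.I * f' z)) (E z - g z) z := by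
    intro z hz
    have d1 : HasDerivAt E (E z * (Complex.I * f' z)) z :=
      ((hf z).ofReal_comp.const_mul Complex.I).cexp
    have d2 : HasDerivAt (fun z => Complex.I * (f' z : ℂ)) (Complex.I * f'' z) z :=
      (hf' z).ofReal_comp.const_mul Complex.I
    refine (d1.div d2 (mul_ne_zero Complex.I_ne_zero (hne' z hz))).congr_deriv ?_
    have := hne' z hz
    have hI := Complex.I_ne_zero
    simp only [hg]
    field_simp
  have hH : ∀ z ∈ uIcc a b, HasDerivAt (fun z => -(f' z)⁻¹) (f'' z / f' z ^ 2) z := by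
    intro z hz
    refine ((hf' z).inv (hne z hz)).neg.congr_deriv ?_
    ring
  have hgr : ContinuousOn (fun z => f'' z / f' z ^ 2) (uIcc a b) :=
    hf''.continuousOn.div (hcf'.pow 2).continuousOn fun z hz => pow_ne_zero _ (hne z hz)
  have i1 : IntervalIntegrable E volume a b := hEc.intervalIntegrable _ _
  have i2 : IntervalIntegrable g volume a b := hgc.intervalIntegrable
  have e1 := intervalIntegral.integral_eq_sub_of_hasDerivAt hF (i1.sub i2)
  rw [intervalIntegral.integral_sub i1 i2, sub_eq_iff_eq_add] at e1
  have e2 := intervalIntegral.integral_eq_sub_of_hasDerivAt hH hgr.intervalIntegrable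
  have e3 : ‖∫ z in a..b, g z‖ ≤ ∫ z in a..b, f'' z / f' z ^ 2 := by
    refine intervalIntegral.norm_integral_le_of_norm_le hab
      (Eventually.of_forall fun z hz => ?_) hgr.intervalIntegrable
    have := h2 z ⟨hz.1.le, hz.2⟩
    simp only [hg, norm_mul, hEn, norm_div, norm_pow, Complex.norm_real, Complex.norm_I, one_mul,
      Real.norm_eq_abs, sq_abs, abs_of_nonneg this]
    exact le_rfl
  have e4 : ∀ z ∈ Icc a b, ‖E z / (Complex.I * f' z)‖ ≤ 1 / l := fun z hz => by
    rw [norm_div, hEn, norm_mul, Complex.norm_I, one_mul, Complex.norm_real]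
    exact one_div_le_one_div_of_le hl (h1 z hz)
  have e5 : ∀ z ∈ Icc a b, |(f' z)⁻¹| ≤ 1 / l := fun z hz => by
    rw [abs_inv, ← one_div]
    exact one_div_le_one_div_of_le hl (h1 z hz)
  have ma := left_mem_Icc.2 hab
  have mb := right_mem_Icc.2 hab
  have e6 : ∫ z in a..b, f'' z / f' z ^ 2 ≤ 2 / l := by
    rw [e2]
    have := abs_le.1 (e5 a ma)
    have := abs_le.1 (e5 b mb)
    have : (2 : ℝ) / l = 1 / l + 1 / l := by ring
    linarith
  rw [e1]
  calc _ ≤ ‖E b / (Complex.I * f' b) - E a / (Complex.I * f' a)‖ + ‖∫ z in a..b, g z‖ :=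
        norm_add_le _ _
    _ ≤ (1 / l + 1 / l) + 2 / l := by
        gcongr
        · exact (norm_sub_le _ _).trans (add_le_add (e4 b mb) (e4 a ma))
        · exact e3.trans e6
    _ = _ := by ring

lemma norm_integral_cexp_le_sub (hab : a ≤ b) :
    ‖∫ z in a..b, Complex.exp (Complex.I * f z)‖ ≤ b - a := by
  have := intervalIntegral.norm_integral_le_of_norm_le_const (C := 1) (a := a) (b := b)
    (f := fun z => Complex.exp (Complex.I * f z)) fun z _ => by
      rw [mul_comm]; exact (Complex.norm_exp_ofReal_mul_I _).le
  rwa [one_mul, abs_of_nonneg (by linarith)] at this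

/-- Second derivative test for oscillatory integrals. -/
lemma norm_integral_cexp_le_of_le_deriv_deriv (hf : ∀ z, HasDerivAt f (f' z) z)
    (hf' : ∀ z, HasDerivAt f' (f'' z) z) (hf'' : Continuous f'') (hab : a ≤ b) (hl : 0 < l)
    (h2 : ∀ z ∈ Icc a b, l ≤ f'' z) :
    ‖∫ z in a..b, Complex.exp (Complex.I * f z)‖ ≤ 10 / √l := by
  have hcf : Continuous f := continuous_iff_continuousAt.2 fun z => (hf z).continuousAt
  have hcf' : Continuous f' := continuous_iff_continuousAt.2 fun z => (hf' z).continuousAt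
  have hmv : ∀ x ∈ Icc a b, ∀ y ∈ Icc a b, x ≤ y → l * (y - x) ≤ f' y - f' x := by
    intro x hx y hy hxy
    refine (convex_Icc a b).mul_sub_le_image_sub_of_le_deriv hcf'.continuousOn
      (fun z _ => (hf' z).differentiableAt.differentiableWithinAt) (fun z hz => ?_) x hx y hy hxy
    rw [(hf' z).deriv]
    exact h2 z (interior_subset hz)
  -- The derivative f' is increasing; m is a zero of it, or the endpoint closest to vanishing if it
  -- keeps its sign.
  obtain ⟨m, hm, hm1, hm2⟩ : ∃ m ∈ Icc a b, (m = b ∨ 0 ≤ f' m) ∧ (m = a ∨ f' m ≤ 0) := by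
    rcases le_or_gt 0 (f' a) with h | h
    · exact ⟨a, left_mem_Icc.2 hab, Or.inr h, Or.inl rfl⟩
    rcases le_or_gt (f' b) 0 with h' | h'
    · exact ⟨b, right_mem_Icc.2 hab, Or.inl rfl, Or.inr h'⟩
    obtain ⟨m, hm, hm0⟩ := intermediate_value_Icc hab hcf'.continuousOn ⟨h.le, h'.le⟩
    exact ⟨m, hm, Or.inr hm0.ge, Or.inr hm0.le⟩
  have hs : 0 < √l := Real.sqrt_pos.2 hl
  have hss : √l * √l = l := Real.mul_self_sqrt hl.le
  -- This width balances the trivial bound 2d near m against the first derivative test with |f'| ≥ l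
  -- d = √l on both sides: 2 + 4 + 4 = 10.
  set d := 1 / √l with hd
  have hd0 : 0 < d := by positivity
  have hld : l * d = √l := by rw [hd]; field_simp; rw [sq, hss]
  have h20 : ∀ z ∈ Icc a b, 0 ≤ f'' z := fun z hz => hl.le.trans (h2 z hz)
  set c₁ := max a (m - d) with hc₁
  set c₂ := min b (m + d) with hc₂
  have o1 : a ≤ c₁ := le_max_left _ _
  have o2 : c₁ ≤ m := max_le hm.1 (by linarith)
  have o3 : m ≤ c₂ := le_min hm.2 (by linarith)
  have o4 : c₂ ≤ b := min_le_left _ _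
  have p1 : ‖∫ z in a..c₁, Complex.exp (Complex.I * f z)‖ ≤ 4 / √l := by
    rcases le_total (m - d) a with h | h
    · rw [hc₁, max_eq_left h, intervalIntegral.integral_same, norm_zero]; positivity
    · refine norm_integral_cexp_le_of_le_abs_deriv hf hf' hf'' o1 hs (fun z hz => ?_)
        fun z hz => h20 z ⟨hz.1, hz.2.trans (o2.trans hm.2)⟩
      have hz2 : z ≤ m - d := by rw [hc₁, max_eq_right h] at hz; exact hz.2
      have := hmv z ⟨hz.1, hz.2.trans (o2.trans hm.2)⟩ m hm (by linarith)
      have hm3 : f' m ≤ 0 := hm2.resolve_left (by rintro rfl; linarith [hz.1])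
      have : l * d ≤ l * (m - z) := by gcongr; linarith
      exact le_abs.2 (Or.inr (by linarith))
  have p3 : ‖∫ z in c₂..b, Complex.exp (Complex.I * f z)‖ ≤ 4 / √l := by
    rcases le_total b (m + d) with h | h
    · rw [hc₂, min_eq_left h, intervalIntegral.integral_same, norm_zero]; positivity
    · refine norm_integral_cexp_le_of_le_abs_deriv hf hf' hf'' o4 hs (fun z hz => ?_)
        fun z hz => h20 z ⟨(hm.1.trans o3).trans hz.1, hz.2⟩
      have hz2 : m + d ≤ z := by rw [hc₂, min_eq_right h] at hz; exact hz.1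
      have := hmv m hm z ⟨(hm.1.trans o3).trans hz.1, hz.2⟩ (by linarith)
      have hm3 : 0 ≤ f' m := hm1.resolve_left (by rintro rfl; linarith [hz.2])
      have : l * d ≤ l * (z - m) := by gcongr; linarith
      exact le_abs.2 (Or.inl (by linarith))
  have p2 : ‖∫ z in c₁..c₂, Complex.exp (Complex.I * f z)‖ ≤ 2 / √l := by
    refine (norm_integral_cexp_le_sub (o2.trans o3)).trans ?_
    have q1 : m - d ≤ c₁ := le_max_right _ _
    have q2 : c₂ ≤ m + d := min_le_right _ _
    have : (2 : ℝ) / √l = d + d := by rw [hd]; ring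
    linarith
  have hi : ∀ x y : ℝ, IntervalIntegrable (fun z => Complex.exp (Complex.I * f z)) volume x y :=
    fun x y => Continuous.intervalIntegrable (by fun_prop) _ _
  rw [← intervalIntegral.integral_add_adjacent_intervals (hi a c₁) (hi c₁ b),
    ← intervalIntegral.integral_add_adjacent_intervals (hi c₁ c₂) (hi c₂ b)]
  calc _ ≤ 4 / √l + (2 / √l + 4 / √l) :=
        (norm_add_le _ _).trans (add_le_add p1 ((norm_add_le _ _).trans (add_le_add p2 p3)))
    _ = _ := by ring

end VanDerCorput

/-! ### The kernel `p_n` -/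

/-- The second derivative of the phase is t n(n-1) z^(n-2) ≥ tR for z ≥ R ≥ 1 and n ≥ 3. The linear
term does not enter it, whence uniformity in x. -/
lemma norm_integral_cexp_mul_add_pow_le {n : ℕ} (hn : 3 ≤ n) (x : ℝ) {t R b : ℝ} (ht : 0 < t)
    (hR : 1 ≤ R) (hRb : R ≤ b) :
    ‖∫ z in R..b, Complex.exp (Complex.I * ((x * z + t * z ^ n : ℝ) : ℂ))‖ ≤ 10 / √(t * R) := by
  obtain ⟨m, rfl⟩ : ∃ m, n = m + 3 := ⟨n - 3, by omega⟩
  refine norm_integral_cexp_le_of_le_deriv_deriv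
    (f' := fun z => x + t * ((m + 3 : ℕ) * z ^ (m + 2)))
    (f'' := fun z => t * ((m + 3 : ℕ) * ((m + 2 : ℕ) * z ^ (m + 1))))
    (fun z => ?_) (fun z => ?_) (by fun_prop) hRb (by positivity) (fun z hz => ?_)
  · have := ((hasDerivAt_id z).const_mul x).add ((hasDerivAt_pow (m + 3) z).const_mul t)
    exact this.congr_deriv (by simp)
  · have := (((hasDerivAt_pow (m + 2) z).const_mul ((m + 3 : ℕ) : ℝ)).const_mul t).const_add x
    simpa using this
  · have hz1 : 1 ≤ z := hR.trans hz.1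
    have h1 : z ≤ z ^ (m + 1) := le_self_pow₀ hz1 (by omega)
    have h2 : (1 : ℝ) ≤ ((m + 3 : ℕ) : ℝ) := by push_cast; linarith [(m.cast_nonneg : (0:ℝ) ≤ m)]
    have h3 : (1 : ℝ) ≤ ((m + 2 : ℕ) : ℝ) := by push_cast; linarith [(m.cast_nonneg : (0:ℝ) ≤ m)]
    gcongr
    calc R ≤ 1 * (1 * z ^ (m + 1)) := by linarith [hz.1]
      _ ≤ _ := by gcongr

/-- The negative sign reduces to the positive one by complex conjugation and x ↦ -x. -/
lemma norm_integral_cexp_mul_add_pow_le' {n : ℕ} (hn : 3 ≤ n) (x : ℝ) {s t R b : ℝ} (ht : 0 < t)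
    (hs : s = 1 ∨ s = -1) (hR : 1 ≤ R) (hRb : R ≤ b) :
    ‖∫ z in R..b, Complex.exp (Complex.I * ((x * z + s * t * z ^ n : ℝ) : ℂ))‖ ≤
      10 / √(t * R) := by
  rcases hs with rfl | rfl
  · simpa using norm_integral_cexp_mul_add_pow_le hn x ht hR hRb
  · have h := norm_integral_cexp_mul_add_pow_le hn (-x) ht hR hRb
    rw [← Complex.norm_conj, ← intervalIntegral.intervalIntegral_conj] at h
    refine (congrArg norm (congrArg (fun g => ∫ z in R..b, g z) (funext fun z => ?_))).trans_le h
    rw [← Complex.exp_conj]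
    simp only [map_mul, Complex.conj_I, Complex.conj_ofReal]
    push_cast
    ring_nf

end FracHeat

namespace FracHeat

lemma continuous_heatIntegrand (n : ℕ) (k : ℝ) :
    Continuous fun p : (ℝ × ℝ) × ℝ => heatIntegrand n k p.1.1 p.1.2 p.2 := by
  unfold heatIntegrand; fun_prop

lemma intervalIntegrable_heatIntegrand (n : ℕ) (k x t a b : ℝ) :
    IntervalIntegrable (heatIntegrand n k x t) volume a b :=
  Continuous.intervalIntegrable (by unfold heatIntegrand; fun_prop) _ _

lemma heatIntegrand_neg (n : ℕ) (k x t z : ℝ) :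
    heatIntegrand n k x t (-z) = heatIntegrand n ((-1) ^ n * k) (-x) t z := by
  unfold heatIntegrand
  congr 1
  push_cast
  rw [show Complex.I * -(z : ℂ) = -1 * (Complex.I * z) by ring, mul_pow]
  ring

/-- The reflection z ↦ -z replaces k by (-1)^n k and x by -x; admissibility of the new coefficient
lets estimates at +∞ serve at -∞. -/
lemma IsHeatCoeff.neg_one_pow_mul {n : ℕ} {k : ℝ} (hk : IsHeatCoeff n k) :
    IsHeatCoeff n ((-1) ^ n * k) := by
  constructor
  · rintro q rfl
    rw [pow_mul, neg_one_sq, one_pow, one_mul]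
    exact hk.1 q rfl
  · rintro q rfl
    rw [pow_succ, pow_mul, neg_one_sq, one_pow, one_mul]
    rcases hk.2 q rfl with rfl | rfl <;> simp

lemma heatIntegrand_two_mul {q : ℕ} {k : ℝ} (hk : IsHeatCoeff (2 * q) k) (x t z : ℝ) :
    heatIntegrand (2 * q) k x t z =
      Complex.exp (Complex.I * x * z + ((-(t * z ^ (2 * q)) : ℝ) : ℂ)) := by
  rw [heatIntegrand, hk.1 q rfl]
  congr 2
  rw [mul_pow, pow_mul Complex.I, Complex.I_sq]
  push_cast
  have h : ((-1 : ℂ) ^ q) * (-1) ^ q = 1 := by rw [← mul_pow]; simp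
  linear_combination (-(t : ℂ) * z ^ (2 * q)) * h

lemma norm_heatIntegrand_two_mul {q : ℕ} {k : ℝ} (hk : IsHeatCoeff (2 * q) k) (x t z : ℝ) :
    ‖heatIntegrand (2 * q) k x t z‖ = Real.exp (-(t * z ^ (2 * q))) := by
  rw [heatIntegrand_two_mul hk, Complex.norm_exp, Complex.add_re, Complex.ofReal_re]
  simp

lemma exists_heatIntegrand_two_mul_add_one {q : ℕ} {k : ℝ} (hk : IsHeatCoeff (2 * q + 1) k) :
    ∃ s : ℝ, (s = 1 ∨ s = -1) ∧ ∀ x t z, heatIntegrand (2 * q + 1) k x t z =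
      Complex.exp (Complex.I * ((x * z + s * t * z ^ (2 * q + 1) : ℝ) : ℂ)) := by
  refine ⟨k * (-1) ^ q, ?_, fun x t z => ?_⟩
  · rcases hk.2 q rfl with rfl | rfl <;> rcases neg_one_pow_eq_or ℝ q with h | h <;> simp [h]
  · rw [heatIntegrand]
    congr 1
    rw [mul_pow, pow_succ Complex.I, pow_mul, Complex.I_sq]
    push_cast
    ring

lemma exp_neg_mul_pow_le {q : ℕ} (hq : 1 ≤ q) {t : ℝ} (ht : 0 < t) (z : ℝ) :
    Real.exp (-(t * z ^ (2 * q))) ≤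
      (Icc (-1 : ℝ) 1).indicator (fun _ => 1) z + Real.exp (-t * z ^ 2) := by
  by_cases hz : z ∈ Icc (-1 : ℝ) 1
  · rw [indicator_of_mem hz]
    have : Real.exp (-(t * z ^ (2 * q))) ≤ 1 := Real.exp_le_one_iff.2 (by
      have : 0 ≤ z ^ (2 * q) := by rw [pow_mul]; positivity
      nlinarith)
    linarith [Real.exp_pos (-t * z ^ 2)]
  · rw [indicator_of_notMem hz, zero_add, neg_mul]
    have h1 : 1 ≤ z ^ 2 := by
      rw [← sq_abs]
      have : 1 ≤ |z| := by
        by_contra h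
        exact hz (abs_le.1 (not_le.1 h).le)
      nlinarith
    have h2 : z ^ 2 ≤ z ^ (2 * q) := by
      rw [pow_mul]
      exact le_self_pow₀ h1 (by omega)
    exact Real.exp_le_exp.2 (neg_le_neg (mul_le_mul_of_nonneg_left h2 ht.le))

lemma integrable_indicator_add_exp {t : ℝ} (ht : 0 < t) :
    Integrable fun z : ℝ => (Icc (-1 : ℝ) 1).indicator (fun _ => (1 : ℝ)) z +
      Real.exp (-t * z ^ 2) :=
  ((integrable_indicator_iff measurableSet_Icc).2 (integrableOn_const (by simp))).add
    (integrable_exp_neg_mul_sq ht)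

lemma integral_indicator_add_exp {t : ℝ} (ht : 0 < t) :
    ∫ z : ℝ, (Icc (-1 : ℝ) 1).indicator (fun _ => (1 : ℝ)) z + Real.exp (-t * z ^ 2) =
      2 + √(Real.pi / t) := by
  rw [integral_add ((integrable_indicator_iff measurableSet_Icc).2 (integrableOn_const (by simp)))
    (integrable_exp_neg_mul_sq ht), integral_gaussian, integral_indicator measurableSet_Icc]
  simp
  norm_num

/-- The integrals of the integrand of `p_n` far out are small, uniformly in `x`. -/
lemma exists_norm_integral_heatIntegrand_le_of_le {n : ℕ} (hn : 2 ≤ n) {k : ℝ}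
    (hk : IsHeatCoeff n k) {t : ℝ} (ht : 0 < t) {ε : ℝ} (hε : 0 < ε) :
    ∃ R : ℝ, ∀ x a b, R ≤ a → a ≤ b → ‖∫ z in a..b, heatIntegrand n k x t z‖ ≤ ε := by
  rcases Nat.even_or_odd' n with ⟨q, rfl | rfl⟩
  · set g : ℝ → ℝ := fun z => (Icc (-1 : ℝ) 1).indicator (fun _ => (1 : ℝ)) z +
      Real.exp (-t * z ^ 2) with hg
    have hgi : Integrable g := integrable_indicator_add_exp ht
    have hg0 : ∀ z, 0 ≤ g z := fun z =>
      (Real.exp_pos _).le.trans (exp_neg_mul_pow_le (q := q) (by omega) ht z)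
    have h1 : Tendsto (fun b => ∫ z in (0 : ℝ)..b, g z) atTop (𝓝 (∫ z in Ioi 0, g z)) :=
      intervalIntegral_tendsto_integral_Ioi 0 hgi.integrableOn tendsto_id
    have h2 := (h1.cauchySeq)
    obtain ⟨R, hR⟩ := Metric.cauchySeq_iff.1 h2 ε hε
    refine ⟨R, fun x a b ha hab => ?_⟩
    have h3 := (hR b (ha.trans hab) a ha).le
    rw [dist_eq_norm, intervalIntegral.integral_interval_sub_left hgi.intervalIntegrable
      hgi.intervalIntegrable] at h3
    refine le_trans ?_ ((le_abs_self _).trans h3)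
    refine intervalIntegral.norm_integral_le_of_norm_le hab (Eventually.of_forall fun z _ => ?_)
      hgi.intervalIntegrable
    rw [norm_heatIntegrand_two_mul hk]
    exact exp_neg_mul_pow_le (by omega) ht z
  · obtain ⟨s, hs, he⟩ := exists_heatIntegrand_two_mul_add_one hk
    -- Chosen so that 10/√(tR) ≤ ε.
    refine ⟨max 1 ((10 / ε) ^ 2 / t), fun x a b ha hab => ?_⟩
    simp_rw [he]
    have ha1 : 1 ≤ a := (le_max_left _ _).trans ha
    refine (norm_integral_cexp_mul_add_pow_le' (by omega) x ht hs ha1 hab).trans ?_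
    have h2 : (10 / ε) ^ 2 ≤ t * a := by
      have := (le_max_right _ _).trans ha
      rw [div_le_iff₀ ht] at this
      linarith
    have h3 : 10 / ε ≤ √(t * a) := Real.le_sqrt_of_sq_le h2
    have h4 : 0 < √(t * a) := Real.sqrt_pos.2 (by positivity)
    rw [div_le_iff₀ hε] at h3
    rw [div_le_iff₀ h4]
    linarith

/-- The integrals of the integrand of `p_n` are `O(1 + t^{-1/2})`, uniformly in `x`. -/
lemma norm_integral_zero_heatIntegrand_le {n : ℕ} (hn : 2 ≤ n) {k : ℝ}
    (hk : IsHeatCoeff n k) : ∀ x t b, 0 < t → 0 ≤ b →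
      ‖∫ z in (0 : ℝ)..b, heatIntegrand n k x t z‖ ≤ 10 * (1 + t ^ (-(1 / 2) : ℝ)) := by
  intro x t b ht hb
  have hsq : t ^ (-(1 / 2) : ℝ) = 1 / √t := by
    rw [Real.rpow_neg ht.le, Real.sqrt_eq_rpow, one_div, one_div]
  have hst : 0 < √t := Real.sqrt_pos.2 ht
  rw [hsq]
  rcases Nat.even_or_odd' n with ⟨q, rfl | rfl⟩
  · have hgi := integrable_indicator_add_exp ht
    have h1 : ‖∫ z in (0 : ℝ)..b, heatIntegrand (2 * q) k x t z‖ ≤ ∫ z in (0 : ℝ)..b,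
        ((Icc (-1 : ℝ) 1).indicator (fun _ => (1 : ℝ)) z + Real.exp (-t * z ^ 2)) := by
      refine intervalIntegral.norm_integral_le_of_norm_le hb (Eventually.of_forall fun z _ => ?_)
        hgi.intervalIntegrable
      rw [norm_heatIntegrand_two_mul hk]
      exact exp_neg_mul_pow_le (by omega) ht z
    have h2 : ∫ z in (0 : ℝ)..b,
        ((Icc (-1 : ℝ) 1).indicator (fun _ => (1 : ℝ)) z + Real.exp (-t * z ^ 2)) ≤
        2 + √(Real.pi / t) := by
      rw [← integral_indicator_add_exp ht, intervalIntegral.integral_of_le hb]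
      exact setIntegral_le_integral hgi (Eventually.of_forall fun z =>
        (Real.exp_pos _).le.trans (exp_neg_mul_pow_le (q := q) (by omega) ht z))
    have h3 : √(Real.pi / t) ≤ 10 * (1 / √t) := by
      rw [Real.sqrt_div Real.pi_pos.le, mul_one_div]
      gcongr
      rw [Real.sqrt_le_left (by norm_num)]
      linarith [Real.pi_le_four]
    linarith
  · obtain ⟨s, hs, he⟩ := exists_heatIntegrand_two_mul_add_one hk
    have hp : 0 < 1 / √t := by positivity
    rcases le_total b 1 with h | h
    · have h1 : ‖∫ z in (0 : ℝ)..b, heatIntegrand (2 * q + 1) k x t z‖ ≤ b - 0 := by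
        simp_rw [he]
        exact norm_integral_cexp_le_sub hb
      linarith
    · rw [← intervalIntegral.integral_add_adjacent_intervals (b := 1)
        (intervalIntegrable_heatIntegrand _ _ _ _ _ _) (intervalIntegrable_heatIntegrand _ _ _ _ _ _)]
      have h1 : ‖∫ z in (0 : ℝ)..1, heatIntegrand (2 * q + 1) k x t z‖ ≤ 1 - 0 := by
        simp_rw [he]
        exact norm_integral_cexp_le_sub zero_le_one
      have h2 : ‖∫ z in (1 : ℝ)..b, heatIntegrand (2 * q + 1) k x t z‖ ≤ 10 / √t := by
        simp_rw [he]
        simpa using norm_integral_cexp_mul_add_pow_le' (n := 2 * q + 1) (by omega) x ht hs le_rfl h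
      refine (norm_add_le _ _).trans ?_
      have : 10 / √t = 10 * (1 / √t) := by ring
      linarith

lemma integral_neg_heatIntegrand (n : ℕ) (k x t a b : ℝ) :
    ∫ z in (-b)..(-a), heatIntegrand n k x t z =
      ∫ z in a..b, heatIntegrand n ((-1) ^ n * k) (-x) t z := by
  rw [← intervalIntegral.integral_comp_neg]
  simp_rw [heatIntegrand_neg]

section HeatKernel
variable {n : ℕ} (hn : 2 ≤ n) {k : ℝ} (hk : IsHeatCoeff n k)
include hn hk

lemma norm_integral_heatIntegrand_le (x a : ℝ) {t b : ℝ} (ht : 0 < t) :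
    ‖∫ z in a..b, heatIntegrand n k x t z‖ ≤ 20 * (1 + t ^ (-(1 / 2) : ℝ)) := by
  have h1 : ∀ b, ‖∫ z in (0 : ℝ)..b, heatIntegrand n k x t z‖ ≤
      10 * (1 + t ^ (-(1 / 2) : ℝ)) := fun b => by
    rcases le_total 0 b with h | h
    · exact norm_integral_zero_heatIntegrand_le hn hk x t b ht h
    · have := integral_neg_heatIntegrand n k x t 0 (-b)
      rw [neg_neg, neg_zero] at this
      rw [intervalIntegral.integral_symm, norm_neg, this]
      exact norm_integral_zero_heatIntegrand_le hn hk.neg_one_pow_mul _ t _ ht (by linarith)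
  rw [← intervalIntegral.integral_interval_sub_left (a := 0)
    (intervalIntegrable_heatIntegrand _ _ _ _ _ _) (intervalIntegrable_heatIntegrand _ _ _ _ _ _)]
  refine (norm_sub_le _ _).trans ?_
  linarith [h1 a, h1 b]

lemma exists_norm_integral_sub_le {t : ℝ} (ht : 0 < t) {ε : ℝ} (hε : 0 < ε) :
    ∃ R : ℝ, ∀ x a b a' b', a ≤ -R → R ≤ b → a' ≤ -R → R ≤ b' →
      ‖(∫ z in a..b, heatIntegrand n k x t z) - ∫ z in a'..b', heatIntegrand n k x t z‖ ≤ ε := by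
  obtain ⟨R₁, hR₁⟩ := exists_norm_integral_heatIntegrand_le_of_le hn hk ht (half_pos hε)
  obtain ⟨R₂, hR₂⟩ := exists_norm_integral_heatIntegrand_le_of_le hn hk.neg_one_pow_mul ht
    (half_pos hε)
  have g1 : ∀ x a b, R₁ ≤ a → R₁ ≤ b → ‖∫ z in a..b, heatIntegrand n k x t z‖ ≤ ε / 2 :=
    fun x a b ha hb => by
      rcases le_total a b with h | h
      · exact hR₁ x a b ha h
      · rw [intervalIntegral.integral_symm, norm_neg]; exact hR₁ x b a hb h
  have g2 : ∀ x a b, a ≤ -R₂ → b ≤ -R₂ → ‖∫ z in a..b, heatIntegrand n k x t z‖ ≤ ε / 2 :=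
    fun x a b ha hb => by
      have := integral_neg_heatIntegrand n k x t (-b) (-a)
      rw [neg_neg, neg_neg] at this
      rw [this]
      rcases le_total (-b) (-a) with h | h
      · exact hR₂ _ _ _ (by linarith) h
      · rw [intervalIntegral.integral_symm, norm_neg]; exact hR₂ _ _ _ (by linarith) h
  refine ⟨max R₁ R₂, fun x a b a' b' ha hb ha' hb' => ?_⟩
  have m1 := le_max_left R₁ R₂
  have m2 := le_max_right R₁ R₂
  have hi := intervalIntegrable_heatIntegrand n k x t
  rw [intervalIntegral.integral_interval_sub_interval_comm' (hi _ _) (hi _ _) (hi _ _)]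
  refine (norm_sub_le _ _).trans ?_
  linarith [g1 x b' b (by linarith) (by linarith), g2 x a' a (by linarith) (by linarith)]

/-- The improper integral defining `p_n` converges, for symmetric intervals uniformly in `x`. -/
lemma exists_tendsto_heatKernelTrunc {t : ℝ} (ht : 0 < t) :
    ∃ p : ℝ → ℂ, (∀ x, Tendsto (heatKernelTrunc n k x t) (atBot ×ˢ atTop) (𝓝 (p x))) ∧
      TendstoUniformly (fun (N : ℕ) x => heatKernelTrunc n k x t (-N, N)) p atTop := by
  set c : ℂ := ((1 / (2 * Real.pi) : ℝ) : ℂ) with hc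
  have hc1 : ‖c‖ ≤ 1 := by
    rw [hc, Complex.norm_real, Real.norm_of_nonneg (by positivity), div_le_one (by positivity)]
    linarith [Real.pi_gt_three]
  have hsub : ∀ ε > 0, ∃ R : ℝ, ∀ x a b a' b', a ≤ -R → R ≤ b → a' ≤ -R → R ≤ b' →
      ‖heatKernelTrunc n k x t (a, b) - heatKernelTrunc n k x t (a', b')‖ ≤ ε := fun ε hε => by
    obtain ⟨R, hR⟩ := exists_norm_integral_sub_le hn hk ht hε
    refine ⟨R, fun x a b a' b' h1 h2 h3 h4 => ?_⟩
    rw [heatKernelTrunc, heatKernelTrunc, ← mul_sub, norm_mul]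
    calc _ ≤ 1 * ε := by
          gcongr
          exact hR x a b a' b' h1 h2 h3 h4
      _ = ε := one_mul ε
  have hcauchy : ∀ x, CauchySeq fun N : ℕ => heatKernelTrunc n k x t (-N, N) := fun x => by
    refine Metric.cauchySeq_iff.2 fun ε hε => ?_
    obtain ⟨R, hR⟩ := hsub (ε / 2) (half_pos hε)
    obtain ⟨N₀, hN₀⟩ := exists_nat_ge R
    refine ⟨N₀, fun N hN M hM => ?_⟩
    have hN' : (N₀ : ℝ) ≤ N := by exact_mod_cast hN
    have hM' : (N₀ : ℝ) ≤ M := by exact_mod_cast hM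
    rw [dist_eq_norm]
    exact (hR x _ _ _ _ (by linarith) (by linarith) (by linarith) (by linarith)).trans_lt
      (half_lt_self hε)
  choose p hp using fun x => cauchySeq_tendsto_of_complete (hcauchy x)
  have hlim : ∀ ε > 0, ∃ R : ℝ, ∀ x a b, a ≤ -R → R ≤ b →
      ‖heatKernelTrunc n k x t (a, b) - p x‖ ≤ ε := fun ε hε => by
    obtain ⟨R, hR⟩ := hsub ε hε
    refine ⟨R, fun x a b ha hb => ?_⟩
    refine le_of_tendsto ((hp x).const_sub (heatKernelTrunc n k x t (a, b))).norm ?_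
    filter_upwards [tendsto_natCast_atTop_atTop.eventually_ge_atTop R] with N hN
    exact hR x a b _ _ ha hb (by linarith) hN
  refine ⟨p, fun x => ?_, ?_⟩
  · refine Metric.tendsto_nhds.2 fun ε hε => ?_
    obtain ⟨R, hR⟩ := hlim (ε / 2) (half_pos hε)
    filter_upwards [prod_mem_prod (Iic_mem_atBot (-R)) (Ici_mem_atTop R)] with r hr
    rw [dist_eq_norm]
    exact (hR x r.1 r.2 hr.1 hr.2).trans_lt (half_lt_self hε)
  · refine Metric.tendstoUniformly_iff.2 fun ε hε => ?_
    obtain ⟨R, hR⟩ := hlim (ε / 2) (half_pos hε)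
    filter_upwards [tendsto_natCast_atTop_atTop.eventually_ge_atTop R] with N hN x
    rw [dist_comm, dist_eq_norm]
    exact (hR x _ _ (by linarith) hN).trans_lt (half_lt_self hε)

theorem tendsto_heatKernelTrunc (x : ℝ) {t : ℝ} (ht : 0 < t) :
    Tendsto (heatKernelTrunc n k x t) (atBot ×ˢ atTop) (𝓝 (heatKernel n k x t)) := by
  obtain ⟨p, hp, -⟩ := exists_tendsto_heatKernelTrunc hn hk ht
  exact tendsto_nhds_limUnder ⟨p x, hp x⟩

lemma tendstoUniformly_heatKernelTrunc {t : ℝ} (ht : 0 < t) :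
    TendstoUniformly (fun (N : ℕ) x => heatKernelTrunc n k x t (-N, N))
      (fun x => heatKernel n k x t) atTop := by
  obtain ⟨p, hp, hu⟩ := exists_tendsto_heatKernelTrunc hn hk ht
  have : (fun x => heatKernel n k x t) = p :=
    funext fun x => tendsto_nhds_unique (tendsto_heatKernelTrunc hn hk x ht) (hp x)
  rwa [this]

omit hn hk in
lemma continuous_heatKernelTrunc (a b : ℝ) :
    Continuous fun p : ℝ × ℝ => heatKernelTrunc n k p.1 p.2 (a, b) := by
  have h : Continuous fun p : ℝ × ℝ => ∫ z in a..b, heatIntegrand n k p.1 p.2 z :=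
    intervalIntegral.continuous_parametric_intervalIntegral_of_continuous'
      (f := fun (p : ℝ × ℝ) z => heatIntegrand n k p.1 p.2 z) (continuous_heatIntegrand n k) a b
  exact h.const_mul _

lemma continuous_heatKernel {t : ℝ} (ht : 0 < t) : Continuous fun x => heatKernel n k x t := by
  have h1 : Continuous fun x : ℝ => (x, t) := by fun_prop
  have h2 : ∀ N : ℕ, Continuous fun x => heatKernelTrunc n k x t (-N, N) := fun N => by
    have h3 := (continuous_heatKernelTrunc (n := n) (k := k) (-(N : ℝ)) N).comp h1
    simpa only [Function.comp_def] using h3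
  exact (tendstoUniformly_heatKernelTrunc hn hk ht).continuous (Frequently.of_forall h2)

lemma norm_heatKernelTrunc_le (x a b : ℝ) {t : ℝ} (ht : 0 < t) :
    ‖heatKernelTrunc n k x t (a, b)‖ ≤ 20 * (1 + t ^ (-(1 / 2) : ℝ)) := by
  rw [heatKernelTrunc, norm_mul, Complex.norm_real, Real.norm_of_nonneg (by positivity)]
  have h : 1 / (2 * Real.pi) ≤ 1 := by
    rw [div_le_one (by positivity)]; linarith [Real.pi_gt_three]
  have h2 := norm_integral_heatIntegrand_le hn hk x a (b := b) ht
  calc _ ≤ 1 * (20 * (1 + t ^ (-(1 / 2) : ℝ))) := by gcongr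
    _ = _ := one_mul _

/-- The singularity u^(-1/2) at u = 0 is integrable against the bounded density, and this gives
absolute convergence of the integral for u_α. -/
lemma norm_heatKernel_le (x : ℝ) {t : ℝ} (ht : 0 < t) :
    ‖heatKernel n k x t‖ ≤ 20 * (1 + t ^ (-(1 / 2) : ℝ)) :=
  le_of_tendsto (tendsto_heatKernelTrunc hn hk x ht).norm
    (Eventually.of_forall fun r => norm_heatKernelTrunc_le hn hk x r.1 r.2 ht)

lemma tendsto_heatKernelTrunc_nat (x : ℝ) {t : ℝ} (ht : 0 < t) :
    Tendsto (fun N : ℕ => heatKernelTrunc n k x t (-N, N)) atTop (𝓝 (heatKernel n k x t)) :=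
  (tendstoUniformly_heatKernelTrunc hn hk ht).tendsto_at x

end HeatKernel

end FracHeat

namespace FracHeat

/-! ### The density `v̄` -/

lemma vbar_eq (α u t : ℝ) : vbar α u t = (t ^ α)⁻¹ * mWright α (u / t ^ α) := by
  rw [vbar, mWright, one_div, neg_div]

section
variable {α : ℝ} (h0 : 0 < α) (h1 : α < 1) {t : ℝ} (ht : 0 < t)
include ht

/-- Self-similarity: the substitution u = t^α v reduces every integral against the density to one
against M. -/
lemma integral_vbar_smul {E : Type*} [NormedAddCommGroup E] [NormedSpace ℝ E] (g : ℝ → E) :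
    ∫ u in Ioi (0 : ℝ), vbar α u t • g u = ∫ v in Ioi (0 : ℝ), mWright α v • g (t ^ α * v) := by
  have hc : 0 < t ^ α := Real.rpow_pos_of_pos ht α
  have h := integral_comp_mul_left_Ioi (fun u => mWright α (u / t ^ α) • g u) 0 hc
  simp only [mul_zero, mul_div_cancel_left₀ _ hc.ne'] at h
  rw [h, ← integral_smul]
  simp_rw [vbar_eq, mul_smul]

include h0 h1

lemma vbar_nonneg {u : ℝ} (hu : 0 ≤ u) : 0 ≤ vbar α u t := by
  rw [vbar_eq]
  exact mul_nonneg (by positivity) (mWright_nonneg h0 h1 (by positivity))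

lemma continuousOn_vbar : ContinuousOn (fun u => vbar α u t) (Ici 0) := by
  have hc : 0 < t ^ α := Real.rpow_pos_of_pos ht α
  simp_rw [vbar_eq]
  refine continuousOn_const.mul ((continuousOn_mWright h0 h1).comp (by fun_prop) fun u hu => ?_)
  exact div_nonneg hu hc.le

lemma aestronglyMeasurable_vbar :
    AEStronglyMeasurable (fun u => vbar α u t) (volume.restrict (Ioi 0)) :=
  ((continuousOn_vbar h0 h1 ht).mono Ioi_subset_Ici_self).aestronglyMeasurable measurableSet_Ioi

lemma exists_vbar_le : ∃ C l : ℝ, 0 < l ∧ ∀ u, 0 ≤ u → vbar α u t ≤ C * Real.exp (-l * u) := by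
  have hc : 0 < t ^ α := Real.rpow_pos_of_pos ht α
  obtain ⟨C, hC, h⟩ := exists_abs_mWright_le h0 h1 1
  refine ⟨(t ^ α)⁻¹ * C, (t ^ α)⁻¹, by positivity, fun u hu => ?_⟩
  rw [vbar_eq, mul_assoc]
  gcongr
  refine (le_abs_self _).trans ((h _ (by positivity)).trans_eq ?_)
  congr 2
  ring

lemma integrableOn_rpow_mul_vbar {s : ℝ} (hs : -1 < s) :
    IntegrableOn (fun u => u ^ s * vbar α u t) (Ioi 0) := by
  obtain ⟨C, l, hl, h⟩ := exists_vbar_le h0 h1 ht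
  refine ((integrableOn_rpow_mul_exp_neg hs hl).const_mul C).mono'
    ((measurable_id.pow_const s).aestronglyMeasurable.mul (aestronglyMeasurable_vbar h0 h1 ht)) ?_
  filter_upwards [ae_restrict_mem measurableSet_Ioi] with u hu
  have hu' : (0 : ℝ) < u := hu
  have hus : 0 ≤ u ^ s := by positivity
  rw [Real.norm_of_nonneg (mul_nonneg hus (vbar_nonneg h0 h1 ht hu'.le)), mul_left_comm]
  gcongr
  exact h u hu'.le

lemma integrableOn_vbar : IntegrableOn (fun u => vbar α u t) (Ioi 0) := by
  simpa using integrableOn_rpow_mul_vbar h0 h1 ht (s := 0) (by norm_num)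

lemma integral_vbar : ∫ u in Ioi (0 : ℝ), vbar α u t = 1 := by
  have h := integral_vbar_smul (α := α) ht (fun _ => (1 : ℝ))
  simp only [smul_eq_mul, mul_one] at h
  rw [h]
  simpa using integral_pow_mul_mWright h0 h1 0

lemma integral_Ici_vbar : ∫ u in Ici (0 : ℝ), vbar α u t = 1 := by
  rw [integral_Ici_eq_integral_Ioi, integral_vbar h0 h1 ht]

lemma integrableOn_Ici_vbar : IntegrableOn (fun u => vbar α u t) (Ici 0) :=
  (integrableOn_Ici_iff_integrableOn_Ioi (by simp)).2 (integrableOn_vbar h0 h1 ht)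

theorem isProbabilityMeasure_randomTimeLaw : IsProbabilityMeasure (randomTimeLaw α t) := by
  constructor
  rw [randomTimeLaw, withDensity_apply _ MeasurableSet.univ, Measure.restrict_univ,
    ← ofReal_integral_eq_lintegral_ofReal (integrableOn_Ici_vbar h0 h1 ht),
    integral_Ici_vbar h0 h1 ht, ENNReal.ofReal_one]
  filter_upwards [ae_restrict_mem measurableSet_Ici] with u hu
  exact vbar_nonneg h0 h1 ht hu

lemma integral_randomTimeLaw (g : ℝ → ℂ) :
    ∫ u, g u ∂(randomTimeLaw α t) = ∫ u in Ioi (0 : ℝ), g u * (vbar α u t : ℂ) := by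
  rw [randomTimeLaw, integral_withDensity_eq_integral_toReal_smul₀
    (((continuousOn_vbar h0 h1 ht).aemeasurable measurableSet_Ici).ennreal_ofReal)
    (Eventually.of_forall fun u => ENNReal.ofReal_lt_top), integral_Ici_eq_integral_Ioi]
  refine setIntegral_congr_fun measurableSet_Ioi fun u hu => ?_
  rw [ENNReal.toReal_ofReal (vbar_nonneg h0 h1 ht (le_of_lt hu)), Complex.real_smul, mul_comm]

lemma continuous_vbar_abs : Continuous fun u => vbar α |u| t :=
  continuousOn_univ.1 ((continuousOn_vbar h0 h1 ht).comp (by fun_prop) fun u _ => abs_nonneg u)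

theorem tendsto_half_vbar_abs :
    Tendsto (fun u : ℝ => 1 / 2 * vbar α |u| t) (cocompact ℝ) (𝓝 0) := by
  obtain ⟨C, l, hl, h⟩ := exists_vbar_le h0 h1 ht
  have hlim : Tendsto (fun u : ℝ => 1 / 2 * (C * Real.exp (-l * |u|))) (cocompact ℝ) (𝓝 0) := by
    have h2 : Tendsto (fun u : ℝ => -l * |u|) (cocompact ℝ) atBot :=
      (tendsto_norm_cocompact_atTop (E := ℝ)).const_mul_atTop_of_neg (by linarith)
    have h3 := ((Real.tendsto_exp_atBot.comp h2).const_mul C).const_mul (1 / 2 : ℝ)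
    rw [mul_zero, mul_zero] at h3
    exact h3
  refine squeeze_zero (fun u => ?_) (fun u => ?_) hlim
  · exact mul_nonneg (by norm_num) (vbar_nonneg h0 h1 ht (abs_nonneg u))
  · gcongr
    exact h _ (abs_nonneg u)

omit h0 h1 in
/-- `v̄` has Laplace transform `E_α(z t^α)`. -/
lemma integral_cexp_mul_vbar (z : ℂ) :
    ∫ u in Ioi (0 : ℝ), Complex.exp (u * z) * (vbar α u t : ℂ) =
      mWrightLaplace α 0 (z * ((t ^ α : ℝ) : ℂ)) := by
  have h := integral_vbar_smul (α := α) ht (fun u : ℝ => Complex.exp (u * z))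
  simp_rw [Complex.real_smul] at h
  rw [mWrightLaplace]
  refine Eq.trans ?_ (h.trans ?_)
  · congr 1; ext u; ring
  · congr 1; ext u
    rw [pow_zero, one_mul, mul_comm]
    congr 2
    push_cast
    ring

/-! ### The fractional diffusion equation -/

-- Fubini, then Fourier inversion: for fixed u, the exponential e^(2πiξru) integrated against 𝓕φ
-- returns φ(ru).
omit ht in
lemma integral_fourier_mul_mWrightLaplace (φ : 𝓢(ℝ, ℂ)) (r : ℝ) :
    ∫ ξ, (𝓕 φ : 𝓢(ℝ, ℂ)) ξ * mWrightLaplace α 0 (2 * Real.pi * ξ * Complex.I * r) =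
      ∫ u in Ioi (0 : ℝ), mWright α u • φ (r * u) := by
  set f : ℝ → ℝ → ℂ := fun ξ u => (𝓕 φ : 𝓢(ℝ, ℂ)) ξ *
    (Complex.exp (2 * Real.pi * ξ * Complex.I * r * u) * mWright α u) with hf
  have hint : Integrable (Function.uncurry f) (volume.prod (volume.restrict (Ioi (0 : ℝ)))) := by
    have h2 := ((𝓕 φ : 𝓢(ℝ, ℂ)).integrable (μ := volume)).mul_prod
      ((integrableOn_mWright h0 h1).ofReal (𝕜 := ℂ))
    have h3 : Continuous fun z : ℝ × ℝ => Complex.exp (2 * Real.pi * z.1 * Complex.I * r * z.2) := by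
      fun_prop
    refine (h2.bdd_mul (c := 1) h3.aestronglyMeasurable (Eventually.of_forall fun z => ?_)).congr
      (Eventually.of_forall fun z => ?_)
    · rw [Complex.norm_exp]
      simp
    · simp only [Function.uncurry, hf]
      rw [mul_left_comm]
      rfl
  have e1 : ∀ ξ : ℝ, (𝓕 φ : 𝓢(ℝ, ℂ)) ξ * mWrightLaplace α 0 (2 * Real.pi * ξ * Complex.I * r) =
      ∫ u in Ioi (0 : ℝ), f ξ u := fun ξ => by
    simp only [hf]
    rw [integral_const_mul, mWrightLaplace]
    simp
  simp_rw [e1]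
  rw [integral_integral_swap hint]
  congr 1; ext u
  have e2 : φ (r * u) = (𝓕⁻ (𝓕 φ : 𝓢(ℝ, ℂ)) : 𝓢(ℝ, ℂ)) (r * u) := by
    rw [FourierTransform.fourierInv_fourier_eq]
  rw [e2, SchwartzMap.fourierInv_coe, Real.fourierInv_eq', Complex.real_smul, ← integral_const_mul]
  congr 1; ext ξ
  simp only [hf, smul_eq_mul, RCLike.inner_apply, conj_trivial]
  push_cast
  ring_nf

/-- The two exponents ±2πiξt^α in the symbol produce the integrals of φ over the two half-lines
against the same density. -/
lemma isGivenBy_half_vbar {U : 𝓢'(ℝ, ℂ)}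
    (hU : ∀ φ : 𝓢(ℝ, ℂ), U φ = ∫ ξ, (𝓕 φ : 𝓢(ℝ, ℂ)) ξ *
      ((mWrightLaplace α 0 (2 * Real.pi * ξ * Complex.I * ((t ^ α : ℝ) : ℂ)) +
        mWrightLaplace α 0 (-(2 * Real.pi * ξ * Complex.I * ((t ^ α : ℝ) : ℂ)))) / 2)) :
    IsGivenBy U fun u => ((1 / 2 * vbar α |u| t : ℝ) : ℂ) := by
  intro φ
  have hbd : ∃ C : ℝ, ∀ u, ‖((1 / 2 * vbar α |u| t : ℝ) : ℂ)‖ ≤ C := by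
    obtain ⟨C, l, hl, h⟩ := exists_vbar_le h0 h1 ht
    refine ⟨|C|, fun u => ?_⟩
    have h3 := vbar_nonneg h0 h1 ht (abs_nonneg u)
    have h4 := h |u| (abs_nonneg u)
    have h5 : Real.exp (-l * |u|) ≤ 1 := Real.exp_le_one_iff.2 (by nlinarith [abs_nonneg u])
    have h6 : C * Real.exp (-l * |u|) ≤ |C| * 1 := by
      gcongr
      exact le_abs_self C
    rw [Complex.norm_real, Real.norm_of_nonneg (by positivity)]
    linarith
  have hc : Continuous fun u => ((1 / 2 * vbar α |u| t : ℝ) : ℂ) :=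
    Complex.continuous_ofReal.comp (continuous_const.mul (continuous_vbar_abs h0 h1 ht))
  obtain ⟨C, hC⟩ := hbd
  have hint : Integrable fun x => φ x * ((1 / 2 * vbar α |x| t : ℝ) : ℂ) := by
    refine ((φ.integrable (μ := volume)).bdd_mul (c := C) hc.aestronglyMeasurable
      (Eventually.of_forall hC)).congr (Eventually.of_forall fun x => mul_comm _ _)
  refine ⟨hint, ?_⟩
  have hF : ∀ r : ℝ, Integrable fun ξ : ℝ => (𝓕 φ : 𝓢(ℝ, ℂ)) ξ *
      mWrightLaplace α 0 (2 * Real.pi * ξ * Complex.I * r) := fun r => by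
    have h3 : Continuous fun ξ : ℝ => mWrightLaplace α 0 (2 * Real.pi * ξ * Complex.I * r) :=
      (continuous_mWrightLaplace h0 h1 0).comp (by fun_prop)
    refine (((𝓕 φ : 𝓢(ℝ, ℂ)).integrable (μ := volume)).bdd_mul h3.aestronglyMeasurable
      (Eventually.of_forall fun ξ => norm_mWrightLaplace_le h0 h1 0 ?_)).congr
      (Eventually.of_forall fun x => mul_comm _ _)
    simp
  have e1 : U φ = 1 / 2 * ((∫ u in Ioi (0 : ℝ), mWright α u • φ (t ^ α * u)) +
      ∫ u in Ioi (0 : ℝ), mWright α u • φ (-(t ^ α) * u)) := by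
    rw [hU, ← integral_fourier_mul_mWrightLaplace h0 h1, ← integral_fourier_mul_mWrightLaplace h0 h1,
      ← integral_add (hF _) (hF _), ← integral_const_mul]
    congr 1; ext ξ
    push_cast
    rw [mul_neg]
    ring
  have e2 := integral_vbar_smul (α := α) ht φ
  have e3 := integral_vbar_smul (α := α) ht fun u => φ (-u)
  simp_rw [← neg_mul] at e3
  rw [e1, ← e2, ← e3, ← intervalIntegral.integral_Iic_add_Ioi (b := 0) hint.integrableOn
    hint.integrableOn]
  have e4 := integral_comp_neg_Iic 0 fun x => φ (-x) * ((1 / 2 * vbar α |x| t : ℝ) : ℂ)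
  simp only [neg_neg, abs_neg, neg_zero] at e4
  rw [e4, mul_add, ← integral_const_mul, ← integral_const_mul, add_comm]
  congr 1 <;> refine setIntegral_congr_fun measurableSet_Ioi fun u hu => ?_ <;>
  · simp only [abs_of_pos (show 0 < u from hu), Complex.real_smul]
    push_cast
    ring

end

end FracHeat

namespace FracHeat

/-! ### The Fourier transform of the kernel and of the solution -/

lemma derivSymbol_neg_inv_mul (n : ℕ) (z : ℝ) :
    derivSymbol n (-(2 * Real.pi)⁻¹ * z) = (Complex.I * z) ^ n := by
  rw [derivSymbol]
  congr 1
  have : (Real.pi : ℂ) ≠ 0 := by exact_mod_cast Real.pi_ne_zero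
  push_cast
  field_simp

lemma heatIntegrand_eq (n : ℕ) (k x t z : ℝ) :
    heatIntegrand n k x t z = Complex.exp (Complex.I * x * z) *
      Complex.exp (t * (k * derivSymbol n (-(2 * Real.pi)⁻¹ * z))) := by
  rw [heatIntegrand, derivSymbol_neg_inv_mul, ← Complex.exp_add]
  congr 1
  ring

section
variable {n : ℕ} {k : ℝ} (hk : IsHeatCoeff n k)
include hk

lemma norm_cexp_mul_derivSymbol_le {t : ℝ} (ht : 0 ≤ t) (ξ : ℝ) :
    ‖Complex.exp (t * (k * derivSymbol n ξ))‖ ≤ 1 := by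
  rw [Complex.norm_exp, Complex.re_ofReal_mul]
  exact Real.exp_le_one_iff.2 (mul_nonpos_of_nonneg_of_nonpos ht (re_mul_derivSymbol_nonpos hk ξ))

omit hk in
lemma continuous_cexp_mul_derivSymbol :
    Continuous fun p : ℝ × ℝ => Complex.exp (p.1 * (k * derivSymbol n p.2)) := by
  have := (continuous_derivSymbol n).comp (continuous_snd (X := ℝ) (Y := ℝ))
  simp only [Function.comp_def] at this
  fun_prop

lemma integrable_fourier_mul_cexp (φ : 𝓢(ℝ, ℂ)) {t : ℝ} (ht : 0 ≤ t) :
    Integrable fun ξ => (𝓕 φ : 𝓢(ℝ, ℂ)) ξ * Complex.exp (t * (k * derivSymbol n ξ)) := by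
  have hc : Continuous fun ξ => Complex.exp (t * (k * derivSymbol n ξ)) :=
    (continuous_cexp_mul_derivSymbol (n := n) (k := k)).comp (Continuous.prodMk_right t)
  exact (((𝓕 φ : 𝓢(ℝ, ℂ)).integrable (μ := volume)).bdd_mul (c := 1) hc.aestronglyMeasurable
    (Eventually.of_forall fun ξ => norm_cexp_mul_derivSymbol_le hk ht ξ)).congr
    (Eventually.of_forall fun ξ => mul_comm _ _)

/-- The range of z is bounded, so Fubini applies although p_n itself need not be given by an
absolutely convergent integral; the x-integral is 𝓕φ at -z/(2π). -/
lemma integral_mul_heatKernelTrunc (φ : 𝓢(ℝ, ℂ)) {t : ℝ} (ht : 0 < t) {a b : ℝ} (hab : a ≤ b) :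
    ∫ x, φ x * heatKernelTrunc n k x t (a, b) = ((1 / (2 * Real.pi) : ℝ) : ℂ) *
      ∫ z in a..b, (𝓕 φ : 𝓢(ℝ, ℂ)) (-(2 * Real.pi)⁻¹ * z) *
        Complex.exp (t * (k * derivSymbol n (-(2 * Real.pi)⁻¹ * z))) := by
  set c : ℂ := ((1 / (2 * Real.pi) : ℝ) : ℂ) with hc
  have hp : (Real.pi : ℂ) ≠ 0 := by exact_mod_cast Real.pi_ne_zero
  set f : ℝ → ℝ → ℂ := fun x z => φ x * heatIntegrand n k x t z with hf
  have hint : Integrable (Function.uncurry f) (volume.prod (volume.restrict (Ioc a b))) := by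
    have h2 := (φ.integrable (μ := volume)).mul_prod
      (integrable_const (μ := (volume : Measure ℝ).restrict (Ioc a b)) (1 : ℂ))
    have h3 : Continuous fun p : ℝ × ℝ => heatIntegrand n k p.1 t p.2 := by
      unfold heatIntegrand; fun_prop
    refine (h2.bdd_mul (c := 1) h3.aestronglyMeasurable (Eventually.of_forall fun p => ?_)).congr
      (Eventually.of_forall fun p => ?_)
    · rw [heatIntegrand_eq, norm_mul]
      have h4 : ‖Complex.exp (Complex.I * p.1 * p.2)‖ = 1 := by rw [Complex.norm_exp]; simp
      rw [h4, one_mul]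
      exact norm_cexp_mul_derivSymbol_le hk ht.le _
    · simp only [Function.uncurry, hf]
      ring
  have e1 : ∀ x, φ x * heatKernelTrunc n k x t (a, b) = c * ∫ z in Ioc a b, f x z := fun x => by
    simp only [hf]
    rw [heatKernelTrunc, intervalIntegral.integral_of_le hab, integral_const_mul]
    ring
  simp_rw [e1]
  rw [integral_const_mul, integral_integral_swap hint, intervalIntegral.integral_of_le hab]
  refine congrArg _ (congrArg (fun g => ∫ z in Ioc a b, g z) (funext fun z => ?_))
  rw [SchwartzMap.fourier_coe, Real.fourier_eq', ← integral_mul_const]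
  congr 1; ext x
  simp only [hf, heatIntegrand_eq, smul_eq_mul, RCLike.inner_apply, conj_trivial]
  have h5 : Complex.I * x * z = ((-2 * Real.pi * (-(2 * Real.pi)⁻¹ * z * x) : ℝ) : ℂ) * Complex.I := by
    push_cast
    field_simp
  rw [h5]
  ring

variable (hn : 2 ≤ n)
include hn

/-- The kernel `p_n(·,t)` has Fourier symbol `exp (t k (-2πiξ)^n)`. -/
lemma integral_mul_heatKernel (φ : 𝓢(ℝ, ℂ)) {t : ℝ} (ht : 0 < t) :
    ∫ x, φ x * heatKernel n k x t =
      ∫ ξ, (𝓕 φ : 𝓢(ℝ, ℂ)) ξ * Complex.exp (t * (k * derivSymbol n ξ)) := by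
  set h : ℝ → ℂ := fun ξ => (𝓕 φ : 𝓢(ℝ, ℂ)) ξ * Complex.exp (t * (k * derivSymbol n ξ)) with hh
  have hp := Real.pi_pos
  have hr : -(2 * Real.pi)⁻¹ ≠ 0 := neg_ne_zero.2 (inv_ne_zero (by positivity))
  have hi : Integrable fun z : ℝ => h (-(2 * Real.pi)⁻¹ * z) :=
    (integrable_fourier_mul_cexp hk φ ht.le).comp_mul_left' hr
  -- The frequency side converges because 𝓕φ is integrable and the exponential has modulus at most
  -- 1; the change of variable ξ = -z/(2π) absorbs the factor 1/(2π). The space side converges by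
  -- domination, the truncated kernels being bounded uniformly in x and N.
  have l1 : Tendsto (fun N : ℕ => ((1 / (2 * Real.pi) : ℝ) : ℂ) *
      ∫ z in (-(N : ℝ))..N, h (-(2 * Real.pi)⁻¹ * z)) atTop (𝓝 (∫ ξ, h ξ)) := by
    have := (intervalIntegral_tendsto_integral hi
      (tendsto_neg_atTop_atBot.comp tendsto_natCast_atTop_atTop)
      (tendsto_natCast_atTop_atTop (R := ℝ))).const_mul ((1 / (2 * Real.pi) : ℝ) : ℂ)
    rw [Measure.integral_comp_mul_left, Complex.real_smul, ← mul_assoc, ← Complex.ofReal_mul,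
      show 1 / (2 * Real.pi) * |(-(2 * Real.pi)⁻¹)⁻¹| = 1 by
        rw [inv_neg, inv_inv, abs_neg, abs_of_pos (by positivity)]; field_simp,
      Complex.ofReal_one, one_mul] at this
    exact this
  have l2 : Tendsto (fun N : ℕ => ∫ x, φ x * heatKernelTrunc n k x t (-N, N)) atTop
      (𝓝 (∫ x, φ x * heatKernel n k x t)) := by
    refine tendsto_integral_of_dominated_convergence
      (fun x => ‖φ x‖ * (20 * (1 + t ^ (-(1 / 2) : ℝ)))) (fun N => ?_)
      ((φ.integrable (μ := volume)).norm.mul_const _) (fun N => Eventually.of_forall fun x => ?_)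
      (Eventually.of_forall fun x => (tendsto_heatKernelTrunc_nat hn hk x ht).const_mul _)
    · have h1 : Continuous fun x : ℝ => (x, t) := by fun_prop
      have h3 := (continuous_heatKernelTrunc (n := n) (k := k) (-(N : ℝ)) N).comp h1
      simp only [Function.comp_def] at h3
      exact (φ.continuous.mul h3).aestronglyMeasurable
    · rw [norm_mul]
      gcongr
      exact norm_heatKernelTrunc_le hn hk x _ _ ht
  refine tendsto_nhds_unique l2 (l1.congr fun N => ?_)
  rw [integral_mul_heatKernelTrunc hk φ ht (by linarith [(N.cast_nonneg : (0 : ℝ) ≤ N)])]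

/-- The kernel is only defined through a limit, so joint measurability comes from the continuous
truncations along the integers. -/
lemma aestronglyMeasurable_heatKernel :
    AEStronglyMeasurable (fun p : ℝ × ℝ => heatKernel n k p.1 p.2)
      ((volume : Measure ℝ).prod (volume.restrict (Ioi (0 : ℝ)))) := by
  have hprod : (volume : Measure ℝ).prod (volume.restrict (Ioi (0 : ℝ))) =
      ((volume : Measure ℝ).prod volume).restrict (univ ×ˢ Ioi (0 : ℝ)) := by
    rw [← Measure.prod_restrict, Measure.restrict_univ]
  refine aestronglyMeasurable_of_tendsto_ae atTop
    (f := fun (N : ℕ) (p : ℝ × ℝ) => heatKernelTrunc n k p.1 p.2 (-N, N))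
    (fun N => (continuous_heatKernelTrunc (-(N : ℝ)) N).aestronglyMeasurable) ?_
  rw [hprod]
  filter_upwards [ae_restrict_mem (MeasurableSet.univ.prod measurableSet_Ioi)] with p hp
  exact tendsto_heatKernelTrunc_nat hn hk p.1 hp.2

lemma aestronglyMeasurable_heatKernel_right (x : ℝ) :
    AEStronglyMeasurable (fun u => heatKernel n k x u) (volume.restrict (Ioi (0 : ℝ))) := by
  refine aestronglyMeasurable_of_tendsto_ae atTop
    (f := fun (N : ℕ) u => heatKernelTrunc n k x u (-N, N)) (fun N => ?_) ?_
  · have h1 : Continuous fun u : ℝ => (x, u) := by fun_prop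
    have h3 := (continuous_heatKernelTrunc (n := n) (k := k) (-(N : ℝ)) N).comp h1
    simp only [Function.comp_def] at h3
    exact h3.aestronglyMeasurable
  · filter_upwards [ae_restrict_mem measurableSet_Ioi] with u hu
    exact tendsto_heatKernelTrunc_nat hn hk x hu

variable {α : ℝ} (h0 : 0 < α) (h1 : α < 1) {t : ℝ} (ht : 0 < t)
include h0 h1 ht

omit hk hn in
lemma integrableOn_bound_mul_vbar :
    IntegrableOn (fun u => 20 * (1 + u ^ (-(1 / 2) : ℝ)) * vbar α u t) (Ioi 0) := by
  have h := ((integrableOn_vbar h0 h1 ht).add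
    (integrableOn_rpow_mul_vbar h0 h1 ht (s := -(1 / 2)) (by norm_num))).const_mul 20
  refine h.congr (Eventually.of_forall fun u => ?_)
  simp only [Pi.add_apply]
  ring

lemma norm_heatKernel_mul_vbar_le (x : ℝ) {u : ℝ} (hu : 0 < u) :
    ‖heatKernel n k x u * (vbar α u t : ℂ)‖ ≤ 20 * (1 + u ^ (-(1 / 2) : ℝ)) * vbar α u t := by
  rw [norm_mul, Complex.norm_real, Real.norm_of_nonneg (vbar_nonneg h0 h1 ht hu.le)]
  gcongr
  · exact vbar_nonneg h0 h1 ht hu.le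
  · exact norm_heatKernel_le hn hk x hu

omit hk hn in
lemma aestronglyMeasurable_ofReal_vbar :
    AEStronglyMeasurable (fun u => (vbar α u t : ℂ)) (volume.restrict (Ioi 0)) :=
  Complex.continuous_ofReal.comp_aestronglyMeasurable (aestronglyMeasurable_vbar h0 h1 ht)

theorem integrableOn_heatKernel_mul_vbar (x : ℝ) :
    IntegrableOn (fun u => heatKernel n k x u * (vbar α u t : ℂ)) (Ioi 0) := by
  refine (integrableOn_bound_mul_vbar h0 h1 ht).mono'
    ((aestronglyMeasurable_heatKernel_right hk hn x).mul
      (aestronglyMeasurable_ofReal_vbar h0 h1 ht)) ?_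
  filter_upwards [ae_restrict_mem measurableSet_Ioi] with u hu
  exact norm_heatKernel_mul_vbar_le hk hn h0 h1 ht x hu

lemma continuous_uSol : Continuous fun x => uSol α n k x t := by
  unfold uSol
  refine continuous_of_dominated (bound := fun u => 20 * (1 + u ^ (-(1 / 2) : ℝ)) * vbar α u t)
    (fun x => (integrableOn_heatKernel_mul_vbar hk hn h0 h1 ht x).aestronglyMeasurable)
    (fun x => ?_) (integrableOn_bound_mul_vbar h0 h1 ht) ?_
  · filter_upwards [ae_restrict_mem measurableSet_Ioi] with u hu
    exact norm_heatKernel_mul_vbar_le hk hn h0 h1 ht x hu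
  · filter_upwards [ae_restrict_mem measurableSet_Ioi] with u hu
    exact (continuous_heatKernel hn hk hu).mul continuous_const

/-- Fubini is used once in space and once in frequency. In between, for each fixed u, the pairing
with p_n(·,u) is replaced by its Fourier symbol e^(ukσ), and averaging that over the density gives
E_α(kσt^α). -/
lemma isGivenBy_uSol {U : 𝓢'(ℝ, ℂ)}
    (hU : ∀ φ : 𝓢(ℝ, ℂ), U φ = ∫ ξ, (𝓕 φ : 𝓢(ℝ, ℂ)) ξ *
      mWrightLaplace α 0 (k * derivSymbol n ξ * ((t ^ α : ℝ) : ℂ))) :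
    IsGivenBy U fun x => uSol α n k x t := by
  intro φ
  set f : ℝ → ℝ → ℂ := fun x u => φ x * (heatKernel n k x u * (vbar α u t : ℂ)) with hf
  have hprod : (volume : Measure ℝ).prod (volume.restrict (Ioi (0 : ℝ))) =
      ((volume : Measure ℝ).prod volume).restrict (univ ×ˢ Ioi (0 : ℝ)) := by
    rw [← Measure.prod_restrict, Measure.restrict_univ]
  have hint : Integrable (Function.uncurry f) (volume.prod (volume.restrict (Ioi (0 : ℝ)))) := by
    have h2 := (φ.integrable (μ := volume)).norm.mul_prod (integrableOn_bound_mul_vbar h0 h1 ht)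
    refine h2.mono' ((φ.continuous.comp continuous_fst).aestronglyMeasurable.mul
      ((aestronglyMeasurable_heatKernel hk hn).mul
        (aestronglyMeasurable_ofReal_vbar h0 h1 ht).comp_snd)) ?_
    rw [hprod]
    filter_upwards [ae_restrict_mem (MeasurableSet.univ.prod measurableSet_Ioi)] with p hp
    simp only [Function.uncurry, hf]
    rw [norm_mul]
    gcongr
    exact norm_heatKernel_mul_vbar_le hk hn h0 h1 ht p.1 hp.2
  set g : ℝ → ℝ → ℂ := fun ξ u => (𝓕 φ : 𝓢(ℝ, ℂ)) ξ *
    (Complex.exp (u * (k * derivSymbol n ξ)) * (vbar α u t : ℂ)) with hg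
  have hgint : Integrable (Function.uncurry g) (volume.prod (volume.restrict (Ioi (0 : ℝ)))) := by
    have h2 := ((𝓕 φ : 𝓢(ℝ, ℂ)).integrable (μ := volume)).mul_prod
      ((integrableOn_vbar h0 h1 ht).ofReal (𝕜 := ℂ))
    have h3 : Continuous fun p : ℝ × ℝ => Complex.exp (p.2 * (k * derivSymbol n p.1)) :=
      (continuous_cexp_mul_derivSymbol (n := n) (k := k)).comp continuous_swap
    refine (h2.bdd_mul (c := 1) h3.aestronglyMeasurable ?_).congr
      (Eventually.of_forall fun p => ?_)
    · rw [hprod]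
      filter_upwards [ae_restrict_mem (MeasurableSet.univ.prod measurableSet_Ioi)] with p hp
      exact norm_cexp_mul_derivSymbol_le hk (le_of_lt hp.2) p.1
    · simp only [Function.uncurry, hg]
      rw [mul_left_comm]
      rfl
  have e1 : ∀ x, φ x * uSol α n k x t = ∫ u in Ioi (0 : ℝ), f x u := fun x => by
    simp only [hf]
    rw [uSol, integral_const_mul]
  simp_rw [e1]
  refine ⟨hint.integral_prod_left, ?_⟩
  have e2 : ∀ ξ, (𝓕 φ : 𝓢(ℝ, ℂ)) ξ *
      mWrightLaplace α 0 (k * derivSymbol n ξ * ((t ^ α : ℝ) : ℂ)) =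
      ∫ u in Ioi (0 : ℝ), g ξ u := fun ξ => by
    simp only [hg]
    rw [integral_const_mul, integral_cexp_mul_vbar ht]
  rw [hU]
  simp_rw [e2]
  rw [integral_integral_swap hint, integral_integral_swap hgint]
  refine setIntegral_congr_fun measurableSet_Ioi fun u hu => ?_
  have e3 := integral_mul_heatKernel hk hn φ hu
  simp only [hf, hg, ← mul_assoc]
  rw [integral_mul_const, integral_mul_const]
  simp only [mul_assoc]
  rw [e3]

end

end FracHeat


/-! ### Conclusion: the random time and the two fundamental solutions. -/

theorem theorem2p3 (α : ℝ) (hα0 : 0 < α) (hα1 : α < 1) (n : ℕ) (hn : 2 ≤ n) (k : ℝ)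
    (hk : FracHeat.IsHeatCoeff n k) :
    -- the improper integral defining `p_n` and the Wright series converge
    (∀ x t : ℝ, 0 < t →
      Tendsto (FracHeat.heatKernelTrunc n k x t) (atBot ×ˢ atTop)
        (𝓝 (FracHeat.heatKernel n k x t))) ∧
    (∀ x : ℝ, Summable (FracHeat.wrightTerm x (-α) (1 - α))) ∧
    -- `v̄_{2α}(·,t)` is a probability density on `[0, ∞)`
    (∀ t : ℝ, 0 < t →
      (∀ u : ℝ, 0 ≤ u → 0 ≤ FracHeat.vbar α u t) ∧
      IntegrableOn (fun u => FracHeat.vbar α u t) (Ici 0) ∧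
      (∫ u in Ici (0 : ℝ), FracHeat.vbar α u t) = 1 ∧
      IsProbabilityMeasure (FracHeat.randomTimeLaw α t)) ∧
    -- `v̄_{2α}` is the folded solution of the fractional diffusion equation of order `2α`
    FracHeat.IsTheFundamentalSolution (2 * α) 2 1
      (fun u t => ((1 / 2 * FracHeat.vbar α |u| t : ℝ) : ℂ)) ∧
    (∀ t : ℝ, 0 < t →
      Tendsto (fun u : ℝ => 1 / 2 * FracHeat.vbar α |u| t) (cocompact ℝ) (𝓝 0)) ∧
    -- `u_α(x,t) = ∫_0^∞ p_n(x,u) v̄_{2α}(u,t) du` is the fundamental solution, and it is the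
    -- expectation of `p_n(x, 𝒯_α(t))`
    (∀ x t : ℝ, 0 < t →
      IntegrableOn (fun u => FracHeat.heatKernel n k x u * (FracHeat.vbar α u t : ℂ)) (Ioi 0) ∧
      FracHeat.uSol α n k x t =
        ∫ u, FracHeat.heatKernel n k x u ∂(FracHeat.randomTimeLaw α t)) ∧
    FracHeat.IsTheFundamentalSolution α n k (FracHeat.uSol α n k) := by
  refine ⟨fun x t ht => FracHeat.tendsto_heatKernelTrunc hn hk x ht,
    fun x => (FracHeat.hasSum_wrightTerm hα0 hα1 x).summable,
    fun t ht => ⟨fun u hu => FracHeat.vbar_nonneg hα0 hα1 ht hu,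
      FracHeat.integrableOn_Ici_vbar hα0 hα1 ht, FracHeat.integral_Ici_vbar hα0 hα1 ht,
      FracHeat.isProbabilityMeasure_randomTimeLaw hα0 hα1 ht⟩,
    ⟨fun t ht => ?_, ?_⟩,
    fun t ht => FracHeat.tendsto_half_vbar_abs hα0 hα1 ht,
    fun x t ht => ⟨FracHeat.integrableOn_heatKernel_mul_vbar hk hn hα0 hα1 ht x,
      (FracHeat.integral_randomTimeLaw hα0 hα1 ht _).symm⟩,
    ⟨fun t ht => FracHeat.continuous_uSol hk hn hα0 hα1 ht, ?_⟩⟩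
  · exact Complex.continuous_ofReal.comp
      (continuous_const.mul (FracHeat.continuous_vbar_abs hα0 hα1 ht))
  · obtain ⟨U, hU, hUe⟩ := FracHeat.exists_fundamentalSolution_diffusion hα0 hα1
    exact ⟨U, hU, fun t ht => FracHeat.isGivenBy_half_vbar hα0 hα1 ht (hUe t ht),
      fun V hV t ht => hU.unique (by linarith) (by linarith) hV ht⟩
  · obtain ⟨U, hU, hUe⟩ := FracHeat.exists_fundamentalSolution_mWrightLaplace hα0 hα1
      (FracHeat.re_mul_derivSymbol_nonpos hk)
    exact ⟨U, hU, fun t ht => FracHeat.isGivenBy_uSol hk hn hα0 hα1 ht (hUe t ht),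
      fun V hV t ht => hU.unique hα0 (by linarith) hV ht⟩
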